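/- Let $n\ge 1$. For an $n\times n$ complex matrix $A$ write $\det(tI_n-A)=t^n+\sum_{j=1}^n(-1)^j\sigma_j(A)t^{n-j}$ and $\sigma(A)=(\sigma_1(A),\dots,\sigma_n(A))$. Let $\Omega_n$ be the spectral unit ball, i.e. the set of $n\times n$ complex matrices with spectral radius $<1$, and let $\mathbb G_n=\sigma(\Omega_n)\subset\mathbb C^n$ be the symmetrized polydisk. For a domain $D\subset\mathbb C^m$ and $z,w\in D$, the Lempert function is $$l_D(z,w)=\inf\{|\alpha| : \alpha\in\mathbb D,\ \exists\,\varphi:\mathbb D\to D \text{ holomorphic with } \varphi(0)=z,\ \varphi(\alpha)=w\},$$ where $\mathbb D\subset\mathbb C$ is the open unit disc. A matrix $A$ is called cyclic (non-derogatory) if there is a vector $v\in\mathbb C^n$ such that the vectors $A^kv$, $k\ge 0$, span $\mathbb C^n$. Let $A\in\Omega_n$. Then the function $l_{\Omega_n}(A,\cdot)$ is continuous on $\Omega_n$ if and only if either $A$ is a scalar matrix, or $n=2$ and $A$ is cyclic with two equal eigenvalues. Moreover, if $n\ge 2$, the following conditions are equivalent: (i) the function $l_{\Omega_n}:\Omega_n\times\Omega_n\to[0,1)$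 is (jointly) continuous at $(A,B)$ for every $B\in\Omega_n$; (ii) $l_{\Omega_n}(A,B)=l_{\mathbb G_n}(\sigma(A),\sigma(B))$ for every $B\in\Omega_n$; (iii) $n=2$ and $A$ is cyclic with two equal eigenvalues. -/

import Mathlib

open scoped ENNReal

/-- The Lempert function of a subset `D` of a complex topological vector space, an infimum
in `[0, ∞]` (so the infimum over no disc at all would be `∞`). -/
noncomputable def lempert {E : Type*} [AddCommGroup E] [Module ℂ E] [TopologicalSpace E]
    (D : Set E) (z w : E) : ℝ≥0∞ :=
  sInf {r | ∃ α ∈ Metric.ball (0 : ℂ) 1, r = ‖α‖ₑ ∧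
    ∃ φ : ℂ → E, DifferentiableOn ℂ φ (Metric.ball 0 1) ∧
      Set.MapsTo φ (Metric.ball 0 1) D ∧ φ 0 = z ∧ φ α = w}

/-- The spectral unit ball `Ω_n`. -/
def spectralBall (n : ℕ) : Set (Matrix (Fin n) (Fin n) ℂ) :=
  {A | spectralRadius ℂ A < 1}

/-- `σ(A) = (σ_1(A), …, σ_n(A))`, where
`det (t I - A) = t ^ n + ∑_{j=1}^n (-1) ^ j σ_j(A) t ^ (n - j)`.
The entry with index `j : Fin n` is `σ_{j+1}(A)`. -/
noncomputable def sigma {n : ℕ} (A : Matrix (Fin n) (Fin n) ℂ) : Fin n → ℂ :=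
  fun j => (-1) ^ ((j : ℕ) + 1) * A.charpoly.coeff (n - ((j : ℕ) + 1))

/-- The symmetrized polydisk `G_n = σ(Ω_n)`. -/
def symPolydisk (n : ℕ) : Set (Fin n → ℂ) := sigma '' spectralBall n

/-- A matrix is cyclic (non-derogatory) if it admits a cyclic vector. -/
def IsCyclicMatrix {n : ℕ} (A : Matrix (Fin n) (Fin n) ℂ) : Prop :=
  ∃ v : Fin n → ℂ,
    Submodule.span ℂ (Set.range fun k : ℕ => Matrix.mulVec (A ^ k) v) = ⊤

/-- `A` is a scalar matrix. -/
def IsScalarMatrix {n : ℕ} (A : Matrix (Fin n) (Fin n) ℂ) : Prop :=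
  ∃ c : ℂ, A = c • (1 : Matrix (Fin n) (Fin n) ℂ)

/-- `A` is a cyclic `2 × 2` matrix with two equal eigenvalues
(eigenvalues counted with algebraic multiplicity). -/
def IsCyclicTwoDouble {n : ℕ} (A : Matrix (Fin n) (Fin n) ℂ) : Prop :=
  n = 2 ∧ IsCyclicMatrix A ∧ ∃ μ : ℂ, A.charpoly.roots = {μ, μ}

/-!
Continuity of `l(A, ·)` and the identity `l(A, B) = l(σ(A), σ(B))` both imply that `l(A, B)` depends
only on the characteristic polynomial of `B`: conjugating a disc by a holomorphic family of
invertible matrices that is the identity at `0` shows that `l(A, ·)` is constant on conjugacy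
classes, and the closures of all the classes with given eigenvalues share the diagonal matrices.
This invariance is restrictive.

* Tilting the linear disc from `0` to a diagonal matrix `D`, while keeping the value at `0`
  nilpotent, brings `D` closer to the nilpotent matrices than its spectral radius, unless more than
  half of the eigenvalues are equal to the largest one. After Möbius transformations this leaves
  only matrices `A` with a single eigenvalue, which may be moved to `0`.
* If `A` is nilpotent and cyclic and `n ≥ 3`, invariance bounds `l(A, B)` by the Lempert function of
  the symmetrized polydisk, which is `O(t ^ 2)` for `B = diag(-(n - 1) t, t, …, t)`. But a disc
  joining `A` to `B` at `α` satisfies `t ^ n = O(|α| ^ (n - 1))`, since `det (φ - t)` vanishes to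
  order `n - 1` at `α`.
* If `A` is nilpotent, nonzero and derogatory, it degenerates to a matrix with one nonzero entry,
  whence explicit discs reach the eigenvalues `(n - 1 / 4) α, 0, …, 0` at a small `α`. Conversely, a
  disc from `A` to `diag(t, 0, …, 0)` has characteristic coefficients divisible by powers of
  `x - α`, and dividing them out gives a polynomial with roots of modulus at most `1 + o(1)`, one of
  which vanishes at `x = 0`. Hence `|t| ≤ (n - 1 / 2) |α|`, a contradiction.

For a cyclic `2 × 2` matrix with a double eigenvalue, moved to `0`, discs in the symmetrized bidisk
lift through companion matrices, and normal families give the continuity. For a scalar matrix,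
moved to `0`, the Lempert function is the spectral radius, which is continuous; but for `n ≥ 2` it
jumps down when the pole `0` is replaced by an arbitrarily small cyclic nilpotent matrix.
-/

open scoped Topology
open Metric

section Lempert

variable {E F : Type*} [NormedAddCommGroup E] [NormedSpace ℂ E]
  [NormedAddCommGroup F] [NormedSpace ℂ F] {D : Set E} {z w : E}

theorem lempert_lt_iff {c : ℝ≥0∞} : lempert D z w < c ↔
    ∃ α ∈ ball (0 : ℂ) 1, ‖α‖ₑ < c ∧ ∃ φ : ℂ → E, DifferentiableOn ℂ φ (ball 0 1) ∧
      Set.MapsTo φ (ball 0 1) D ∧ φ 0 = z ∧ φ α = w := by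
  rw [lempert, sInf_lt_iff]
  constructor
  · rintro ⟨r, ⟨α, hα, rfl, h⟩, hr⟩
    exact ⟨α, hα, hr, h⟩
  · rintro ⟨α, hα, hr, h⟩
    exact ⟨_, ⟨α, hα, rfl, h⟩, hr⟩

theorem lempert_le {α : ℂ} (hα : α ∈ ball (0 : ℂ) 1) {φ : ℂ → E}
    (hφ : DifferentiableOn ℂ φ (ball 0 1)) (hm : Set.MapsTo φ (ball 0 1) D) :
    lempert D (φ 0) (φ α) ≤ ‖α‖ₑ :=
  sInf_le ⟨α, hα, rfl, φ, hφ, hm, rfl, rfl⟩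

theorem lempert_le_of_mapsTo_ball {R : ℝ} (hR : 0 < R) {α : ℂ} (hα : α ∈ ball (0 : ℂ) R)
    {φ : ℂ → E} (hφ : DifferentiableOn ℂ φ (ball 0 R)) (hm : Set.MapsTo φ (ball 0 R) D) :
    lempert D (φ 0) (φ α) ≤ ‖α / R‖ₑ := by
  have hscale : Set.MapsTo (fun x : ℂ => R * x) (ball 0 1) (ball 0 R) := fun x hx => by
    rw [mem_ball_zero_iff] at hx ⊢
    rw [norm_mul, Complex.norm_real, Real.norm_of_nonneg hR.le]
    exact mul_lt_of_lt_one_right hR hx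
  have hα' : α / R ∈ ball (0 : ℂ) 1 := by
    rw [mem_ball_zero_iff] at hα ⊢
    rwa [norm_div, Complex.norm_real, Real.norm_of_nonneg hR.le, div_lt_one hR]
  have hR' : (R : ℂ) ≠ 0 := Complex.ofReal_ne_zero.2 hR.ne'
  simpa [Function.comp_def, mul_div_cancel₀ _ hR'] using
    lempert_le hα' (hφ.comp (by fun_prop) hscale) (hm.comp hscale)

theorem exists_disc_of_lempert_lt {c : ℝ≥0∞} (h : lempert D z w < c) :
    ∃ α ∈ ball (0 : ℂ) 1, α ≠ 0 ∧ ‖α‖ₑ < c ∧ ∃ φ : ℂ → E, DifferentiableOn ℂ φ (ball 0 1) ∧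
      Set.MapsTo φ (ball 0 1) D ∧ φ 0 = z ∧ φ α = w := by
  obtain ⟨α, hα, hαc, φ, hφ, hm, rfl, rfl⟩ := lempert_lt_iff.1 h
  by_cases hα0 : α = 0
  · subst hα0
    obtain ⟨r, hr0, hr⟩ := ENNReal.lt_iff_exists_nnreal_btwn.1 <|
      show (0 : ℝ≥0∞) < min c 1 from lt_min (by simpa using hαc) one_pos
    have hr1 : r < 1 := by exact_mod_cast hr.trans_le (min_le_right _ _)
    have hnorm : ‖((r : ℝ) : ℂ)‖ₑ = r := by
      rw [enorm_eq_nnnorm, Complex.nnnorm_real, Real.nnnorm_of_nonneg r.coe_nonneg]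
      rfl
    refine ⟨(r : ℝ), by simpa using hr1, by simpa using hr0.ne',
      hnorm.trans_lt (hr.trans_le (min_le_left _ _)), fun _ => φ 0, by fun_prop,
      fun _ _ => hm (mem_ball_self one_pos), rfl, rfl⟩
  · exact ⟨α, hα, hα0, hαc, φ, hφ, hm, rfl, rfl⟩

theorem lempert_comp_le {D' : Set F} {f : E → F} (hf : DifferentiableOn ℂ f D)
    (hm : Set.MapsTo f D D') : lempert D' (f z) (f w) ≤ lempert D z w := by
  refine le_of_forall_gt fun c hc => ?_
  obtain ⟨α, hα, hαc, φ, hφ, hm', rfl, rfl⟩ := lempert_lt_iff.1 hc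
  exact lempert_lt_iff.2 ⟨α, hα, hαc, f ∘ φ, hf.comp hφ hm', hm.comp hm', rfl, rfl⟩

section

open scoped ComplexConjugate

theorem norm_sub_lt_norm_one_sub {a x : ℂ} (ha : ‖a‖ < 1) (hx : ‖x‖ < 1) :
    ‖a - x‖ < ‖1 - conj a * x‖ := by
  have hsq : ‖1 - conj a * x‖ ^ 2 - ‖a - x‖ ^ 2 = (1 - ‖a‖ ^ 2) * (1 - ‖x‖ ^ 2) := by
    simp only [← Complex.normSq_eq_norm_sq, Complex.normSq_apply, Complex.sub_re, Complex.sub_im,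
      Complex.mul_re, Complex.mul_im, Complex.conj_re, Complex.conj_im, Complex.one_re,
      Complex.one_im]
    ring
  have hpos : 0 < (1 - ‖a‖ ^ 2) * (1 - ‖x‖ ^ 2) := by
    apply mul_pos <;> nlinarith [norm_nonneg a, norm_nonneg x]
  exact lt_of_pow_lt_pow_left₀ 2 (norm_nonneg _) (by linarith)

theorem one_sub_conj_mul_ne_zero {a x : ℂ} (ha : ‖a‖ < 1) (hx : ‖x‖ < 1) :
    1 - conj a * x ≠ 0 :=
  norm_pos_iff.1 <| (norm_nonneg _).trans_lt (norm_sub_lt_norm_one_sub ha hx)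

theorem norm_moebius_lt_one {a x : ℂ} (ha : ‖a‖ < 1) (hx : ‖x‖ < 1) :
    ‖(a - x) / (1 - conj a * x)‖ < 1 := by
  rw [norm_div, div_lt_one (norm_pos_iff.2 (one_sub_conj_mul_ne_zero ha hx))]
  exact norm_sub_lt_norm_one_sub ha hx

-- Precompose a disc with the Möbius involution of the unit disc exchanging `0` and `α`.
theorem lempert_comm_le : lempert D z w ≤ lempert D w z := by
  refine le_of_forall_gt fun c hc => ?_
  obtain ⟨α, hα, hαc, φ, hφ, hm, rfl, rfl⟩ := lempert_lt_iff.1 hc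
  have hα1 := mem_ball_zero_iff.1 hα
  have hmaps : Set.MapsTo (fun x => (α - x) / (1 - conj α * x)) (ball 0 1) (ball (0 : ℂ) 1) :=
    fun x hx => mem_ball_zero_iff.2 (norm_moebius_lt_one hα1 (mem_ball_zero_iff.1 hx))
  have hdiff : DifferentiableOn ℂ (fun x => (α - x) / (1 - conj α * x)) (ball 0 1) :=
    DifferentiableOn.fun_div (by fun_prop) (by fun_prop) fun x hx =>
      one_sub_conj_mul_ne_zero hα1 (mem_ball_zero_iff.1 hx)
  exact lempert_lt_iff.2 ⟨α, hα, hαc, φ ∘ fun x => (α - x) / (1 - conj α * x),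
    hφ.comp hdiff hmaps, hm.comp hmaps, by simp, by simp⟩

end

theorem lempert_comm : lempert D z w = lempert D w z :=
  le_antisymm lempert_comm_le lempert_comm_le

theorem lempert_lt_enorm {φ : ℂ → E} (hD : IsOpen D) (hφ : Differentiable ℂ φ)
    (hm : Set.MapsTo φ (closedBall 0 1) D) {α : ℂ} (hα : ‖α‖ < 1) (hα0 : α ≠ 0) :
    lempert D (φ 0) (φ α) < ‖α‖ₑ := by
  obtain ⟨δ, hδ, hsub⟩ := (isCompact_closedBall (0 : ℂ) 1).exists_thickening_subset_open
    (hD.preimage hφ.continuous) hm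
  rw [thickening_closedBall hδ zero_le_one] at hsub
  have hR : 1 < δ + 1 := by linarith
  refine (lempert_le_of_mapsTo_ball (one_pos.trans hR) (by simpa using hα.trans hR)
    hφ.differentiableOn hsub).trans_lt ?_
  rw [enorm_eq_nnnorm, enorm_eq_nnnorm, ENNReal.coe_lt_coe, ← NNReal.coe_lt_coe, coe_nnnorm,
    coe_nnnorm, norm_div, Complex.norm_real, Real.norm_of_nonneg (by linarith)]
  exact div_lt_self (norm_pos_iff.2 hα0) hR

theorem exists_disc_thickening_subset (hD : IsOpen D) {c : ℝ≥0∞} (h : lempert D z w < c) :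
    ∃ β ∈ ball (0 : ℂ) 1, β ≠ 0 ∧ ‖β‖ₑ < c ∧ ∃ φ : ℂ → E, DifferentiableOn ℂ φ (ball 0 1) ∧
      φ 0 = z ∧ φ β = w ∧ ∃ δ > 0, thickening δ (φ '' ball 0 1) ⊆ D := by
  obtain ⟨α, hα, hα0, hαc, φ, hφ, hm, rfl, rfl⟩ := exists_disc_of_lempert_lt h
  rw [mem_ball_zero_iff] at hα
  obtain ⟨r, hrc, hαr, hr1⟩ : ∃ r : ℝ, ‖α / r‖ₑ < c ∧ ‖α‖ < r ∧ r < 1 := by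
    have hcont : ContinuousAt (fun r : ℝ => ‖α / r‖ₑ) 1 :=
      (continuousAt_const.div Complex.continuous_ofReal.continuousAt (by simp)).enorm
    have hc : ∀ᶠ r : ℝ in 𝓝 1, ‖α / r‖ₑ < c :=
      hcont.eventually_lt continuousAt_const (by simpa using hαc)
    exact ((hc.and (lt_mem_nhds hα)).filter_mono nhdsWithin_le_nhds |>.and
      (self_mem_nhdsWithin : Set.Iio 1 ∈ 𝓝[<] (1 : ℝ))).exists.imp fun r h => ⟨h.1.1, h.1.2, h.2⟩
  have hr0 : 0 < r := (norm_nonneg α).trans_lt hαr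
  have hr0' : (r : ℂ) ≠ 0 := Complex.ofReal_ne_zero.2 hr0.ne'
  have hsub : closedBall (0 : ℂ) r ⊆ ball 0 1 := closedBall_subset_ball hr1
  have hscale : Set.MapsTo (fun x : ℂ => r * x) (ball 0 1) (closedBall 0 r) := fun x hx => by
    rw [mem_ball_zero_iff] at hx
    rw [mem_closedBall_zero_iff, norm_mul, Complex.norm_real, Real.norm_of_nonneg hr0.le]
    exact mul_le_of_le_one_right hr0.le hx.le
  obtain ⟨δ, hδ, hδD⟩ := ((isCompact_closedBall _ _).image_of_continuousOn
    (hφ.continuousOn.mono hsub)).exists_thickening_subset_open hD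
      (Set.image_subset_iff.2 fun x hx => hm (hsub hx))
  refine ⟨α / r, ?_, div_ne_zero hα0 hr0', hrc, fun x => φ (r * x),
    hφ.comp (by fun_prop) (hscale.mono_right hsub), by simp, by simp [mul_div_cancel₀ _ hr0'], δ,
    hδ, (thickening_subset_of_subset δ ?_).trans hδD⟩
  · rwa [mem_ball_zero_iff, norm_div, Complex.norm_real, Real.norm_of_nonneg hr0.le,
      div_lt_one hr0]
  · rintro _ ⟨x, hx, rfl⟩
    exact Set.mem_image_of_mem φ (hscale hx)

-- A disc through `z` and `w` is moved to one through nearby points by an affine correction.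
theorem eventually_lempert_lt (hD : IsOpen D) {c : ℝ≥0∞} (h : lempert D z w < c) :
    ∀ᶠ p : E × E in 𝓝 (z, w), lempert D p.1 p.2 < c := by
  obtain ⟨β, hβ, hβ0, hβc, φ, hφ, rfl, rfl, δ, hδ, hδD⟩ := exists_disc_thickening_subset hD h
  have hsmall : ∀ᶠ p : E × E in 𝓝 (φ 0, φ β),
      (1 + 1 / ‖β‖) * ‖p.1 - φ 0‖ + 1 / ‖β‖ * ‖p.2 - φ β‖ < δ := by
    have hcont : ContinuousAt (fun p : E × E =>
        (1 + 1 / ‖β‖) * ‖p.1 - φ 0‖ + 1 / ‖β‖ * ‖p.2 - φ β‖) (φ 0, φ β) := by fun_prop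
    exact hcont.eventually_lt continuousAt_const (by simpa using hδ)
  filter_upwards [hsmall] with p hp
  refine lempert_lt_iff.2 ⟨β, hβ, hβc,
    fun x => φ x + ((1 - x / β) • (p.1 - φ 0) + (x / β) • (p.2 - φ β)), hφ.fun_add (by fun_prop),
    fun x hx => hδD (mem_thickening_iff.2 ⟨φ x, Set.mem_image_of_mem φ hx, ?_⟩), by simp,
    by simp [hβ0]⟩
  have hx1 : ‖x / β‖ ≤ 1 / ‖β‖ := by
    rw [norm_div]
    gcongr
    exact (mem_ball_zero_iff.1 hx).le
  have hx2 : ‖1 - x / β‖ ≤ 1 + 1 / ‖β‖ := by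
    simpa using (norm_sub_le 1 (x / β)).trans (add_le_add_right hx1 _)
  rw [dist_eq_norm, add_sub_cancel_left]
  refine ((norm_add_le _ _).trans ?_).trans_lt hp
  rw [norm_smul, norm_smul]
  gcongr

end Lempert

section Charpoly

variable {ι K : Type*} [Fintype ι] [DecidableEq ι]

section CommRing

variable [CommRing K] {A B : Matrix ι ι K}

theorem charpoly_eq_of_isConj (h : IsConj A B) : A.charpoly = B.charpoly := by
  obtain ⟨c, hc⟩ := h
  rw [← Matrix.charpoly_units_conj c A, ← Matrix.coe_units_inv, hc.eq, Units.mul_inv_cancel_right]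

theorem isConj_of_mul_eq {P Q : Matrix ι ι K} (hPQ : P * Q = 1) (h : P * A = B * P) :
    IsConj A B :=
  ⟨⟨P, Q, hPQ, mul_eq_one_comm.1 hPQ⟩, h⟩

theorem isConj_conj {P Q : Matrix ι ι K} (hPQ : P * Q = 1) (A : Matrix ι ι K) :
    IsConj A (P * A * Q) :=
  isConj_of_mul_eq hPQ (by rw [mul_assoc, mul_eq_one_comm.1 hPQ, mul_one])

theorem eval_charpoly_eq_det (A : Matrix ι ι K) (t : K) :
    A.charpoly.eval t = (t • 1 - A).det := by
  rw [Matrix.eval_charpoly, Matrix.scalar_apply, Matrix.smul_one_eq_diagonal]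

end CommRing

variable [Field K] {A B : Matrix ι ι K}

theorem isConj_of_det_ne_zero {P : Matrix ι ι K} (hP : P.det ≠ 0) (h : P * A = B * P) :
    IsConj A B :=
  isConj_of_mul_eq (Matrix.mul_nonsing_inv P (isUnit_iff_ne_zero.2 hP)) h

theorem isConj_diagonal {d : ι → K} (hd : ∀ i, d i ≠ 0) (A : Matrix ι ι K) :
    IsConj A (Matrix.of fun i j => d i * A i j * (d j)⁻¹) := by
  refine isConj_of_det_ne_zero (P := Matrix.diagonal d) ?_ ?_
  · rw [Matrix.det_diagonal]
    exact Finset.prod_ne_zero_iff.2 fun i _ => hd i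
  · ext i j
    simp [Matrix.diagonal_mul, Matrix.mul_diagonal, hd]

theorem isRoot_charpoly_iff_exists_mulVec {t : K} :
    A.charpoly.IsRoot t ↔ ∃ v : ι → K, v ≠ 0 ∧ A.mulVec v = t • v := by
  rw [Polynomial.IsRoot, eval_charpoly_eq_det, ← Matrix.exists_mulVec_eq_zero_iff]
  simp only [Matrix.sub_mulVec, Matrix.smul_mulVec, Matrix.one_mulVec, sub_eq_zero,
    eq_comm (a := t • _)]

theorem isRoot_charpoly_smul {c t : K} (hc : c ≠ 0) :
    (c • A).charpoly.IsRoot (c * t) ↔ A.charpoly.IsRoot t := by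
  rw [Polynomial.IsRoot, Polynomial.IsRoot, eval_charpoly_eq_det, eval_charpoly_eq_det, mul_smul,
    ← smul_sub, Matrix.det_smul]
  simp [hc]

theorem isRoot_prod_X_sub_C {ι : Type*} [Fintype ι] {d : ι → K} {t : K} :
    (∏ i, (Polynomial.X - Polynomial.C (d i))).IsRoot t ↔ ∃ i, d i = t := by
  simp only [Polynomial.IsRoot, Polynomial.eval_prod, Finset.prod_eq_zero_iff, Polynomial.eval_sub,
    Polynomial.eval_X, Polynomial.eval_C, Finset.mem_univ, true_and, sub_eq_zero, eq_comm (a := t)]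

variable [IsAlgClosed K]

theorem isRoot_charpoly_pow {k : ℕ} (hk : 0 < k) {t : K} :
    (A ^ k).charpoly.IsRoot t ↔ ∃ x, A.charpoly.IsRoot x ∧ x ^ k = t := by
  rw [← Matrix.mem_spectrum_iff_isRoot_charpoly, spectrum.map_pow_of_pos A hk]
  simp [Matrix.mem_spectrum_iff_isRoot_charpoly]

theorem exists_isRoot_charpoly [Nonempty ι] (A : Matrix ι ι K) : ∃ t, A.charpoly.IsRoot t := by
  apply IsAlgClosed.exists_root
  rw [Matrix.charpoly_degree_eq_dim]
  simp

end Charpoly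

section Triangular

variable {n : ℕ} {K : Type*}

/-- The block matrix `1 ⊕ Q`, as a multiplicative map of `Q`: it extends a change of basis of
the last `n` coordinates by the identity in the first one. -/
def oneBlockHom (n : ℕ) (K : Type*) [CommRing K] :
    Matrix (Fin n) (Fin n) K →* Matrix (Fin (n + 1)) (Fin (n + 1)) K where
  toFun Q := Matrix.of (Fin.cons (Fin.cons 1 0) fun i => Fin.cons 0 (Q i))
  map_one' := by
    ext i j
    cases i using Fin.cases <;> cases j using Fin.cases <;>
      simp [Matrix.one_apply, Fin.succ_ne_zero, (Fin.succ_ne_zero _).symm]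
  map_mul' Q R := by
    ext i j
    cases i using Fin.cases <;> cases j using Fin.cases <;>
      simp [Matrix.mul_apply, Fin.sum_univ_succ]

theorem exists_isConj_extending_of_first_column [CommRing K]
    {B : Matrix (Fin (n + 1)) (Fin (n + 1)) K} (hB : ∀ i : Fin n, B i.succ 0 = 0)
    {T : Matrix (Fin n) (Fin n) K} (hT : IsConj (B.submatrix Fin.succ Fin.succ) T) :
    ∃ C, IsConj B C ∧ (∀ i : Fin n, C i.succ 0 = 0) ∧ C.submatrix Fin.succ Fin.succ = T := by
  obtain ⟨c, hc⟩ := hT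
  have hcT : (c : Matrix (Fin n) (Fin n) K) * B.submatrix Fin.succ Fin.succ *
      (c⁻¹ : (Matrix (Fin n) (Fin n) K)ˣ) = T := by
    rw [hc.eq, Units.mul_inv_cancel_right]
  refine ⟨oneBlockHom n K c * B * oneBlockHom n K (c⁻¹ : (Matrix (Fin n) (Fin n) K)ˣ),
    isConj_conj (by rw [← map_mul, Units.mul_inv, map_one]) B, fun i => ?_, ?_⟩
  · simp [oneBlockHom, Matrix.mul_apply, Fin.sum_univ_succ, hB]
  · ext i j
    simp [← hcT, oneBlockHom, Matrix.mul_apply, Fin.sum_univ_succ]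

theorem exists_linearEquiv_apply_eq {V : Type*} [Field K] [AddCommGroup V] [Module K V]
    {v w : V} (hv : v ≠ 0) (hw : w ≠ 0) : ∃ e : V ≃ₗ[K] V, e v = w := by
  let f := (LinearEquiv.toSpanNonzeroSingleton K V v hv).symm ≪≫ₗ
    LinearEquiv.toSpanNonzeroSingleton K V w hw
  obtain ⟨e, he⟩ := Submodule.exists_linearEquiv_restrict_eq f
  refine ⟨e, (he ⟨v, Submodule.mem_span_singleton_self v⟩).symm.trans ?_⟩
  have hv1 : (LinearEquiv.toSpanNonzeroSingleton K V v hv).symm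
      ⟨v, Submodule.mem_span_singleton_self v⟩ = 1 := LinearEquiv.coord_self K V v hv
  simp [f, hv1]

theorem exists_isConj_first_column [Field K] [IsAlgClosed K]
    (A : Matrix (Fin (n + 1)) (Fin (n + 1)) K) :
    ∃ B, IsConj A B ∧ ∀ i : Fin n, B i.succ 0 = 0 := by
  obtain ⟨t, ht⟩ := exists_isRoot_charpoly A
  obtain ⟨v, hv, hAv⟩ := isRoot_charpoly_iff_exists_mulVec.1 ht
  obtain ⟨e, he⟩ := exists_linearEquiv_apply_eq (K := K) hv
    (show (Pi.single 0 1 : Fin (n + 1) → K) ≠ 0 by simp)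
  let P := LinearMap.toMatrix' e.toLinearMap
  let Q := LinearMap.toMatrix' e.symm.toLinearMap
  have hPQ : P * Q = 1 := by
    rw [← LinearMap.toMatrix'_comp, LinearEquiv.comp_symm, LinearMap.toMatrix'_id]
  have hP : P.mulVec v = Pi.single 0 1 := by rw [← he]; simp [P]
  have hQ : Q.mulVec (Pi.single 0 1) = v := by rw [← he]; simp [Q]
  have hcol : (P * A * Q).mulVec (Pi.single 0 1) = t • Pi.single 0 1 := by
    rw [← Matrix.mulVec_mulVec, hQ, ← Matrix.mulVec_mulVec, hAv, Matrix.mulVec_smul, hP]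
  refine ⟨P * A * Q, isConj_conj hPQ A, fun i => ?_⟩
  simpa [Matrix.mulVec_single_one] using congrFun hcol i.succ

theorem exists_isConj_upperTriangular [Field K] [IsAlgClosed K] (A : Matrix (Fin n) (Fin n) K) :
    ∃ T : Matrix (Fin n) (Fin n) K, IsConj A T ∧ ∀ i j, j < i → T i j = 0 := by
  induction n with
  | zero => exact ⟨A, IsConj.refl _, fun i => i.elim0⟩
  | succ n ih =>
    obtain ⟨B, hAB, hB⟩ := exists_isConj_first_column A
    obtain ⟨T, hBT, hT⟩ := ih (B.submatrix Fin.succ Fin.succ)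
    obtain ⟨C, hBC, hC, rfl⟩ := exists_isConj_extending_of_first_column hB hBT
    refine ⟨C, hAB.trans hBC, fun i j hij => ?_⟩
    cases i using Fin.cases with
    | zero => simp at hij
    | succ i =>
      cases j using Fin.cases with
      | zero => exact hC i
      | succ j => exact hT i j (Fin.succ_lt_succ_iff.1 hij)

variable {ι 𝕜 : Type*} [Fintype ι] [DecidableEq ι] [NontriviallyNormedField 𝕜]

theorem mem_closure_orbit_of_weights {A : Matrix ι ι 𝕜} (w : ι → ℕ)
    (hw : ∀ i j, w j < w i → A i j = 0) :
    (Matrix.of fun i j => if w i = w j then A i j else 0) ∈ closure {B | IsConj A B} := by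
  let f : 𝕜 → Matrix ι ι 𝕜 := fun s =>
    Matrix.of fun i j => if w j < w i then 0 else s ^ (w j - w i) * A i j
  have hf : Continuous f := by
    refine continuous_matrix fun i j => ?_
    simp only [f, Matrix.of_apply]
    split_ifs <;> fun_prop
  have hf0 : f 0 = Matrix.of fun i j => if w i = w j then A i j else 0 := by
    ext i j
    simp only [f, Matrix.of_apply]
    rcases lt_trichotomy (w i) (w j) with h | h | h
    · rw [if_neg (by omega), if_neg (by omega), zero_pow (by omega), zero_mul]
    · simp [h]
    · rw [if_pos h, if_neg (by omega)]
  rw [← hf0]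
  refine mem_closure_of_tendsto (f := f) (b := 𝓝[≠] 0)
    (hf.continuousAt.mono_left nhdsWithin_le_nhds) ?_
  filter_upwards [self_mem_nhdsWithin] with s (hs : s ≠ 0)
  convert isConj_diagonal (fun i => inv_ne_zero (pow_ne_zero (w i) hs)) A using 1
  ext i j
  simp only [f, Matrix.of_apply]
  split_ifs with hij
  · simp [hw i j hij]
  · rw [pow_sub₀ s hs (by omega), inv_inv]
    ring

theorem exists_diagonal_mem_closure [IsAlgClosed 𝕜] (A : Matrix (Fin n) (Fin n) 𝕜) :
    ∃ d : Fin n → 𝕜, A.charpoly = ∏ i, (Polynomial.X - Polynomial.C (d i)) ∧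
      Matrix.diagonal d ∈ closure {B | IsConj A B} := by
  obtain ⟨T, hAT, hT⟩ := exists_isConj_upperTriangular A
  have horbit : {B | IsConj T B} = {B | IsConj A B} :=
    Set.ext fun B => ⟨hAT.trans, hAT.symm.trans⟩
  refine ⟨fun i => T i i, ?_, ?_⟩
  · rw [charpoly_eq_of_isConj hAT, Matrix.charpoly_of_isUpperTriangular T fun i j h => hT i j h]
  · convert horbit ▸ mem_closure_orbit_of_weights (A := T) (fun i => (i : ℕ)) hT
    ext i j
    by_cases hij : i = j <;> simp [hij, Fin.val_inj]

end Triangular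

section SpectralRadius

open scoped Matrix.Norms.Operator

variable {ι : Type*} [Fintype ι] [DecidableEq ι] {n : ℕ}

theorem spectralRadius_le_iff {A : Matrix ι ι ℂ} {c : ℝ≥0∞} :
    spectralRadius ℂ A ≤ c ↔ ∀ t, A.charpoly.IsRoot t → ‖t‖ₑ ≤ c := by
  simp only [spectralRadius, iSup₂_le_iff, Matrix.mem_spectrum_iff_isRoot_charpoly]
  rfl

theorem lt_spectralRadius_iff {A : Matrix ι ι ℂ} {c : ℝ≥0∞} :
    c < spectralRadius ℂ A ↔ ∃ t, A.charpoly.IsRoot t ∧ c < ‖t‖ₑ := by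
  simp only [← not_le, spectralRadius_le_iff, not_forall, exists_prop]

theorem enorm_le_spectralRadius {A : Matrix ι ι ℂ} {t : ℂ} (ht : A.charpoly.IsRoot t) :
    ‖t‖ₑ ≤ spectralRadius ℂ A :=
  spectralRadius_le_iff.1 le_rfl t ht

theorem norm_le_opNorm_of_isRoot_charpoly {A : Matrix ι ι ℂ} {t : ℂ} (ht : A.charpoly.IsRoot t) :
    ‖t‖ ≤ ‖A‖ := by
  obtain ⟨v, hv, -⟩ := isRoot_charpoly_iff_exists_mulVec.1 ht
  have : Nonempty ι := (Function.ne_iff.1 hv).nonempty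
  exact spectrum.norm_le_norm_of_mem (Matrix.mem_spectrum_iff_isRoot_charpoly.2 ht)

variable {A B : Matrix (Fin n) (Fin n) ℂ}

theorem mem_spectralBall_iff : A ∈ spectralBall n ↔ ∀ t, A.charpoly.IsRoot t → ‖t‖ < 1 := by
  simp only [← Matrix.mem_spectrum_iff_isRoot_charpoly, spectralBall, Set.mem_ofPred_eq]
  constructor
  · intro h t ht
    exact_mod_cast (le_iSup₂ (α := ℝ≥0∞) t ht).trans_lt h
  · intro h
    rcases (spectrum ℂ A).eq_empty_or_nonempty with hs | hs
    · simp [spectralRadius, hs]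
    · obtain ⟨t, ht, hr⟩ := spectrum.exists_nnnorm_eq_spectralRadius_of_nonempty hs
      rw [← hr]
      exact_mod_cast h t ht

theorem mem_spectralBall_of_opNorm_lt (h : ‖A‖ < 1) : A ∈ spectralBall n :=
  mem_spectralBall_iff.2 fun _ ht => (norm_le_opNorm_of_isRoot_charpoly ht).trans_lt h

theorem zero_mem_spectralBall : (0 : Matrix (Fin n) (Fin n) ℂ) ∈ spectralBall n :=
  mem_spectralBall_of_opNorm_lt (by simp)

theorem smul_mem_spectralBall {c : ℂ} (h : ∀ t, A.charpoly.IsRoot t → ‖c‖ * ‖t‖ < 1) :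
    c • A ∈ spectralBall n := by
  rcases eq_or_ne c 0 with rfl | hc
  · simpa using zero_mem_spectralBall
  · refine mem_spectralBall_iff.2 fun t ht => ?_
    rw [← mul_div_cancel₀ t hc, isRoot_charpoly_smul hc] at ht
    have hlt := h _ ht
    rwa [← norm_mul, mul_div_cancel₀ _ hc] at hlt

theorem mem_spectralBall_of_charpoly_eq (h : A.charpoly = B.charpoly) (hA : A ∈ spectralBall n) :
    B ∈ spectralBall n := by
  rwa [mem_spectralBall_iff, ← h, ← mem_spectralBall_iff]

theorem isOpen_spectralBall : IsOpen (spectralBall n) := by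
  have hpre : spectralBall n = spectrum ℂ ⁻¹' Set.Iic (ball (0 : ℂ) 1) := by
    ext A
    simp only [mem_spectralBall_iff, ← Matrix.mem_spectrum_iff_isRoot_charpoly,
      Set.mem_preimage, Set.mem_Iic, Set.subset_def, mem_ball_zero_iff]
  rw [hpre]
  exact upperHemicontinuous_iff_isOpen_preimage_Iic.1 (upperHemicontinuous_spectrum ℂ _) _
    isOpen_ball

theorem pow_sub_le_norm_eval_charpoly {A : Matrix ι ι ℂ} {c : ℝ} {b : ℂ} (hcb : c ≤ ‖b‖)
    (h : ∀ t, A.charpoly.IsRoot t → ‖t‖ ≤ c) :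
    (‖b‖ - c) ^ Fintype.card ι ≤ ‖A.charpoly.eval b‖ := by
  have hsplit := IsAlgClosed.splits A.charpoly
  have hcard : A.charpoly.roots.card = Fintype.card ι := by
    rw [← hsplit.natDegree_eq_card_roots, Matrix.charpoly_natDegree_eq_dim]
  have hnorm : ‖A.charpoly.eval b‖ = (A.charpoly.roots.map fun t => ‖b - t‖).prod := by
    rw [hsplit.eval_eq_prod_roots_of_monic A.charpoly_monic]
    exact (Multiset.prod_hom' _ (normHom (α := ℂ)) _).symm
  rw [hnorm, ← hcard, ← Multiset.prod_replicate, ← Multiset.map_const']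
  refine Multiset.prod_map_le_prod_map₀ _ _ (fun _ _ => sub_nonneg.2 hcb) fun t ht => ?_
  exact (sub_le_sub_left (h t (Polynomial.isRoot_of_mem_roots ht)) _).trans (norm_sub_norm_le b t)

theorem eventually_lt_spectralRadius {B : Matrix ι ι ℂ} {c : ℝ≥0∞}
    (hc : c < spectralRadius ℂ B) : ∀ᶠ X in 𝓝 B, c < spectralRadius ℂ X := by
  obtain ⟨b, hb, hcb⟩ := lt_spectralRadius_iff.1 hc
  lift c to NNReal using hcb.ne_top
  have hcb' : (c : ℝ) < ‖b‖ := by exact_mod_cast hcb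
  have hcont : Continuous fun X : Matrix ι ι ℂ => ‖X.charpoly.eval b‖ := by
    simp only [eval_charpoly_eq_det]
    exact (Continuous.matrix_det (by fun_prop)).norm
  have hev : ∀ᶠ X in 𝓝 B, ‖X.charpoly.eval b‖ < (‖b‖ - c) ^ Fintype.card ι :=
    hcont.continuousAt.eventually_lt continuousAt_const
      (by simpa [hb.eq_zero] using pow_pos (sub_pos.2 hcb') _)
  filter_upwards [hev] with X hX
  contrapose! hX
  exact pow_sub_le_norm_eval_charpoly hcb'.le fun t ht =>
    by exact_mod_cast spectralRadius_le_iff.1 hX t ht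

end SpectralRadius

section Holomorphic

open scoped Matrix.Norms.Operator

variable {𝕜 : Type*} [NontriviallyNormedField 𝕜] {ι : Type*} {n : ℕ}
  {E : Type*} [NormedAddCommGroup E] [NormedSpace 𝕜 E] {s : Set E}

theorem differentiableOn_matrix_iff [Finite ι] {φ : E → Matrix ι ι 𝕜} :
    DifferentiableOn 𝕜 φ s ↔ ∀ i j, DifferentiableOn 𝕜 (fun x => φ x i j) s :=
  have := Fintype.ofFinite ι
  ⟨fun h i j => differentiableOn_pi.1 (differentiableOn_pi.1 h i) j,
    fun h => differentiableOn_pi.2 fun i => differentiableOn_pi.2 fun j => h i j⟩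

theorem differentiableOn_coeff_charpoly [Fintype ι] [DecidableEq ι] [CompleteSpace 𝕜]
    {φ : E → Matrix ι ι 𝕜} (hφ : DifferentiableOn 𝕜 φ s) (k : ℕ) :
    DifferentiableOn 𝕜 (fun x => (φ x).charpoly.coeff k) s := by
  have huniv (x : E) : (φ x).charpoly.coeff k =
      MvPolynomial.eval (fun ij => φ x ij.1 ij.2) ((Matrix.charpoly.univ 𝕜 ι).coeff k) :=
    (Matrix.charpoly.univ_coeff_eval₂Hom ι (RingHom.id 𝕜) (fun ij => φ x ij.1 ij.2) k).symm
  simp only [huniv]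
  exact (AnalyticOnNhd.eval_mvPolynomial _).differentiableOn.comp
    (differentiableOn_pi.2 fun ij => differentiableOn_matrix_iff.1 hφ ij.1 ij.2)
    fun _ _ => Set.mem_univ _

theorem differentiableOn_det [Fintype ι] [DecidableEq ι] [CompleteSpace 𝕜] {φ : E → Matrix ι ι 𝕜}
    (hφ : DifferentiableOn 𝕜 φ s) : DifferentiableOn 𝕜 (fun x => (φ x).det) s := by
  simp only [Matrix.det_eq_sign_charpoly_coeff]
  exact (differentiableOn_coeff_charpoly hφ 0).const_mul _

theorem differentiableOn_sigma {E : Type*} [NormedAddCommGroup E] [NormedSpace ℂ E] {s : Set E}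
    {φ : E → Matrix (Fin n) (Fin n) ℂ} (hφ : DifferentiableOn ℂ φ s) :
    DifferentiableOn ℂ (fun x => sigma (φ x)) s :=
  differentiableOn_pi.2 fun _ => (differentiableOn_coeff_charpoly hφ _).const_mul _

theorem continuous_matrix_sigma : Continuous (sigma : Matrix (Fin n) (Fin n) ℂ → Fin n → ℂ) :=
  (differentiableOn_univ.1 (differentiableOn_sigma differentiableOn_id)).continuous

theorem lempert_symPolydisk_le (A B : Matrix (Fin n) (Fin n) ℂ) :
    lempert (symPolydisk n) (sigma A) (sigma B) ≤ lempert (spectralBall n) A B :=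
  lempert_comp_le (f := sigma) (differentiableOn_sigma differentiableOn_id)
    fun _ hX => Set.mem_image_of_mem sigma hX

end Holomorphic

section Conjugation

open scoped Matrix.Norms.Operator

variable {n : ℕ} {A B C : Matrix (Fin n) (Fin n) ℂ}

-- If a disc joins `A` to `B` at `α`, conjugating it by `P (x / α)` keeps the first endpoint.
theorem lempert_conj_le_of_path {P Q : ℂ → Matrix (Fin n) (Fin n) ℂ} (hP : Differentiable ℂ P)
    (hQ : Differentiable ℂ Q) (hPQ : ∀ x, P x * Q x = 1) (hP0 : P 0 = 1) :
    lempert (spectralBall n) A (P 1 * B * Q 1) ≤ lempert (spectralBall n) A B := by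
  refine le_of_forall_gt fun c hc => ?_
  obtain ⟨α, hα, hα0, hαc, φ, hφ, hm, rfl, rfl⟩ := exists_disc_of_lempert_lt hc
  have hQ0 : Q 0 = 1 := by simpa [hP0] using hPQ 0
  have hdiv : Differentiable ℂ fun x : ℂ => x / α := by fun_prop
  refine lempert_lt_iff.2 ⟨α, hα, hαc, fun x => P (x / α) * φ x * Q (x / α),
    ((hP.comp hdiv).differentiableOn.mul hφ).mul (hQ.comp hdiv).differentiableOn,
    fun x hx => ?_, by simp [hP0, hQ0], by simp [hα0]⟩
  exact mem_spectralBall_of_charpoly_eq (charpoly_eq_of_isConj (isConj_conj (hPQ _) _)) (hm hx)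

theorem lempert_conj_diagonal_le {d : Fin n → ℂ} (hd : ∀ i, d i ≠ 0) :
    lempert (spectralBall n) A (Matrix.diagonal d * B * (Matrix.diagonal d)⁻¹) ≤
      lempert (spectralBall n) A B := by
  let P : ℂ → ℂ → Matrix (Fin n) (Fin n) ℂ := fun c x =>
    Matrix.diagonal fun i => Complex.exp (c * x * Complex.log (d i))
  have hdiff (c : ℂ) : Differentiable ℂ (P c) := by
    rw [← differentiableOn_univ, differentiableOn_matrix_iff]
    intro i j
    rcases eq_or_ne i j with rfl | hij
    · simp only [P, Matrix.diagonal_apply_eq]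
      fun_prop
    · simp only [P, Matrix.diagonal_apply_ne _ hij, differentiableOn_const]
  have hmul (x : ℂ) : P 1 x * P (-1) x = 1 := by
    simp [P, Matrix.diagonal_mul_diagonal, ← Complex.exp_add]
  have hP1 : P 1 1 = Matrix.diagonal d := by simp [P, Complex.exp_log (hd _)]
  have hinv : (Matrix.diagonal d)⁻¹ = P (-1) 1 := Matrix.inv_eq_right_inv (hP1 ▸ hmul 1)
  simpa only [hinv, hP1] using
    lempert_conj_le_of_path (A := A) (B := B) (hdiff 1) (hdiff (-1)) hmul (by simp [P])

theorem lempert_conj_transvection_le (t : Matrix.TransvectionStruct (Fin n) ℂ) :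
    lempert (spectralBall n) A (t.toMatrix * B * t.toMatrix⁻¹) ≤ lempert (spectralBall n) A B := by
  let P : ℂ → ℂ → Matrix (Fin n) (Fin n) ℂ := fun c x => Matrix.transvection t.i t.j (c * x)
  have hdiff (c : ℂ) : Differentiable ℂ (P c) := by
    rw [← differentiableOn_univ, differentiableOn_matrix_iff]
    intro i j
    simp only [P, Matrix.transvection, Matrix.add_apply, Matrix.single_apply]
    split_ifs <;> fun_prop
  have hmul (x : ℂ) : P t.c x * P (-t.c) x = 1 := by
    simp [P, Matrix.transvection_mul_transvection_same _ _ t.hij]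
  have hP1 : P t.c 1 = t.toMatrix := by simp [P, Matrix.TransvectionStruct.toMatrix]
  have hinv : t.toMatrix⁻¹ = P (-t.c) 1 := Matrix.inv_eq_right_inv (hP1 ▸ hmul 1)
  simpa only [hinv, hP1] using
    lempert_conj_le_of_path (A := A) (B := B) (hdiff t.c) (hdiff (-t.c)) hmul (by simp [P])

theorem lempert_conj_le {P : Matrix (Fin n) (Fin n) ℂ} (hP : P.det ≠ 0) :
    ∀ B, lempert (spectralBall n) A (P * B * P⁻¹) ≤ lempert (spectralBall n) A B := by
  refine Matrix.diagonal_transvection_induction_of_det_ne_zero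
    (fun P => ∀ B, lempert (spectralBall n) A (P * B * P⁻¹) ≤ lempert (spectralBall n) A B) P hP
    (fun d hd B => lempert_conj_diagonal_le fun i => ?_)
    (fun t B => lempert_conj_transvection_le t) fun P Q _ _ ihP ihQ B => ?_
  · exact Finset.prod_ne_zero_iff.1 (Matrix.det_diagonal (d := d) ▸ hd) i (Finset.mem_univ i)
  · calc lempert (spectralBall n) A (P * Q * B * (P * Q)⁻¹)
        = lempert (spectralBall n) A (P * (Q * B * Q⁻¹) * P⁻¹) := by
          simp only [Matrix.mul_inv_rev, mul_assoc]
      _ ≤ _ := (ihP _).trans (ihQ B)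

theorem lempert_eq_of_isConj_right (h : IsConj B C) :
    lempert (spectralBall n) A B = lempert (spectralBall n) A C := by
  have hle {B C : Matrix (Fin n) (Fin n) ℂ} (h : IsConj B C) :
      lempert (spectralBall n) A C ≤ lempert (spectralBall n) A B := by
    obtain ⟨c, hc⟩ := h
    have hdet := (Matrix.isUnit_iff_isUnit_det _).1 c.isUnit
    have hle := lempert_conj_le (A := A) hdet.ne_zero B
    rwa [hc.eq, Matrix.mul_nonsing_inv_cancel_right _ _ hdet] at hle
  exact le_antisymm (hle h.symm) (hle h)

theorem lempert_spectralBall_comm (A B : Matrix (Fin n) (Fin n) ℂ) :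
    lempert (spectralBall n) A B = lempert (spectralBall n) B A :=
  lempert_comm

theorem lempert_eq_of_isConj_left (h : IsConj A C) :
    lempert (spectralBall n) A B = lempert (spectralBall n) C B := by
  rw [lempert_spectralBall_comm, lempert_eq_of_isConj_right h, lempert_spectralBall_comm]

theorem eventually_lempert_lt_right {c : ℝ≥0∞} (h : lempert (spectralBall n) A B < c) :
    ∀ᶠ X in 𝓝 B, lempert (spectralBall n) A X < c :=
  (Continuous.prodMk_right A).continuousAt.eventually (eventually_lempert_lt isOpen_spectralBall h)

theorem lempert_le_of_mem_closure (h : C ∈ closure {X | IsConj B X}) :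
    lempert (spectralBall n) A B ≤ lempert (spectralBall n) A C := by
  refine le_of_forall_gt fun c hc => ?_
  obtain ⟨X, hX, hconj⟩ := mem_closure_iff_nhds.1 h _ (eventually_lempert_lt_right hc)
  rwa [lempert_eq_of_isConj_right hconj]

end Conjugation

section Schwarz

open scoped Matrix.Norms.Operator

variable {ι : Type*} [Fintype ι] [DecidableEq ι] {n : ℕ} {A : Matrix ι ι ℂ} {R : ℝ}

theorem norm_coeff_charpoly_le (h : ∀ t, A.charpoly.IsRoot t → ‖t‖ ≤ R) (i : ℕ) :
    ‖A.charpoly.coeff i‖ ≤ R ^ (Fintype.card ι - i) * (Fintype.card ι).choose i := by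
  have hroots : ∀ t ∈ (A.charpoly.map (RingHom.id ℂ)).roots, ‖t‖ ≤ R := fun t ht =>
    h t (Polynomial.isRoot_of_mem_roots (by rwa [Polynomial.map_id] at ht))
  simpa using Polynomial.coeff_le_of_roots_le i A.charpoly_monic (IsAlgClosed.splits _) hroots

theorem two_mul_norm_pow_le_of_isRoot_charpoly
    (h : ∀ i, ‖A.charpoly.coeff i‖ ≤ R ^ (Fintype.card ι - i) * (Fintype.card ι).choose i)
    {t : ℂ} (ht : A.charpoly.IsRoot t) :
    2 * ‖t‖ ^ Fintype.card ι ≤ (‖t‖ + R) ^ Fintype.card ι := by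
  have heval := ht.eq_zero
  have hlead : A.charpoly.coeff (Fintype.card ι) = 1 := by
    simpa using A.charpoly_monic.coeff_natDegree
  rw [Polynomial.eval_eq_sum_range, Matrix.charpoly_natDegree_eq_dim, Finset.sum_range_succ,
    hlead, one_mul, add_eq_zero_iff_eq_neg'] at heval
  have hsum : ‖t‖ ^ Fintype.card ι ≤ ∑ i ∈ Finset.range (Fintype.card ι),
      ‖t‖ ^ i * R ^ (Fintype.card ι - i) * (Fintype.card ι).choose i := by
    rw [← norm_pow, heval, norm_neg]
    refine (norm_sum_le _ _).trans (Finset.sum_le_sum fun i _ => ?_)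
    rw [norm_mul, norm_pow, mul_comm, mul_assoc]
    exact mul_le_mul_of_nonneg_left (h i) (by positivity)
  rw [add_pow, Finset.sum_range_succ]
  simp only [Nat.sub_self, pow_zero, Nat.choose_self, Nat.cast_one, mul_one]
  linarith

theorem le_of_forall_two_mul_pow_le {a b : ℝ} (hb : 0 ≤ b) {N : ℕ}
    (h : ∀ k : ℕ, 0 < k → 2 * (a ^ k) ^ N ≤ (a ^ k + b ^ k) ^ N) : a ≤ b := by
  by_contra! hlt
  have ha : 0 < a := hb.trans_lt hlt
  have htend : Filter.Tendsto (fun k : ℕ => (1 + (b / a) ^ k) ^ N) Filter.atTop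
      (𝓝 ((1 + 0) ^ N)) :=
    ((tendsto_pow_atTop_nhds_zero_of_lt_one (by positivity) ((div_lt_one ha).2 hlt)).const_add
      1).pow N
  have htwo : (2 : ℝ) ≤ (1 + 0) ^ N := by
    refine ge_of_tendsto htend ((Filter.eventually_gt_atTop 0).mono fun k hk => ?_)
    rw [← mul_le_mul_iff_left₀ (show 0 < (a ^ k) ^ N by positivity), ← mul_pow, add_mul, one_mul,
      div_pow, div_mul_cancel₀ _ (by positivity)]
    exact h k hk
  norm_num at htwo

-- The maximum principle applies to the coefficients of the characteristic polynomials of all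
-- powers `ψ ^ k`, and the loss of a constant factor disappears as `k → ∞`.
theorem norm_le_of_isRoot_charpoly_of_sphere {ψ : ℂ → Matrix ι ι ℂ} {r : ℝ}
    (hψ : DifferentiableOn ℂ ψ (closedBall 0 r)) (hR : 0 ≤ R)
    (h : ∀ x ∈ sphere (0 : ℂ) r, ∀ t, (ψ x).charpoly.IsRoot t → ‖t‖ ≤ R) {x : ℂ}
    (hx : x ∈ ball (0 : ℂ) r) {t : ℂ} (ht : (ψ x).charpoly.IsRoot t) : ‖t‖ ≤ R := by
  have hr0 : r ≠ 0 := (pos_of_mem_ball hx).ne'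
  refine le_of_forall_two_mul_pow_le hR (N := Fintype.card ι) fun k hk => ?_
  rw [← norm_pow]
  refine two_mul_norm_pow_le_of_isRoot_charpoly (A := ψ x ^ k) (fun i => ?_)
    ((isRoot_charpoly_pow hk).2 ⟨t, ht, rfl⟩)
  have hcl : DiffContOnCl ℂ (fun y => (ψ y ^ k).charpoly.coeff i) (ball 0 r) :=
    DifferentiableOn.diffContOnCl <| by
      rw [closure_ball _ hr0]
      exact differentiableOn_coeff_charpoly (hψ.fun_pow k) i
  refine Complex.norm_le_of_forall_mem_frontier_norm_le isBounded_ball hcl (fun y hy => ?_)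
    (subset_closure hx)
  rw [frontier_ball _ hr0] at hy
  refine norm_coeff_charpoly_le (fun s hs => ?_) i
  obtain ⟨u, hu, rfl⟩ := (isRoot_charpoly_pow hk).1 hs
  rw [norm_pow]
  exact pow_le_pow_left₀ (norm_nonneg u) (h y hy u hu) k

theorem norm_le_of_isRoot_charpoly_smul {ψ : ℂ → Matrix ι ι ℂ}
    (hψ : DifferentiableOn ℂ ψ (ball 0 1)) (hR : 0 ≤ R)
    (h : ∀ x ∈ ball (0 : ℂ) 1, ∀ t, (x • ψ x).charpoly.IsRoot t → ‖t‖ ≤ R) {x : ℂ}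
    (hx : x ∈ ball (0 : ℂ) 1) {t : ℂ} (ht : (ψ x).charpoly.IsRoot t) : ‖t‖ ≤ R := by
  rw [mem_ball_zero_iff] at hx
  have hr {r : ℝ} (hxr : ‖x‖ < r) (hr1 : r < 1) : ‖t‖ ≤ R / r := by
    have hr0 : 0 < r := (norm_nonneg _).trans_lt hxr
    refine norm_le_of_isRoot_charpoly_of_sphere (hψ.mono (closedBall_subset_ball hr1))
      (by positivity) (fun y hy u hu => ?_) (mem_ball_zero_iff.2 hxr) ht
    rw [mem_sphere_zero_iff_norm] at hy
    have hy0 : y ≠ 0 := norm_ne_zero_iff.1 (hy ▸ hr0.ne')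
    rw [le_div_iff₀ hr0, mul_comm, ← hy, ← norm_mul]
    exact h y (by simpa [hy] using hr1) _ ((isRoot_charpoly_smul hy0).2 hu)
  have htend : Filter.Tendsto (fun r : ℝ => R / r) (𝓝[<] 1) (𝓝 (R / 1)) :=
    (continuousAt_const.div continuousAt_id one_ne_zero).mono_left nhdsWithin_le_nhds
  rw [div_one] at htend
  refine ge_of_tendsto htend ?_
  filter_upwards [self_mem_nhdsWithin, (lt_mem_nhds hx).filter_mono nhdsWithin_le_nhds]
    with r h1 h2 using hr h2 h1

theorem exists_eq_smul_of_apply_eq_zero {E : Type*} [NormedAddCommGroup E] [NormedSpace ℂ E]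
    [CompleteSpace E] {f : ℂ → E} {s : Set ℂ} {a : ℂ} (hf : DifferentiableOn ℂ f s)
    (hs : s ∈ 𝓝 a) (h : f a = 0) :
    ∃ g : ℂ → E, DifferentiableOn ℂ g s ∧ ∀ x, f x = (x - a) • g x :=
  ⟨dslope f a, (Complex.differentiableOn_dslope hs).2 hf,
    fun x => by rw [sub_smul_dslope, h, sub_zero]⟩

theorem norm_le_mul_norm_of_isRoot_charpoly {φ : ℂ → Matrix ι ι ℂ}
    (hφ : DifferentiableOn ℂ φ (ball 0 1)) (hR : 0 ≤ R) (h0 : φ 0 = 0)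
    (h : ∀ x ∈ ball (0 : ℂ) 1, ∀ t, (φ x).charpoly.IsRoot t → ‖t‖ ≤ R) {x : ℂ}
    (hx : x ∈ ball (0 : ℂ) 1) {t : ℂ} (ht : (φ x).charpoly.IsRoot t) : ‖t‖ ≤ R * ‖x‖ := by
  obtain ⟨ψ, hψ, hφψ⟩ := exists_eq_smul_of_apply_eq_zero hφ (ball_mem_nhds 0 one_pos) h0
  simp only [sub_zero] at hφψ
  rcases eq_or_ne x 0 with rfl | hx0
  · simpa [h0] using norm_le_opNorm_of_isRoot_charpoly ht
  · rw [hφψ, ← mul_div_cancel₀ t hx0, isRoot_charpoly_smul hx0] at ht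
    have hle := norm_le_of_isRoot_charpoly_smul hψ hR
      (fun y hy u hu => h y hy u (by rwa [hφψ])) hx ht
    rwa [norm_div, div_le_iff₀ (norm_pos_iff.2 hx0)] at hle

theorem lempert_zero_le {B : Matrix (Fin n) (Fin n) ℂ} (hB : B ∈ spectralBall n) :
    lempert (spectralBall n) 0 B ≤ spectralRadius ℂ B := by
  refine le_of_forall_gt fun c hc => ?_
  obtain ⟨r, hr0, hr1⟩ := exists_between (lt_min hc hB : spectralRadius ℂ B < min c 1)
  have hrtop : r < 1 := hr1.trans_le (min_le_right _ _)
  lift r to NNReal using hrtop.ne_top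
  have hrpos : (0 : ℝ) < r := by exact_mod_cast (zero_le (a := spectralRadius ℂ B)).trans_lt hr0
  have hrne : ((r : ℝ) : ℂ) ≠ 0 := Complex.ofReal_ne_zero.2 hrpos.ne'
  have hnorm : ‖((r : ℝ) : ℂ)‖ = r := by simp
  have henorm : ‖((r : ℝ) : ℂ)‖ₑ = r := by
    rw [enorm_eq_nnnorm, Complex.nnnorm_real, Real.nnnorm_of_nonneg hrpos.le]
    rfl
  refine lempert_lt_iff.2 ⟨(r : ℝ), mem_ball_zero_iff.2 (hnorm.trans_lt (by exact_mod_cast hrtop)),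
    henorm ▸ hr1.trans_le (min_le_left _ _), fun x => (x / (r : ℝ)) • B, by fun_prop,
    fun x hx => smul_mem_spectralBall fun t ht => ?_, by simp, by simp [div_self hrne]⟩
  have htr : ‖t‖ < r := by exact_mod_cast (enorm_le_spectralRadius ht).trans_lt hr0
  rw [norm_div, hnorm, div_mul_eq_mul_div, div_lt_one hrpos]
  exact (mul_le_of_le_one_left (norm_nonneg t) (mem_ball_zero_iff.1 hx).le).trans_lt htr

theorem lempert_zero_left {B : Matrix (Fin n) (Fin n) ℂ} (hB : B ∈ spectralBall n) :
    lempert (spectralBall n) 0 B = spectralRadius ℂ B := by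
  refine le_antisymm (lempert_zero_le hB) (le_of_forall_gt fun c hc => ?_)
  obtain ⟨α, hα, hαc, φ, hφ, hm, h0, rfl⟩ := lempert_lt_iff.1 hc
  refine (spectralRadius_le_iff.2 fun t ht => ?_).trans_lt hαc
  rw [enorm_le_iff_norm_le]
  simpa using norm_le_mul_norm_of_isRoot_charpoly hφ zero_le_one h0
    (fun x hx t ht => (mem_spectralBall_iff.1 (hm hx) t ht).le) hα ht

end Schwarz

section Moebius

open scoped Matrix.Norms.Operator ComplexConjugate

/-- The Möbius map `z ↦ (z - μ) / (1 - conj μ * z)` applied to a matrix. For `‖μ‖ < 1` it is an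
automorphism of the spectral unit ball which sends `μ • 1` to `0`. -/
noncomputable def matrixMoebius {ι : Type*} [Fintype ι] [DecidableEq ι] (μ : ℂ)
    (M : Matrix ι ι ℂ) : Matrix ι ι ℂ :=
  (M - μ • 1) * (1 - conj μ • M)⁻¹

theorem det_smul_one_sub_smul {ι K : Type*} [Fintype ι] [DecidableEq ι] [Field K] {a b : K}
    (hb : b ≠ 0) (M : Matrix ι ι K) :
    (a • (1 : Matrix ι ι K) - b • M).det = b ^ Fintype.card ι * M.charpoly.eval (a / b) := by
  rw [eval_charpoly_eq_det, ← Matrix.det_smul, smul_sub, smul_smul, mul_div_cancel₀ _ hb]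

variable {n : ℕ} {μ : ℂ} {A B M : Matrix (Fin n) (Fin n) ℂ}

theorem det_one_sub_conj_smul_ne_zero (hμ : ‖μ‖ < 1) (hM : M ∈ spectralBall n) :
    (1 - conj μ • M).det ≠ 0 := by
  rcases eq_or_ne μ 0 with rfl | h0
  · simp
  · have hc : conj μ ≠ 0 := by simpa using h0
    have hdet := det_smul_one_sub_smul (a := 1) hc M
    rw [one_smul] at hdet
    rw [hdet]
    refine mul_ne_zero (pow_ne_zero _ hc) fun h => ?_
    have hlt := mem_spectralBall_iff.1 hM _ h
    rw [norm_div, norm_one, RCLike.norm_conj, div_lt_one (norm_pos_iff.2 h0)] at hlt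
    exact hμ.not_gt hlt

theorem matrixMoebius_eq_iff (hμ : ‖μ‖ < 1) (hM : M ∈ spectralBall n) :
    matrixMoebius μ M = A ↔ M - μ • 1 = A * (1 - conj μ • M) := by
  have hu : IsUnit (1 - conj μ • M).det := (det_one_sub_conj_smul_ne_zero hμ hM).isUnit
  constructor
  · rintro rfl
    rw [matrixMoebius, Matrix.nonsing_inv_mul_cancel_right _ _ hu]
  · intro h
    rw [matrixMoebius, h, Matrix.mul_nonsing_inv_cancel_right _ _ hu]

theorem matrixMoebius_mul (hμ : ‖μ‖ < 1) (hM : M ∈ spectralBall n) :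
    matrixMoebius μ M * (1 - conj μ • M) = M - μ • 1 :=
  ((matrixMoebius_eq_iff hμ hM).1 rfl).symm

theorem det_smul_one_sub_matrixMoebius (hμ : ‖μ‖ < 1) (hM : M ∈ spectralBall n) (x : ℂ) :
    (x • 1 - matrixMoebius μ M).det * (1 - conj μ • M).det =
      ((x + μ) • (1 : Matrix (Fin n) (Fin n) ℂ) - (1 + x * conj μ) • M).det := by
  rw [← Matrix.det_mul, sub_mul, matrixMoebius_mul hμ hM, smul_mul_assoc, one_mul]
  congr 1
  module

theorem exists_of_isRoot_charpoly_matrixMoebius (hμ : ‖μ‖ < 1) (hM : M ∈ spectralBall n) {x : ℂ}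
    (hx : (matrixMoebius μ M).charpoly.IsRoot x) :
    ∃ y, M.charpoly.IsRoot y ∧ x = (y - μ) / (1 - conj μ * y) := by
  have hdet := det_smul_one_sub_matrixMoebius hμ hM x
  rw [← eval_charpoly_eq_det, hx.eq_zero, zero_mul] at hdet
  have hb : 1 + x * conj μ ≠ 0 := by
    intro hb
    rw [hb, zero_smul, sub_zero, Matrix.det_smul, Matrix.det_one, mul_one] at hdet
    have hxμ := eq_neg_of_add_eq_zero_left (eq_zero_of_pow_eq_zero hdet.symm)
    refine one_sub_conj_mul_ne_zero hμ hμ ?_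
    rw [hxμ] at hb
    linear_combination hb
  rw [det_smul_one_sub_smul hb, eq_comm, mul_eq_zero, or_iff_right (pow_ne_zero _ hb)] at hdet
  have hy1 := one_sub_conj_mul_ne_zero hμ (mem_spectralBall_iff.1 hM _ hdet)
  refine ⟨_, hdet, ?_⟩
  rw [eq_div_iff hy1]
  field_simp
  ring

theorem matrixMoebius_mem (hμ : ‖μ‖ < 1) (hM : M ∈ spectralBall n) :
    matrixMoebius μ M ∈ spectralBall n := by
  refine mem_spectralBall_iff.2 fun t ht => ?_
  obtain ⟨y, hy, rfl⟩ := exists_of_isRoot_charpoly_matrixMoebius hμ hM ht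
  rw [norm_div, norm_sub_rev, ← norm_div]
  exact norm_moebius_lt_one hμ (mem_spectralBall_iff.1 hM y hy)

theorem charpoly_matrixMoebius_eq (hμ : ‖μ‖ < 1) (hA : A ∈ spectralBall n)
    (h : A.charpoly = B.charpoly) :
    (matrixMoebius μ A).charpoly = (matrixMoebius μ B).charpoly := by
  have hB := mem_spectralBall_of_charpoly_eq h hA
  have hdet (a b : ℂ) : (a • (1 : Matrix (Fin n) (Fin n) ℂ) - b • A).det =
      (a • (1 : Matrix (Fin n) (Fin n) ℂ) - b • B).det := by
    rcases eq_or_ne b 0 with rfl | hb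
    · simp
    · rw [det_smul_one_sub_smul hb, det_smul_one_sub_smul hb, h]
  have hone := hdet 1 (conj μ)
  rw [one_smul] at hone
  refine Polynomial.funext fun x => ?_
  have hx := det_smul_one_sub_matrixMoebius hμ hA x
  rw [hdet, ← det_smul_one_sub_matrixMoebius hμ hB x, hone] at hx
  rw [eval_charpoly_eq_det, eval_charpoly_eq_det]
  exact mul_right_cancel₀ (det_one_sub_conj_smul_ne_zero hμ hB) hx

theorem matrixMoebius_mul_self (hμ : ‖μ‖ < 1) (hM : M ∈ spectralBall n) :
    matrixMoebius μ M * M = M * matrixMoebius μ M := by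
  have hu : IsUnit (1 - conj μ • M) :=
    (Matrix.isUnit_iff_isUnit_det _).2 (det_one_sub_conj_smul_ne_zero hμ hM).isUnit
  have hcomm : M * (1 - conj μ • M) = (1 - conj μ • M) * M := by simp [mul_sub, sub_mul]
  refine hu.mul_left_injective ?_
  simp only
  rw [mul_assoc, hcomm, ← mul_assoc, matrixMoebius_mul hμ hM, mul_assoc, matrixMoebius_mul hμ hM]
  simp [mul_sub, sub_mul]

theorem matrixMoebius_neg_matrixMoebius (hμ : ‖μ‖ < 1) (hM : M ∈ spectralBall n) :
    matrixMoebius (-μ) (matrixMoebius μ M) = M := by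
  have hmul := matrixMoebius_mul hμ hM
  rw [matrixMoebius_eq_iff (by simpa using hμ) (matrixMoebius_mem hμ hM), mul_sub, mul_smul_comm,
    ← matrixMoebius_mul_self hμ hM, map_neg, neg_smul, neg_smul, sub_neg_eq_add, sub_neg_eq_add,
    mul_one]
  rw [mul_sub, mul_smul_comm, mul_one] at hmul
  exact sub_eq_sub_iff_add_eq_add.1 hmul

theorem matrixMoebius_self {ι : Type*} [Fintype ι] [DecidableEq ι] (μ : ℂ) :
    matrixMoebius μ (μ • (1 : Matrix ι ι ℂ)) = 0 := by
  simp [matrixMoebius]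

theorem matrixMoebius_neg_zero {ι : Type*} [Fintype ι] [DecidableEq ι] (μ : ℂ) :
    matrixMoebius (-μ) (0 : Matrix ι ι ℂ) = μ • 1 := by
  simp [matrixMoebius]

theorem diagonal_mem_spectralBall_iff {d : Fin n → ℂ} :
    Matrix.diagonal d ∈ spectralBall n ↔ ∀ i, ‖d i‖ < 1 := by
  simp only [mem_spectralBall_iff, Matrix.charpoly_diagonal, isRoot_prod_X_sub_C]
  exact Set.forall_mem_range

theorem matrixMoebius_diagonal (hμ : ‖μ‖ < 1) {d : Fin n → ℂ} (hd : ∀ i, ‖d i‖ < 1) :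
    matrixMoebius μ (Matrix.diagonal d) =
      Matrix.diagonal fun i => (d i - μ) / (1 - conj μ * d i) := by
  rw [matrixMoebius_eq_iff hμ (diagonal_mem_spectralBall_iff.2 hd)]
  simp only [← Matrix.diagonal_one, ← Matrix.diagonal_smul, Matrix.diagonal_sub,
    Matrix.diagonal_mul_diagonal]
  congr 1
  ext i
  simp [div_mul_cancel₀ _ (one_sub_conj_mul_ne_zero hμ (hd i))]

theorem differentiableOn_matrixMoebius (hμ : ‖μ‖ < 1) :
    DifferentiableOn ℂ (matrixMoebius μ) (spectralBall n) := by
  refine DifferentiableOn.mul (by fun_prop) fun M hM => ?_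
  simp only [Matrix.nonsing_inv_eq_ringInverse]
  have hu : IsUnit (1 - conj μ • M) :=
    (Matrix.isUnit_iff_isUnit_det _).2 (det_one_sub_conj_smul_ne_zero hμ hM).isUnit
  exact ((differentiableAt_inverse (𝕜 := ℂ) hu).comp M (f := fun M => 1 - conj μ • M)
    (by fun_prop)).differentiableWithinAt

theorem lempert_matrixMoebius (hμ : ‖μ‖ < 1) (hA : A ∈ spectralBall n) (hB : B ∈ spectralBall n) :
    lempert (spectralBall n) (matrixMoebius μ A) (matrixMoebius μ B) =
      lempert (spectralBall n) A B := by
  have hμ' : ‖-μ‖ < 1 := by simpa using hμ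
  refine le_antisymm
    (lempert_comp_le (differentiableOn_matrixMoebius hμ) fun _ => matrixMoebius_mem hμ) ?_
  have hle := lempert_comp_le (z := matrixMoebius μ A) (w := matrixMoebius μ B)
    (differentiableOn_matrixMoebius (n := n) hμ') fun _ => matrixMoebius_mem hμ'
  rwa [matrixMoebius_neg_matrixMoebius hμ hA, matrixMoebius_neg_matrixMoebius hμ hB] at hle

theorem smul_one_mem_spectralBall (hμ : ‖μ‖ < 1) :
    μ • (1 : Matrix (Fin n) (Fin n) ℂ) ∈ spectralBall n := by
  rw [← matrixMoebius_neg_zero]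
  exact matrixMoebius_mem (by simpa using hμ) zero_mem_spectralBall

theorem norm_lt_one_of_smul_one_mem [Nonempty (Fin n)]
    (h : μ • (1 : Matrix (Fin n) (Fin n) ℂ) ∈ spectralBall n) : ‖μ‖ < 1 :=
  mem_spectralBall_iff.1 h μ <| by
    rw [Polynomial.IsRoot, eval_charpoly_eq_det, sub_self, Matrix.det_zero]

theorem lempert_smul_one_left (hμ : ‖μ‖ < 1) (hB : B ∈ spectralBall n) :
    lempert (spectralBall n) (μ • 1) B = spectralRadius ℂ (matrixMoebius μ B) := by
  rw [← lempert_matrixMoebius hμ (smul_one_mem_spectralBall hμ) hB, matrixMoebius_self,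
    lempert_zero_left (matrixMoebius_mem hμ hB)]

theorem IsScalarMatrix.continuousOn_lempert [Nonempty (Fin n)] (h : IsScalarMatrix A)
    (hA : A ∈ spectralBall n) :
    ContinuousOn (fun B => lempert (spectralBall n) A B) (spectralBall n) := by
  obtain ⟨μ, rfl⟩ := h
  have hμ := norm_lt_one_of_smul_one_mem hA
  refine fun B hB => tendsto_order.2 ⟨fun c hc => ?_, fun c hc =>
    (eventually_lempert_lt_right hc).filter_mono nhdsWithin_le_nhds⟩
  simp only [lempert_smul_one_left hμ hB] at hc
  have hcont := (differentiableOn_matrixMoebius hμ).continuousOn B hB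
  filter_upwards [hcont.eventually (eventually_lt_spectralRadius hc), self_mem_nhdsWithin]
    with X hX hXm
  rwa [lempert_smul_one_left hμ hXm]

end Moebius

section Companion

open scoped Matrix Matrix.Norms.Operator
open Polynomial (X C)

variable {R : Type*} [CommRing R] {n : ℕ}

/-- The companion matrix with ones above the diagonal and prescribed first column. -/
def firstColumnCompanion (c : Fin n → R) : Matrix (Fin n) (Fin n) R :=
  Matrix.of fun i j => (if (j : ℕ) = 0 then c i else 0) + if (i : ℕ) + 1 = j then 1 else 0

theorem firstColumnCompanion_mulVec_single_zero (c : Fin (n + 1) → R) :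
    firstColumnCompanion c *ᵥ Pi.single 0 1 = c := by
  ext i
  simp [firstColumnCompanion]

theorem firstColumnCompanion_mulVec_single_succ (c : Fin (n + 1) → R) (i : Fin n) :
    firstColumnCompanion c *ᵥ Pi.single i.succ 1 = Pi.single i.castSucc 1 := by
  ext k
  rw [Matrix.mulVec_single_one]
  simp only [firstColumnCompanion, Matrix.col_apply, Matrix.of_apply, Fin.val_succ, Pi.single_apply,
    Fin.ext_iff, Fin.val_castSucc, Nat.succ_ne_zero, if_false, zero_add, add_left_inj]

theorem firstColumnCompanion_pow_mulVec_single_last (c : Fin (n + 1) → R) (j : Fin (n + 1)) :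
    firstColumnCompanion c ^ (j.rev : ℕ) *ᵥ Pi.single (Fin.last n) 1 = Pi.single j 1 := by
  induction j using Fin.reverseInduction with
  | last => rw [Fin.rev_last, Fin.val_zero, pow_zero, Matrix.one_mulVec]
  | cast i ih =>
    rw [Fin.rev_succ, Fin.val_castSucc] at ih
    rw [Fin.rev_castSucc, Fin.val_succ, pow_succ', ← Matrix.mulVec_mulVec, ih,
      firstColumnCompanion_mulVec_single_succ]

theorem sum_range_eq_sum_fin_rev {M : Type*} [AddCommMonoid M] (f : ℕ → M) :
    ∑ k ∈ Finset.range n, f k = ∑ j : Fin n, f j.rev := by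
  rw [← Fin.sum_univ_eq_sum_range]
  exact (Equiv.sum_comp Fin.revPerm fun i : Fin n => f i).symm

theorem firstColumnCompanion_pow_card_mulVec (c : Fin (n + 1) → R) :
    firstColumnCompanion c ^ (n + 1) *ᵥ Pi.single (Fin.last n) 1 = c := by
  have hfirst := firstColumnCompanion_pow_mulVec_single_last c 0
  rw [Fin.rev_zero, Fin.val_last] at hfirst
  rw [pow_succ', ← Matrix.mulVec_mulVec, hfirst, firstColumnCompanion_mulVec_single_zero]

theorem charpoly_eq_X_pow_add_sum (A : Matrix (Fin n) (Fin n) R) :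
    A.charpoly = X ^ n + ∑ j : Fin n, C (A.charpoly.coeff j.rev) * X ^ (j.rev : ℕ) := by
  nontriviality R
  have hdeg : A.charpoly.natDegree = n := by
    rw [Matrix.charpoly_natDegree_eq_dim, Fintype.card_fin]
  conv_lhs => rw [A.charpoly_monic.as_sum, hdeg,
    sum_range_eq_sum_fin_rev fun k => C (A.charpoly.coeff k) * X ^ k]

theorem pow_mulVec_eq_neg_sum (A : Matrix (Fin n) (Fin n) R) (v : Fin n → R) :
    A ^ n *ᵥ v = -∑ j : Fin n, A.charpoly.coeff j.rev • (A ^ (j.rev : ℕ) *ᵥ v) := by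
  have h := congrArg (· *ᵥ v) A.aeval_self_charpoly
  rw [charpoly_eq_X_pow_add_sum] at h
  simp only [map_add, map_pow, Polynomial.aeval_X, map_sum, map_mul, Polynomial.aeval_C,
    Matrix.add_mulVec, Matrix.sum_mulVec, Matrix.zero_mulVec, ← Algebra.smul_def,
    Matrix.smul_mulVec] at h
  exact eq_neg_of_add_eq_zero_left h

theorem coeff_charpoly_firstColumnCompanion (c : Fin n → R) (j : Fin n) :
    (firstColumnCompanion c).charpoly.coeff j.rev = -c j := by
  cases n with
  | zero => exact j.elim0
  | succ n =>
    have h := pow_mulVec_eq_neg_sum (firstColumnCompanion c) (Pi.single (Fin.last n) 1)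
    simp only [firstColumnCompanion_pow_card_mulVec,
      firstColumnCompanion_pow_mulVec_single_last] at h
    have hj := congrFun h j
    simp only [Pi.neg_apply, Finset.sum_apply, Pi.smul_apply, Pi.single_apply, smul_eq_mul, mul_ite,
      mul_one, mul_zero, Finset.sum_ite_eq, Finset.mem_univ, if_true] at hj
    rw [hj, neg_neg]

/-- The matrix with columns `A ^ (n - 1) v, …, A v, v`. -/
def krylovMatrix (A : Matrix (Fin n) (Fin n) R) (v : Fin n → R) : Matrix (Fin n) (Fin n) R :=
  Matrix.of fun i j => (A ^ (j.rev : ℕ) *ᵥ v) i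

theorem krylovMatrix_mulVec (A : Matrix (Fin n) (Fin n) R) (v x : Fin n → R) :
    krylovMatrix A v *ᵥ x = ∑ j : Fin n, x j • (A ^ (j.rev : ℕ) *ᵥ v) := by
  ext i
  simp [krylovMatrix, Matrix.mulVec, dotProduct, mul_comm]

theorem krylovMatrix_mulVec_single (A : Matrix (Fin n) (Fin n) R) (v : Fin n → R) (j : Fin n) :
    krylovMatrix A v *ᵥ Pi.single j 1 = A ^ (j.rev : ℕ) *ᵥ v := by
  rw [Matrix.mulVec_single_one]
  rfl

theorem mul_krylovMatrix (A : Matrix (Fin n) (Fin n) R) (v : Fin n → R) :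
    A * krylovMatrix A v =
      krylovMatrix A v * firstColumnCompanion fun j : Fin n => -A.charpoly.coeff j.rev := by
  refine Matrix.toLin'.injective (LinearMap.pi_ext' fun j => LinearMap.ext_ring ?_)
  simp only [LinearMap.comp_apply, LinearMap.coe_single, Matrix.toLin'_apply,
    ← Matrix.mulVec_mulVec, krylovMatrix_mulVec_single]
  rw [Matrix.mulVec_mulVec, ← pow_succ']
  cases n with
  | zero => exact j.elim0
  | succ n =>
    cases j using Fin.cases with
    | zero =>
      rw [firstColumnCompanion_mulVec_single_zero, krylovMatrix_mulVec, Fin.rev_zero, Fin.val_last,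
        pow_mulVec_eq_neg_sum, ← Finset.sum_neg_distrib]
      simp only [neg_smul]
    | succ i =>
      rw [firstColumnCompanion_mulVec_single_succ, krylovMatrix_mulVec_single, Fin.rev_succ,
        Fin.rev_castSucc, Fin.val_castSucc, Fin.val_succ]

variable {A B : Matrix (Fin n) (Fin n) ℂ} {v : Fin n → ℂ}

theorem charpoly_coeff_eq_sigma (A : Matrix (Fin n) (Fin n) ℂ) (j : Fin n) :
    A.charpoly.coeff j.rev = -((-1) ^ (j : ℕ) * sigma A j) := by
  rw [sigma, Fin.val_rev, ← mul_assoc, ← pow_add, ← add_assoc, pow_succ, ← two_mul, pow_mul]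
  simp

theorem charpoly_eq_iff_sigma_eq : A.charpoly = B.charpoly ↔ sigma A = sigma B := by
  refine ⟨fun h => by simp only [funext_iff, sigma, h, implies_true], fun h => ?_⟩
  rw [charpoly_eq_X_pow_add_sum A, charpoly_eq_X_pow_add_sum B]
  simp only [charpoly_coeff_eq_sigma, h]

/-- The companion matrix `M` with `sigma M = s`. It provides a holomorphic section of `sigma`. -/
def companionOfSigma (s : Fin n → ℂ) : Matrix (Fin n) (Fin n) ℂ :=
  firstColumnCompanion fun j => (-1) ^ (j : ℕ) * s j

theorem sigma_companionOfSigma (s : Fin n → ℂ) : sigma (companionOfSigma s) = s := by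
  ext j
  have h := coeff_charpoly_firstColumnCompanion (fun j : Fin n => (-1) ^ (j : ℕ) * s j) j
  rw [charpoly_coeff_eq_sigma, neg_inj] at h
  exact mul_left_cancel₀ (pow_ne_zero _ (by norm_num)) h

theorem mem_symPolydisk_iff {s : Fin n → ℂ} :
    s ∈ symPolydisk n ↔ companionOfSigma s ∈ spectralBall n := by
  refine ⟨?_, fun h => ⟨_, h, sigma_companionOfSigma s⟩⟩
  rintro ⟨A, hA, rfl⟩
  exact mem_spectralBall_of_charpoly_eq
    (charpoly_eq_iff_sigma_eq.2 (sigma_companionOfSigma _).symm) hA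

theorem differentiable_companionOfSigma :
    Differentiable ℂ (companionOfSigma : (Fin n → ℂ) → Matrix (Fin n) (Fin n) ℂ) := by
  rw [← differentiableOn_univ, differentiableOn_matrix_iff]
  intro i j
  simp only [companionOfSigma, firstColumnCompanion, Matrix.of_apply]
  split_ifs <;> fun_prop

theorem isConj_companionOfSigma (h : (krylovMatrix A v).det ≠ 0) :
    IsConj (companionOfSigma (sigma A)) A := by
  have hcomp : companionOfSigma (sigma A) =
      firstColumnCompanion fun j : Fin n => -A.charpoly.coeff j.rev := by
    simp only [companionOfSigma, charpoly_coeff_eq_sigma, neg_neg]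
  rw [hcomp]
  exact isConj_of_det_ne_zero h (mul_krylovMatrix A v).symm

theorem det_krylovMatrix_ne_zero_iff {K : Type*} [Field K] {A : Matrix (Fin n) (Fin n) K}
    {v : Fin n → K} :
    (krylovMatrix A v).det ≠ 0 ↔ Submodule.span K (Set.range fun k : ℕ => A ^ k *ᵥ v) = ⊤ := by
  rw [← isUnit_iff_ne_zero, ← Matrix.isUnit_iff_isUnit_det, ← Matrix.mulVec_surjective_iff_isUnit]
  change Function.Surjective (krylovMatrix A v).mulVecLin ↔ _
  rw [← LinearMap.range_eq_top]
  suffices hspan : LinearMap.range (krylovMatrix A v).mulVecLin =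
      Submodule.span K (Set.range fun k : ℕ => A ^ k *ᵥ v) by rw [hspan]
  refine le_antisymm ?_ (Submodule.span_le.2 ?_)
  · rintro _ ⟨x, rfl⟩
    rw [Matrix.mulVecLin_apply, krylovMatrix_mulVec]
    exact Submodule.sum_mem _ fun j _ =>
      Submodule.smul_mem _ _ (Submodule.subset_span (Set.mem_range_self _))
  · rintro _ ⟨k, rfl⟩
    induction k with
    | zero =>
      cases n with
      | zero => exact ⟨0, Subsingleton.elim _ _⟩
      | succ n =>
        refine ⟨Pi.single (Fin.last n) 1, ?_⟩
        rw [Matrix.mulVecLin_apply, krylovMatrix_mulVec_single, Fin.rev_last, Fin.val_zero]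
    | succ k ih =>
      obtain ⟨x, hx⟩ := ih
      refine ⟨(firstColumnCompanion fun j : Fin n => -A.charpoly.coeff j.rev) *ᵥ x, ?_⟩
      rw [Matrix.mulVecLin_apply] at hx ⊢
      rw [Matrix.mulVec_mulVec, ← mul_krylovMatrix, ← Matrix.mulVec_mulVec, hx,
        Matrix.mulVec_mulVec, ← pow_succ']

theorem isCyclicMatrix_iff : IsCyclicMatrix A ↔ ∃ v, (krylovMatrix A v).det ≠ 0 := by
  simp only [det_krylovMatrix_ne_zero_iff, IsCyclicMatrix]

theorem IsCyclicMatrix.isConj_companionOfSigma (h : IsCyclicMatrix A) :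
    IsConj (companionOfSigma (sigma A)) A := by
  obtain ⟨v, hv⟩ := isCyclicMatrix_iff.1 h
  exact _root_.isConj_companionOfSigma hv

theorem isCyclicMatrix_of_pow_ne_zero (hA : A ^ (n - 1) ≠ 0) (hA' : A ^ n = 0) :
    IsCyclicMatrix A := by
  obtain ⟨v, hv⟩ : ∃ v, A ^ (n - 1) *ᵥ v ≠ 0 := by
    by_contra! h
    exact hA (Matrix.ext_iff_mulVec.2 fun v => by rw [h, Matrix.zero_mulVec])
  refine isCyclicMatrix_iff.2 ⟨v, fun hdet => ?_⟩
  obtain ⟨x, hx, hQx⟩ := Matrix.exists_mulVec_eq_zero_iff.2 hdet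
  obtain ⟨i₀, hi₀⟩ := Function.ne_iff.1 hx
  obtain ⟨j, hj, hmax⟩ := Finset.exists_max_image (Finset.univ.filter fun i => x i ≠ 0) id
    ⟨i₀, by simpa using hi₀⟩
  simp only [Finset.mem_filter, Finset.mem_univ, true_and, id] at hj hmax
  rw [krylovMatrix_mulVec] at hQx
  have hsum := congrArg (A ^ (j : ℕ) *ᵥ ·) hQx
  simp only [Matrix.mulVec_zero, Matrix.mulVec_sum, Matrix.mulVec_smul, Matrix.mulVec_mulVec,
    ← pow_add] at hsum
  rw [Finset.sum_eq_single_of_mem j (Finset.mem_univ j)] at hsum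
  · rw [Fin.val_rev, show (j : ℕ) + (n - (j + 1)) = n - 1 by omega] at hsum
    exact smul_ne_zero hj hv hsum
  · intro i _ hij
    by_cases hxi : x i = 0
    · rw [hxi, zero_smul]
    · have hlt : i < j := lt_of_le_of_ne (hmax i hxi) hij
      rw [Fin.val_rev, show (j : ℕ) + (n - (i + 1)) = n + (j - (i + 1)) by omega, pow_add, hA',
        zero_mul, Matrix.zero_mulVec, smul_zero]

theorem lempert_companionOfSigma_le (s t : Fin n → ℂ) :
    lempert (spectralBall n) (companionOfSigma s) (companionOfSigma t) ≤
      lempert (symPolydisk n) s t :=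
  lempert_comp_le differentiable_companionOfSigma.differentiableOn
    fun _ hs => mem_symPolydisk_iff.1 hs

theorem IsCyclicMatrix.lempert_le_symPolydisk (hA : IsCyclicMatrix A) (hB : IsCyclicMatrix B) :
    lempert (spectralBall n) A B ≤ lempert (symPolydisk n) (sigma A) (sigma B) := by
  rw [← lempert_eq_of_isConj_left hA.isConj_companionOfSigma,
    ← lempert_eq_of_isConj_right hB.isConj_companionOfSigma]
  exact lempert_companionOfSigma_le _ _

end Companion

section NormalFamilies

variable {ι E : Type*} [NormedAddCommGroup E] [NormedSpace ℂ E]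

theorem equicontinuousOn_of_differentiableOn_of_norm_le {s : Set ℂ} (hs : IsOpen s)
    {f : ι → ℂ → E} {C : ℝ} (hf : ∀ p, DifferentiableOn ℂ (f p) s)
    (hC : ∀ p, ∀ x ∈ s, ‖f p x‖ ≤ C) : EquicontinuousOn f s := by
  intro x hx
  obtain ⟨r, hr, hrs⟩ := Metric.isOpen_iff.1 hs x hx
  have hlip (p : ι) (y : ℂ) (hy : y ∈ ball x r) :
      dist (f p x) (f p y) ≤ (C + C) / r * dist y x := by
    rw [dist_comm]
    refine Complex.dist_le_div_mul_dist_of_mapsTo_ball ((hf p).mono hrs) (fun z hz => ?_) hy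
    exact (dist_le_norm_add_norm _ _).trans (add_le_add (hC p z (hrs hz)) (hC p x hx))
  refine EquicontinuousAt.equicontinuousWithinAt
    (equicontinuousAt_of_continuity_modulus (fun y => (C + C) / r * dist y x) ?_ f ?_) s
  · exact Continuous.tendsto' (by fun_prop) _ _ (by simp)
  · filter_upwards [ball_mem_nhds x hr] with y hy p using hlip p y hy

-- Montel's theorem along an ultrafilter: pointwise limits exist by compactness, and
-- equicontinuity upgrades the convergence.
theorem exists_tendstoLocallyUniformlyOn_ultrafilter [FiniteDimensional ℂ E] (U : Ultrafilter ι)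
    {s : Set ℂ} (hs : IsOpen s) {f : ι → ℂ → E} {C : ℝ} (hf : ∀ p, DifferentiableOn ℂ (f p) s)
    (hC : ∀ p, ∀ x ∈ s, ‖f p x‖ ≤ C) : ∃ g : ℂ → E, TendstoLocallyUniformlyOn f g U s := by
  have : ProperSpace E := FiniteDimensional.proper ℂ E
  have hlim (x : ℂ) : ∃ y : E, x ∈ s → Filter.Tendsto (fun p => f p x) U (𝓝 y) := by
    by_cases hx : x ∈ s
    · obtain ⟨y, -, hy⟩ := (isCompact_closedBall (0 : E) C).ultrafilter_le_nhds
        (U.map fun p => f p x) <| Filter.le_principal_iff.2 <|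
          Filter.mem_map.2 <| Filter.univ_mem' fun p => by simpa using hC p x hx
      exact ⟨y, fun _ => hy⟩
    · exact ⟨0, fun h => absurd h hx⟩
  choose g hg using hlim
  have hequi := equicontinuousOn_of_differentiableOn_of_norm_le hs hf hC
  have hconv := (EquicontinuousOn.tendsto_uniformOnFun_iff_pi' (𝔖 := {K | K ⊆ s ∧ IsCompact K})
    (fun K hK => hK.2) (fun K hK => hequi.mono hK.1) U g).2 <| tendsto_pi_nhds.2 fun x =>
      hg x (Set.sUnion_subset (fun K hK => hK.1) x.2)
  rw [UniformOnFun.tendsto_iff_tendstoUniformlyOn] at hconv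
  exact ⟨g, (tendstoLocallyUniformlyOn_iff_forall_isCompact hs).2 fun K hKs hK =>
    hconv K ⟨hKs, hK⟩⟩

theorem exists_disc_closure_of_mem_closure [FiniteDimensional ℂ E] {D : Set E}
    (hD : Bornology.IsBounded D) {z w : E} {c : NNReal} (hc : c < 1)
    (h : (z, w) ∈ closure {q : E × E | lempert D q.1 q.2 < c}) :
    ∃ a : ℂ, ‖a‖ ≤ c ∧ ∃ g : ℂ → E, DifferentiableOn ℂ g (ball 0 1) ∧
      Set.MapsTo g (ball 0 1) (closure D) ∧ g 0 = z ∧ g a = w := by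
  obtain ⟨C, hC⟩ := hD.exists_norm_le
  rw [mem_closure_iff_comap_neBot] at h
  obtain ⟨U, hle⟩ := Ultrafilter.exists_le
    (Filter.comap (Subtype.val : {q : E × E | lempert D q.1 q.2 < c} → E × E) (𝓝 (z, w)))
  have hU : Filter.Tendsto Subtype.val (U : Filter {q : E × E | lempert D q.1 q.2 < c})
      (𝓝 (z, w)) := Filter.tendsto_comap.mono_left hle
  have hdisc (q : {q : E × E | lempert D q.1 q.2 < c}) := lempert_lt_iff.1 q.2
  choose α hα1 hαc φ hφ hm hφ0 hφα using hdisc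
  have hαc' (q) : ‖α q‖ ≤ c := by
    have := hαc q
    rw [enorm_eq_nnnorm, ENNReal.coe_lt_coe] at this
    exact this.le
  obtain ⟨a, ha, hUa⟩ := (isCompact_closedBall (0 : ℂ) c).ultrafilter_le_nhds (U.map α) <|
    Filter.le_principal_iff.2 <| Filter.mem_map.2 <| Filter.univ_mem' fun q => by
      simpa using hαc' q
  rw [mem_closedBall_zero_iff] at ha
  have ha1 : a ∈ ball (0 : ℂ) 1 := mem_ball_zero_iff.2 (ha.trans_lt (by exact_mod_cast hc))
  obtain ⟨g, hlim⟩ := exists_tendstoLocallyUniformlyOn_ultrafilter U isOpen_ball hφ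
    fun q x hx => hC _ (hm q hx)
  have hg := hlim.differentiableOn (Filter.Eventually.of_forall hφ) isOpen_ball
  refine ⟨a, ha, g, hg, fun x hx => ?_, ?_, ?_⟩
  · exact mem_closure_of_tendsto (hlim.tendsto_at hx) (Filter.Eventually.of_forall fun q => hm q hx)
  · refine tendsto_nhds_unique (hlim.tendsto_at (mem_ball_self one_pos)) ?_
    simpa only [hφ0, Function.comp_def] using (continuous_fst.tendsto _).comp hU
  · have hend : Filter.Tendsto (fun q => φ q (α q)) U (𝓝 (g a)) :=
      hlim.tendsto_comp (hg.continuousOn a ha1) ha1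
        (tendsto_nhdsWithin_iff.2 ⟨hUa, Filter.Eventually.of_forall hα1⟩)
    refine tendsto_nhds_unique hend ?_
    simpa only [hφα, Function.comp_def] using (continuous_snd.tendsto _).comp hU

end NormalFamilies

section Nilpotent

open scoped Matrix.Norms.Operator
open Polynomial (X C)

variable {n : ℕ} {A B : Matrix (Fin n) (Fin n) ℂ}

theorem pow_eq_zero_of_charpoly_eq_X_pow {ι R : Type*} [Fintype ι] [DecidableEq ι] [CommRing R]
    {A : Matrix ι ι R} {k : ℕ} (h : A.charpoly = X ^ k) : A ^ k = 0 := by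
  have hCH := A.aeval_self_charpoly
  rwa [h, map_pow, Polynomial.aeval_X] at hCH

theorem eq_zero_of_isRoot_X_pow {K : Type*} [Field K] {k : ℕ} {t : K}
    (h : (X ^ k : Polynomial K).IsRoot t) : t = 0 := by
  rw [Polynomial.IsRoot, Polynomial.eval_pow, Polynomial.eval_X] at h
  exact eq_zero_of_pow_eq_zero h

theorem mem_spectralBall_of_charpoly_eq_X_pow (h : A.charpoly = X ^ n) : A ∈ spectralBall n :=
  mem_spectralBall_iff.2 fun t ht => by
    rw [h] at ht
    rw [eq_zero_of_isRoot_X_pow ht, norm_zero]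
    exact one_pos

theorem zero_mem_closure_orbit (h : A.charpoly = X ^ n) : 0 ∈ closure {Y | IsConj A Y} := by
  obtain ⟨d, hd, hcl⟩ := exists_diagonal_mem_closure A
  have hd0 : d = 0 := funext fun i => eq_zero_of_isRoot_X_pow (k := n) <| by
    rw [← h, hd, isRoot_prod_X_sub_C]
    exact ⟨i, rfl⟩
  rwa [hd0, Pi.zero_def, Matrix.diagonal_zero] at hcl

theorem lempert_lt_one_of_charpoly_eq_X_pow (h : A.charpoly = X ^ n) (hB : B ∈ spectralBall n) :
    lempert (spectralBall n) A B < 1 := by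
  rw [lempert_spectralBall_comm]
  refine (lempert_le_of_mem_closure (zero_mem_closure_orbit h)).trans_lt ?_
  rwa [lempert_spectralBall_comm, lempert_zero_left hB]

theorem sigma_eq_zero_iff : sigma A = 0 ↔ A.charpoly = X ^ n := by
  have hcp : (0 : Matrix (Fin n) (Fin n) ℂ).charpoly = X ^ n := by
    rw [Matrix.charpoly_zero, Fintype.card_fin]
  have hσ : sigma (0 : Matrix (Fin n) (Fin n) ℂ) = 0 := by
    funext j
    rw [sigma, hcp, Polynomial.coeff_X_pow, if_neg (by omega), mul_zero, Pi.zero_apply]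
  rw [← hσ, ← charpoly_eq_iff_sigma_eq, hcp]

theorem isBounded_symPolydisk : Bornology.IsBounded (symPolydisk n) := by
  refine isBounded_iff_forall_norm_le.2 ⟨2 ^ n, ?_⟩
  rintro _ ⟨A, hA, rfl⟩
  refine (pi_norm_le_iff_of_nonneg (by positivity)).2 fun j => ?_
  rw [sigma, norm_mul, norm_pow, norm_neg, norm_one, one_pow, one_mul]
  refine (norm_coeff_charpoly_le (fun t ht => (mem_spectralBall_iff.1 hA t ht).le) _).trans ?_
  rw [one_pow, one_mul, Fintype.card_fin]
  exact_mod_cast Nat.choose_le_two_pow _ _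

theorem norm_le_one_of_mem_closure_symPolydisk {s : Fin n → ℂ} (hs : s ∈ closure (symPolydisk n))
    {t : ℂ} (ht : (companionOfSigma s).charpoly.IsRoot t) : ‖t‖ ≤ 1 := by
  by_contra! hlt
  have hradius : 1 < spectralRadius ℂ (companionOfSigma s) := by
    refine lt_of_lt_of_le ?_ (enorm_le_spectralRadius ht)
    rw [enorm_eq_nnnorm]
    exact_mod_cast hlt
  obtain ⟨u, hu, hus⟩ := mem_closure_iff_nhds.1 hs _
    (differentiable_companionOfSigma.continuous.continuousAt.eventually
      (eventually_lt_spectralRadius hradius))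
  exact absurd (show spectralRadius ℂ (companionOfSigma u) < 1 from mem_symPolydisk_iff.1 hus)
    (not_lt.2 (le_of_lt hu))

-- The Schwarz lemma for the `n`-th power of the companion matrices, which vanishes at `0`.
theorem mapsTo_symPolydisk_of_mapsTo_closure {g : ℂ → Fin n → ℂ}
    (hg : DifferentiableOn ℂ g (ball 0 1))
    (hm : Set.MapsTo g (ball 0 1) (closure (symPolydisk n))) (h0 : g 0 = 0) :
    Set.MapsTo g (ball 0 1) (symPolydisk n) := by
  intro x hx
  refine mem_symPolydisk_iff.2 (mem_spectralBall_iff.2 fun t ht => ?_)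
  rcases Nat.eq_zero_or_pos n with rfl | hn
  · simp at ht
  have hpow : companionOfSigma (g 0) ^ n = 0 := by
    refine pow_eq_zero_of_charpoly_eq_X_pow (sigma_eq_zero_iff.1 ?_)
    rw [sigma_companionOfSigma, h0]
  have hle := norm_le_mul_norm_of_isRoot_charpoly
    ((differentiable_companionOfSigma.comp_differentiableOn hg).fun_pow n) zero_le_one hpow
    (fun y hy s hs => by
      obtain ⟨u, hu, rfl⟩ := (isRoot_charpoly_pow hn).1 hs
      rw [norm_pow]
      exact pow_le_one₀ (norm_nonneg _) (norm_le_one_of_mem_closure_symPolydisk (hm hy) hu))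
    hx ((isRoot_charpoly_pow hn).2 ⟨t, ht, rfl⟩)
  rw [one_mul, norm_pow] at hle
  rw [mem_ball_zero_iff] at hx
  by_contra! hge
  exact absurd (one_le_pow₀ hge) (not_le.2 (hle.trans_lt hx))

theorem eventually_lt_lempert_symPolydisk {s : Fin n → ℂ} {c : ℝ≥0∞} (hc1 : c < 1)
    (hc : c < lempert (symPolydisk n) 0 s) :
    ∀ᶠ q in 𝓝 ((0 : Fin n → ℂ), s), c < lempert (symPolydisk n) q.1 q.2 := by
  by_contra hnot
  obtain ⟨c', hcc', hc'⟩ := exists_between (lt_min hc hc1)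
  obtain ⟨hc', hc'1⟩ := lt_min_iff.1 hc'
  lift c' to NNReal using hc'1.ne_top
  have hmem : ((0 : Fin n → ℂ), s) ∈
      closure {q : (Fin n → ℂ) × (Fin n → ℂ) | lempert (symPolydisk n) q.1 q.2 < c'} :=
    mem_closure_iff_frequently.2 <| (Filter.not_eventually.1 hnot).mono fun q hq =>
      (not_lt.1 hq).trans_lt hcc'
  obtain ⟨a, ha, g, hg, hm, hg0, hga⟩ := exists_disc_closure_of_mem_closure isBounded_symPolydisk
    (by exact_mod_cast hc'1) hmem
  have ha1 : a ∈ ball (0 : ℂ) 1 := mem_ball_zero_iff.2 (ha.trans_lt (by exact_mod_cast hc'1))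
  have hle := lempert_le ha1 hg (mapsTo_symPolydisk_of_mapsTo_closure hg hm hg0)
  rw [hg0, hga, enorm_eq_nnnorm] at hle
  exact absurd (hle.trans (ENNReal.coe_le_coe.2 ha)) (not_le.2 hc')

theorem continuousAt_lempert_of_eq_symPolydisk (hA : A.charpoly = X ^ n) (hB : B ∈ spectralBall n)
    (h : lempert (spectralBall n) A B = lempert (symPolydisk n) (sigma A) (sigma B)) :
    ContinuousAt (fun p : Matrix (Fin n) (Fin n) ℂ × Matrix (Fin n) (Fin n) ℂ =>
      lempert (spectralBall n) p.1 p.2) (A, B) := by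
  refine tendsto_order.2 ⟨fun c hc => ?_, fun c => eventually_lempert_lt isOpen_spectralBall⟩
  have hc1 := hc.trans (lempert_lt_one_of_charpoly_eq_X_pow hA hB)
  simp only [h, sigma_eq_zero_iff.2 hA] at hc
  have hcont : Filter.Tendsto (fun p : Matrix (Fin n) (Fin n) ℂ × Matrix (Fin n) (Fin n) ℂ =>
      (sigma p.1, sigma p.2)) (𝓝 (A, B)) (𝓝 (0, sigma B)) := by
    rw [← sigma_eq_zero_iff.2 hA]
    exact (continuous_matrix_sigma.prodMap continuous_matrix_sigma).tendsto (A, B)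
  filter_upwards [hcont.eventually (eventually_lt_lempert_symPolydisk hc1 hc)] with p hp
  exact hp.trans_le (lempert_symPolydisk_le _ _)

end Nilpotent

section TwoByTwo

open scoped Matrix.Norms.Operator
open Polynomial (X C)

theorem IsCyclicMatrix.not_isScalarMatrix {n : ℕ} (hn : 2 ≤ n) {A : Matrix (Fin n) (Fin n) ℂ}
    (hA : IsCyclicMatrix A) : ¬ IsScalarMatrix A := by
  obtain ⟨v, hv⟩ := hA
  rintro ⟨c, rfl⟩
  have hle : Submodule.span ℂ (Set.range fun k : ℕ =>
      Matrix.mulVec ((c • (1 : Matrix (Fin n) (Fin n) ℂ)) ^ k) v) ≤ Submodule.span ℂ {v} := by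
    rw [Submodule.span_le]
    rintro _ ⟨k, rfl⟩
    simp only [smul_pow, one_pow, Matrix.smul_mulVec, Matrix.one_mulVec]
    exact Submodule.smul_mem _ _ (Submodule.mem_span_singleton_self v)
  rw [hv, top_le_iff] at hle
  have hfin := finrank_span_le_card (R := ℂ) ({v} : Set (Fin n → ℂ))
  rw [hle, finrank_top, Module.finrank_fin_fun, Set.toFinset_singleton,
    Finset.card_singleton] at hfin
  omega

theorem isCyclicMatrix_of_not_isScalarMatrix {A : Matrix (Fin 2) (Fin 2) ℂ}
    (h : ¬ IsScalarMatrix A) : IsCyclicMatrix A := by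
  have hdet (v : Fin 2 → ℂ) (hv : A.mulVec v 0 * v 1 - v 0 * A.mulVec v 1 ≠ 0) :
      IsCyclicMatrix A :=
    isCyclicMatrix_iff.2 ⟨v, by simpa [Matrix.det_fin_two, krylovMatrix] using hv⟩
  by_cases h01 : A 0 1 = 0
  · by_cases h10 : A 1 0 = 0
    · refine hdet ![1, 1] fun h0 => h ⟨A 0 0, ?_⟩
      have hdiag : A 0 0 = A 1 1 := by
        simpa [Matrix.mulVec, dotProduct, h01, h10, sub_eq_zero] using h0
      ext i j
      fin_cases i <;> fin_cases j <;> simp [h01, h10, hdiag]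
    · exact hdet ![1, 0] (by simpa [Matrix.mulVec, dotProduct] using h10)
  · exact hdet ![0, 1] (by simpa [Matrix.mulVec, dotProduct] using h01)

theorem sigma_zero_eq_trace {n : ℕ} (A : Matrix (Fin (n + 1)) (Fin (n + 1)) ℂ) :
    sigma A 0 = A.trace := by
  rw [Matrix.trace_eq_neg_charpoly_coeff, sigma]
  simp

theorem charpoly_smul_one {ι R : Type*} [Fintype ι] [DecidableEq ι] [CommRing R] (μ : R) :
    (μ • (1 : Matrix ι ι R)).charpoly = (X - C μ) ^ Fintype.card ι := by
  rw [Matrix.smul_one_eq_diagonal, Matrix.charpoly_diagonal, Finset.prod_const, Finset.card_univ]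

-- Half the trace is a holomorphic section of `β ↦ σ(β • 1)` into the disc.
theorem lempert_smul_one_le_symPolydisk {μ β : ℂ} :
    lempert (spectralBall 2) (μ • 1) (β • 1) ≤
      lempert (symPolydisk 2) (sigma (μ • (1 : Matrix (Fin 2) (Fin 2) ℂ)))
        (sigma (β • (1 : Matrix (Fin 2) (Fin 2) ℂ))) := by
  set f : (Fin 2 → ℂ) → Matrix (Fin 2) (Fin 2) ℂ := fun s => (s 0 / 2) • 1
  have hsection (c : ℂ) : f (sigma (c • (1 : Matrix (Fin 2) (Fin 2) ℂ))) = c • 1 := by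
    simp [f, sigma_zero_eq_trace]
  have hmaps : Set.MapsTo f (symPolydisk 2) (spectralBall 2) := by
    rintro _ ⟨M, hM, rfl⟩
    refine smul_one_mem_spectralBall ?_
    obtain ⟨d, hd, -⟩ := exists_diagonal_mem_closure M
    have hlt := diagonal_mem_spectralBall_iff.1
      (mem_spectralBall_of_charpoly_eq (hd.trans (Matrix.charpoly_diagonal d).symm) hM)
    rw [charpoly_eq_iff_sigma_eq.1 (hd.trans (Matrix.charpoly_diagonal d).symm),
      sigma_zero_eq_trace, Matrix.trace_diagonal, Fin.sum_univ_two, norm_div, Complex.norm_ofNat,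
      div_lt_one two_pos]
    linarith [norm_add_le (d 0) (d 1), hlt 0, hlt 1]
  have hle := lempert_comp_le (z := sigma (μ • (1 : Matrix (Fin 2) (Fin 2) ℂ)))
    (w := sigma (β • (1 : Matrix (Fin 2) (Fin 2) ℂ))) (f := f) (by fun_prop) hmaps
  rwa [hsection, hsection] at hle

theorem spectralRadius_eq_of_charpoly_eq {ι : Type*} [Fintype ι] [DecidableEq ι]
    {A B : Matrix ι ι ℂ} (h : A.charpoly = B.charpoly) :
    spectralRadius ℂ A = spectralRadius ℂ B :=
  le_antisymm (spectralRadius_le_iff.2 fun _ ht => enorm_le_spectralRadius (h ▸ ht))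
    (spectralRadius_le_iff.2 fun _ ht => enorm_le_spectralRadius (h ▸ ht))

theorem lempert_eq_symPolydisk_two {A B : Matrix (Fin 2) (Fin 2) ℂ} {μ : ℂ}
    (hA : A ∈ spectralBall 2) (hcyc : IsCyclicMatrix A) (hμ : A.charpoly = (X - C μ) ^ 2)
    (hB : B ∈ spectralBall 2) :
    lempert (spectralBall 2) A B = lempert (symPolydisk 2) (sigma A) (sigma B) := by
  refine le_antisymm ?_ (lempert_symPolydisk_le A B)
  by_cases hBs : IsScalarMatrix B
  · obtain ⟨β, rfl⟩ := hBs
    have hβ := norm_lt_one_of_smul_one_mem hB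
    have hcp : A.charpoly = (μ • (1 : Matrix (Fin 2) (Fin 2) ℂ)).charpoly := by
      rw [hμ, charpoly_smul_one, Fintype.card_fin]
    have hscalar : lempert (spectralBall 2) A (β • 1) =
        lempert (spectralBall 2) (μ • 1) (β • 1) := by
      rw [lempert_spectralBall_comm, lempert_smul_one_left hβ hA, lempert_spectralBall_comm,
        lempert_smul_one_left hβ (mem_spectralBall_of_charpoly_eq hcp hA)]
      exact spectralRadius_eq_of_charpoly_eq (charpoly_matrixMoebius_eq hβ hA hcp)
    rw [hscalar, charpoly_eq_iff_sigma_eq.1 hcp]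
    exact lempert_smul_one_le_symPolydisk
  · exact hcyc.lempert_le_symPolydisk (isCyclicMatrix_of_not_isScalarMatrix hBs)

theorem continuousWithinAt_lempert_of_matrixMoebius {n : ℕ} {A B : Matrix (Fin n) (Fin n) ℂ}
    {μ : ℂ} (hμ : ‖μ‖ < 1) (hA : A ∈ spectralBall n) (hB : B ∈ spectralBall n)
    (h : ContinuousWithinAt (fun p : Matrix (Fin n) (Fin n) ℂ × Matrix (Fin n) (Fin n) ℂ =>
      lempert (spectralBall n) p.1 p.2) (spectralBall n ×ˢ spectralBall n)
      (matrixMoebius μ A, matrixMoebius μ B)) :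
    ContinuousWithinAt (fun p : Matrix (Fin n) (Fin n) ℂ × Matrix (Fin n) (Fin n) ℂ =>
      lempert (spectralBall n) p.1 p.2) (spectralBall n ×ˢ spectralBall n) (A, B) := by
  have hcont := (differentiableOn_matrixMoebius (n := n) hμ).continuousOn
  refine ((h.comp (f := Prod.map (matrixMoebius μ) (matrixMoebius μ)) (x := (A, B))
    (hcont.prodMap hcont (A, B) ⟨hA, hB⟩)
    fun p hp => ⟨matrixMoebius_mem hμ hp.1, matrixMoebius_mem hμ hp.2⟩)).congr
    (fun p hp => (lempert_matrixMoebius hμ hp.1 hp.2).symm) (lempert_matrixMoebius hμ hA hB).symm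

theorem charpoly_matrixMoebius_of_eq_pow {n : ℕ} {A : Matrix (Fin n) (Fin n) ℂ} {μ : ℂ}
    (hμ : ‖μ‖ < 1) (hA : A ∈ spectralBall n) (h : A.charpoly = (X - C μ) ^ n) :
    (matrixMoebius μ A).charpoly = X ^ n := by
  have hscalar : A.charpoly = (μ • (1 : Matrix (Fin n) (Fin n) ℂ)).charpoly := by
    rw [h, charpoly_smul_one, Fintype.card_fin]
  rw [charpoly_matrixMoebius_eq hμ hA hscalar, matrixMoebius_self, Matrix.charpoly_zero,
    Fintype.card_fin]

theorem matrixMoebius_eq_zero_iff {n : ℕ} {A : Matrix (Fin n) (Fin n) ℂ} {μ : ℂ}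
    (hμ : ‖μ‖ < 1) (hA : A ∈ spectralBall n) : matrixMoebius μ A = 0 ↔ A = μ • 1 := by
  rw [matrixMoebius_eq_iff hμ hA, zero_mul, sub_eq_zero]

theorem IsScalarMatrix.eq_zero {n : ℕ} {A : Matrix (Fin n) (Fin n) ℂ} (hs : IsScalarMatrix A)
    (h : A.charpoly = X ^ n) : A = 0 := by
  obtain ⟨c, rfl⟩ := hs
  have hpow := pow_eq_zero_of_charpoly_eq_X_pow h
  rw [smul_pow, one_pow, smul_eq_zero] at hpow
  rcases hpow with hc | h1
  · rw [eq_zero_of_pow_eq_zero hc, zero_smul]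
  · rw [h1, smul_zero]

theorem continuousWithinAt_lempert_two {A B : Matrix (Fin 2) (Fin 2) ℂ} {μ : ℂ}
    (hA : A ∈ spectralBall 2) (hcyc : IsCyclicMatrix A) (hμ : A.charpoly = (X - C μ) ^ 2)
    (hB : B ∈ spectralBall 2) :
    ContinuousWithinAt (fun p : Matrix (Fin 2) (Fin 2) ℂ × Matrix (Fin 2) (Fin 2) ℂ =>
      lempert (spectralBall 2) p.1 p.2) (spectralBall 2 ×ˢ spectralBall 2) (A, B) := by
  have hμ1 : ‖μ‖ < 1 := mem_spectralBall_iff.1 hA μ (by rw [hμ]; simp)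
  have hcp := charpoly_matrixMoebius_of_eq_pow hμ1 hA hμ
  have hcyc' : IsCyclicMatrix (matrixMoebius μ A) := isCyclicMatrix_of_not_isScalarMatrix fun hs =>
    hcyc.not_isScalarMatrix le_rfl ⟨μ, (matrixMoebius_eq_zero_iff hμ1 hA).1 (hs.eq_zero hcp)⟩
  have heq := lempert_eq_symPolydisk_two (matrixMoebius_mem hμ1 hA) hcyc'
    (μ := 0) (by rw [hcp, map_zero, sub_zero]) (matrixMoebius_mem hμ1 hB)
  exact continuousWithinAt_lempert_of_matrixMoebius hμ1 hA hB
    (continuousAt_lempert_of_eq_symPolydisk hcp (matrixMoebius_mem hμ1 hB) heq).continuousWithinAt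

end TwoByTwo

section Invariance

open scoped Matrix.Norms.Operator
open Polynomial (X C)

theorem isConj_submatrix_perm {ι R : Type*} [Fintype ι] [DecidableEq ι] [CommRing R]
    (A : Matrix ι ι R) (τ : Equiv.Perm ι) : IsConj A (A.submatrix τ τ) := by
  have hmul (M N : Matrix ι ι R) (e f g : Equiv.Perm ι) :
      M.submatrix e f * N.submatrix f g = (M * N).submatrix e g :=
    Matrix.submatrix_mul_equiv M N e f g
  refine isConj_of_mul_eq (P := (1 : Matrix ι ι R).submatrix τ (1 : Equiv.Perm ι))
    (Q := (1 : Matrix ι ι R).submatrix (1 : Equiv.Perm ι) τ) ?_ ?_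
  · rw [hmul, mul_one, Matrix.submatrix_one_equiv]
  · rw [hmul, mul_one]
    exact (hmul 1 A τ 1 1).trans (by rw [one_mul])

theorem isConj_diagonal_comp_perm {ι R : Type*} [Fintype ι] [DecidableEq ι] [CommRing R]
    (d : ι → R) (τ : Equiv.Perm ι) : IsConj (Matrix.diagonal d) (Matrix.diagonal (d ∘ τ)) :=
  Matrix.submatrix_diagonal_equiv d τ ▸ isConj_submatrix_perm (Matrix.diagonal d) τ

theorem isConj_diagonal_of_prod_eq {ι K : Type*} [Fintype ι] [DecidableEq ι] [Field K]
    {d d' : ι → K} (h : ∏ i, (X - C (d i)) = ∏ i, (X - C (d' i))) :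
    IsConj (Matrix.diagonal d) (Matrix.diagonal d') := by
  classical
  have hroots (d : ι → K) : (∏ i, (X - C (d i))).roots = Finset.univ.val.map d := by
    rw [← Polynomial.roots_multiset_prod_X_sub_C (Finset.univ.val.map d), Multiset.map_map]
    rfl
  have hcard (z : K) : Fintype.card {i // d i = z} = Fintype.card {i // d' i = z} := by
    have hcount := congrArg (fun p => Multiset.count z p.roots) h
    simp only [hroots, Multiset.count_map] at hcount
    simp only [Fintype.card_subtype, Finset.card_def, Finset.filter_val]
    simpa only [eq_comm] using hcount
  let τ : Equiv.Perm ι := Equiv.ofFiberEquiv fun z => Fintype.equivOfCardEq (hcard z)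
  have hτ : d' ∘ τ = d := funext fun i => Equiv.ofFiberEquiv_map _ i
  rw [← hτ]
  exact (isConj_diagonal_comp_perm d' τ).symm

variable {n : ℕ} {A B : Matrix (Fin n) (Fin n) ℂ}

/-- The Lempert function with pole `A` depends only on the characteristic polynomial of the
second argument. Both continuity of `l(A, ·)` and the identity with the Lempert function of the
symmetrized polydisk imply this, and all the obstructions are derived from it. -/
def LempertInvariant (A : Matrix (Fin n) (Fin n) ℂ) : Prop :=
  ∀ B B', B ∈ spectralBall n → B.charpoly = B'.charpoly →
    lempert (spectralBall n) A B = lempert (spectralBall n) A B'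

theorem lempert_eq_of_mem_closure_orbit {D : Matrix (Fin n) (Fin n) ℂ}
    (h : ContinuousOn (fun B => lempert (spectralBall n) A B) (spectralBall n))
    (hD : D ∈ spectralBall n) (hcl : D ∈ closure {Y | IsConj B Y}) :
    lempert (spectralBall n) A B = lempert (spectralBall n) A D := by
  refine le_antisymm (lempert_le_of_mem_closure hcl) (le_of_forall_lt fun c hc => ?_)
  have hev := (h D hD).eventually (lt_mem_nhds hc)
  rw [isOpen_spectralBall.nhdsWithin_eq hD] at hev
  obtain ⟨Y, hY, hconj⟩ := mem_closure_iff_nhds.1 hcl _ hev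
  rw [lempert_eq_of_isConj_right hconj]
  exact hY

theorem lempertInvariant_of_continuousOn
    (h : ContinuousOn (fun B => lempert (spectralBall n) A B) (spectralBall n)) :
    LempertInvariant A := by
  intro B B' hB hBB'
  have hdiag {Y : Matrix (Fin n) (Fin n) ℂ} (hY : Y ∈ spectralBall n) {d : Fin n → ℂ}
      (hd : Y.charpoly = ∏ i, (X - C (d i)))
      (hcl : Matrix.diagonal d ∈ closure {Z | IsConj Y Z}) :
      lempert (spectralBall n) A Y = lempert (spectralBall n) A (Matrix.diagonal d) :=
    lempert_eq_of_mem_closure_orbit h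
      (mem_spectralBall_of_charpoly_eq (hd.trans (Matrix.charpoly_diagonal d).symm) hY) hcl
  obtain ⟨d, hd, hcl⟩ := exists_diagonal_mem_closure B
  obtain ⟨d', hd', hcl'⟩ := exists_diagonal_mem_closure B'
  rw [hdiag hB hd hcl, hdiag (mem_spectralBall_of_charpoly_eq hBB' hB) hd' hcl']
  exact lempert_eq_of_isConj_right (isConj_diagonal_of_prod_eq (by rw [← hd, ← hd', hBB']))

theorem lempertInvariant_matrixMoebius (h : LempertInvariant A) {μ : ℂ} (hμ : ‖μ‖ < 1)
    (hA : A ∈ spectralBall n) : LempertInvariant (matrixMoebius μ A) := by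
  have hμ' : ‖-μ‖ < 1 := by rwa [norm_neg]
  intro B B' hB hBB'
  have hpull {Y : Matrix (Fin n) (Fin n) ℂ} (hY : Y ∈ spectralBall n) :
      lempert (spectralBall n) (matrixMoebius μ A) Y =
        lempert (spectralBall n) A (matrixMoebius (-μ) Y) := by
    rw [← lempert_matrixMoebius hμ' (matrixMoebius_mem hμ hA) hY,
      matrixMoebius_neg_matrixMoebius hμ hA]
  rw [hpull hB, hpull (mem_spectralBall_of_charpoly_eq hBB' hB)]
  exact h _ _ (matrixMoebius_mem hμ' hB) (charpoly_matrixMoebius_eq hμ' hB hBB')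

theorem charpoly_eq_X_pow_of_pow_eq_zero {k : ℕ} (h : A ^ k = 0) : A.charpoly = X ^ n := by
  have hnil := Matrix.isNilpotent_charpoly_sub_pow_of_isNilpotent ⟨k, h⟩
  rw [Fintype.card_fin] at hnil
  exact sub_eq_zero.1 hnil.eq_zero

end Invariance

section DistinctEigenvalues

open scoped Matrix.Norms.Operator ComplexConjugate
open Polynomial (X C)

/-- The matrix `diagonal c + diagonal e * P`, where `P` is the matrix of the map `p`. For an
involution `p` it splits into `2 × 2` blocks, which can be made nilpotent and joined to a diagonal
matrix independently of each other. -/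
def pairingMatrix {ι R : Type*} [DecidableEq ι] [Semiring R] (p : ι → ι) (c e : ι → R) :
    Matrix ι ι R :=
  Matrix.of fun k l => (if l = k then c k else 0) + if l = p k then e k else 0

theorem pairingMatrix_zero_right {ι R : Type*} [DecidableEq ι] [Semiring R] (p : ι → ι)
    (c : ι → R) : pairingMatrix p c 0 = Matrix.diagonal c := by
  ext k l
  simp [pairingMatrix, Matrix.diagonal_apply, eq_comm]

variable {ι : Type*} [Fintype ι]

theorem pairingMatrix_sq_eq_zero {R : Type*} [DecidableEq ι] [CommRing R] {p : ι → ι}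
    {c e : ι → R} (hp : Function.Involutive p) (hc : ∀ k, c (p k) = -c k)
    (he : ∀ k, e k * e (p k) = -c k ^ 2) : pairingMatrix p c e ^ 2 = 0 := by
  ext k m
  rw [pow_two, Matrix.mul_apply, Matrix.zero_apply]
  simp only [pairingMatrix, Matrix.of_apply, add_mul, ite_mul, zero_mul, Finset.sum_add_distrib,
    Finset.sum_ite_eq', Finset.mem_univ, if_true, hp k, hc]
  split_ifs
  all_goals first | linear_combination he k | ring

theorem norm_pairingMatrix_lt_one [DecidableEq ι] {p : ι → ι} {c e : ι → ℂ}
    (h : ∀ k, ‖c k‖ + ‖e k‖ < 1) :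
    ‖pairingMatrix p c e‖ < 1 := by
  rw [← coe_nnnorm, ← NNReal.coe_one, NNReal.coe_lt_coe, Matrix.linfty_opNNNorm_def,
    Finset.sup_lt_iff (by simp)]
  intro k _
  rw [← NNReal.coe_lt_coe, NNReal.coe_sum, NNReal.coe_one]
  simp only [coe_nnnorm]
  calc ∑ l, ‖pairingMatrix p c e k l‖
      ≤ ∑ l, ((if l = k then ‖c k‖ else 0) + if l = p k then ‖e k‖ else 0) := by
        refine Finset.sum_le_sum fun l _ => (norm_add_le _ _).trans (add_le_add ?_ ?_)
        all_goals split_ifs <;> simp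
    _ = ‖c k‖ + ‖e k‖ := by simp [Finset.sum_add_distrib]
    _ < 1 := h k

theorem exists_involutive_forall_notMem {I : Finset ι} (hI : 2 * I.card ≤ Fintype.card ι) :
    ∃ p : ι → ι, Function.Involutive p ∧ ∀ k ∈ I, p k ∉ I := by
  classical
  obtain ⟨f⟩ : Nonempty (I ↪ (Iᶜ : Finset ι)) := Function.Embedding.nonempty_of_card_le <| by
    rw [Fintype.card_coe, Fintype.card_coe, Finset.card_compl]
    omega
  set g : I → ι := fun i => f i
  have hg : Function.Injective g := Subtype.val_injective.comp f.injective
  have hgI (i : I) : g i ∉ I := Finset.mem_compl.1 (f i).2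
  let p : ι → ι := fun k => if h : k ∈ I then g ⟨k, h⟩ else Function.extend g Subtype.val id k
  have hpI (i : I) : p i = g i := dif_pos i.2
  have hpg (i : I) : p (g i) = i := (dif_neg (hgI i)).trans (hg.extend_apply _ _ i)
  refine ⟨p, fun k => ?_, fun k hk => by rw [hpI ⟨k, hk⟩]; exact hgI _⟩
  by_cases hk : k ∈ I
  · rw [hpI ⟨k, hk⟩, hpg]
  · by_cases hkg : ∃ i, g i = k
    · obtain ⟨i, rfl⟩ := hkg
      rw [hpg, hpI]
    · have hfix : p k = k := (dif_neg hk).trans (Function.extend_apply' _ _ _ hkg)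
      rw [hfix, hfix]

theorem exists_pairing {K : Type*} [NormedField K] {I : Finset ι}
    (hI : 2 * I.card ≤ Fintype.card ι) {η : K} (hη : η ≠ 0) :
    ∃ (p : ι → ι) (c e : ι → K), Function.Involutive p ∧ (∀ k, c (p k) = -c k) ∧
      (∀ k, e k * e (p k) = -c k ^ 2) ∧ (∀ k ∈ I, c k = -1 ∧ e k = η) ∧
      ∀ k, k ∉ I → ‖c k‖ ≤ 1 ∧ ‖e k‖ ≤ ‖η‖⁻¹ := by
  classical
  obtain ⟨p, hp, hpI⟩ := exists_involutive_forall_notMem hI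
  refine ⟨p, fun k => if k ∈ I then -1 else if p k ∈ I then 1 else 0,
    fun k => if k ∈ I then η else if p k ∈ I then -η⁻¹ else 0, hp, fun k => ?_, fun k => ?_,
    fun k hk => ⟨if_pos hk, if_pos hk⟩, fun k hk => ⟨?_, ?_⟩⟩
  · by_cases hk : k ∈ I
    · simp [hp k, hk, hpI k hk]
    · by_cases hpk : p k ∈ I <;> simp [hp k, hk, hpk]
  · by_cases hk : k ∈ I
    · simp [hp k, hk, hpI k hk, hη]
    · by_cases hpk : p k ∈ I <;> simp [hp k, hk, hpk, hη]
  · by_cases hpk : p k ∈ I <;> simp [hk, hpk]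
  · by_cases hpk : p k ∈ I <;> simp [hk, hpk]

theorem norm_sub_add_norm_lt_one {a x : ℂ} {ε : ℝ} (ha : ‖a‖ < 1) (hx : ‖x‖ ≤ 1) (hε : 0 < ε)
    (hε1 : ε < 1) : ‖x + ε * (x - a) * -1‖ + ‖ε * (x - a) * ((1 - ‖a‖) / 4 : ℝ)‖ < 1 := by
  have hxa : ‖x - a‖ ≤ 2 := (norm_sub_le _ _).trans (by linarith)
  have hconv : ‖x + ε * (x - a) * -1‖ ≤ (1 - ε) + ε * ‖a‖ := by
    rw [show x + ε * (x - a) * -1 = ((1 - ε : ℝ) : ℂ) * x + ε * a by push_cast; ring]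
    refine (norm_add_le _ _).trans ?_
    rw [norm_mul, norm_mul, Complex.norm_of_nonneg hε.le, Complex.norm_of_nonneg (by linarith)]
    nlinarith
  have herr : ‖ε * (x - a) * ((1 - ‖a‖) / 4 : ℝ)‖ ≤ ε * 2 * ((1 - ‖a‖) / 4) := by
    rw [norm_mul, norm_mul, Complex.norm_of_nonneg hε.le, Complex.norm_of_nonneg (by linarith)]
    gcongr
  nlinarith [mul_pos hε (sub_pos.2 ha)]

theorem norm_add_add_norm_le {a x b c e : ℂ} {ε δ : ℝ} (ha : ‖a‖ < 1) (hx : ‖x‖ ≤ 1)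
    (hε : 0 ≤ ε) (hc : ‖c‖ ≤ 1) (he : ‖e‖ ≤ δ) :
    ‖x * b / a + ε * (x - a) * c‖ + ‖ε * (x - a) * e‖ ≤ ‖b‖ / ‖a‖ + 2 * ε * (1 + δ) := by
  have hxa : ‖x - a‖ ≤ 2 := (norm_sub_le _ _).trans (by linarith)
  have hmain : ‖x * b / a‖ ≤ ‖b‖ / ‖a‖ := by
    rw [norm_div, norm_mul]
    gcongr
    exact mul_le_of_le_one_left (norm_nonneg _) hx
  have hperturb {y : ℂ} {r : ℝ} (hy : ‖y‖ ≤ r) : ‖ε * (x - a) * y‖ ≤ ε * 2 * r := by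
    rw [norm_mul, norm_mul, Complex.norm_of_nonneg hε]
    gcongr
  linarith [norm_add_le (x * b / a) (ε * (x - a) * c), hperturb hc, hperturb he]

theorem exists_forall_div_add_lt_one {ι : Type*} [Finite ι] {d : ι → ℂ} {a : ℂ} (δ : ℝ) :
    ∃ ε : ℝ, 0 < ε ∧ ε < 1 ∧ ∀ i, ‖d i‖ < ‖a‖ → ‖d i‖ / ‖a‖ + 2 * ε * (1 + δ) < 1 := by
  have hsmall : ∀ᶠ ε in 𝓝[>] (0 : ℝ), ε < 1 ∧
      ∀ i, ‖d i‖ < ‖a‖ → ‖d i‖ / ‖a‖ + 2 * ε * (1 + δ) < 1 := by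
    refine (eventually_nhdsWithin_of_eventually_nhds (eventually_lt_nhds one_pos)).and ?_
    refine Filter.eventually_all.2 fun i => Filter.eventually_imp_distrib_left.2 fun hi => ?_
    refine eventually_nhdsWithin_of_eventually_nhds (ContinuousAt.eventually_lt (by fun_prop)
      continuousAt_const ?_)
    rw [mul_zero, zero_mul, add_zero, div_lt_one ((norm_nonneg _).trans_lt hi)]
    exact hi
  obtain ⟨ε, ⟨hε1, hε⟩, hε0⟩ := (hsmall.and self_mem_nhdsWithin).exists
  exact ⟨ε, hε0, hε1, hε⟩

-- At most half of the diagonal entries are equal to `a`. Pairing each of them with a smaller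
-- entry, one can tilt the disc `x ↦ (x / a) • diagonal d` inwards, keeping its value at `a` and a
-- nilpotent value at `0`.
theorem exists_disc_of_card_le [DecidableEq ι] {d : ι → ℂ} {a : ℂ} (ha0 : a ≠ 0) (ha : ‖a‖ < 1)
    (hd : ∀ i, d i = a ∨ ‖d i‖ < ‖a‖)
    (hcard : 2 * (Finset.univ.filter fun i => d i = a).card ≤ Fintype.card ι) :
    ∃ φ : ℂ → Matrix ι ι ℂ, Differentiable ℂ φ ∧ (∀ x ∈ closedBall (0 : ℂ) 1, ‖φ x‖ < 1) ∧
      φ 0 ^ 2 = 0 ∧ φ a = Matrix.diagonal d := by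
  have hη0 : 0 < (1 - ‖a‖) / 4 := by linarith
  set η : ℂ := (((1 - ‖a‖) / 4 : ℝ) : ℂ)
  have hη : η ≠ 0 := Complex.ofReal_ne_zero.2 hη0.ne'
  obtain ⟨p, c, e, hp, hc, he, hI, hce⟩ := exists_pairing hcard hη
  simp only [Finset.mem_filter_univ] at hI hce
  obtain ⟨ε, hε0, hε1, hε⟩ := exists_forall_div_add_lt_one (d := d) (a := a) ‖η‖⁻¹
  refine ⟨fun x => pairingMatrix p (fun k => x * d k / a + ε * (x - a) * c k)
    fun k => ε * (x - a) * e k, ?_, fun x hx => norm_pairingMatrix_lt_one fun k => ?_, ?_, ?_⟩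
  · rw [← differentiableOn_univ, differentiableOn_matrix_iff]
    intro i j
    simp only [pairingMatrix, Matrix.of_apply]
    split_ifs <;> fun_prop
  · rw [mem_closedBall_zero_iff] at hx
    rcases eq_or_ne (d k) a with hk | hk
    · rw [(hI k hk).1, (hI k hk).2, hk, mul_div_cancel_right₀ _ ha0]
      exact norm_sub_add_norm_lt_one ha hx hε0 hε1
    · exact (norm_add_add_norm_le ha hx hε0.le (hce k hk).1 (hce k hk).2).trans_lt
        (hε k ((hd k).resolve_left hk))
  · refine pairingMatrix_sq_eq_zero hp (fun k => ?_) fun k => ?_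
    · rw [hc]
      ring
    · linear_combination (ε * -a) ^ 2 * he k
  · simp only [sub_self, mul_zero, zero_mul, add_zero, mul_div_cancel_left₀ _ ha0]
    exact pairingMatrix_zero_right p d

variable {n : ℕ}

theorem exists_nilpotent_lempert_lt {d : Fin n → ℂ} {i₀ : Fin n} (hd1 : ‖d i₀‖ < 1)
    (hd : ∀ i, d i = d i₀ ∨ ‖d i‖ < ‖d i₀‖)
    (hcard : 2 * (Finset.univ.filter fun i => d i = d i₀).card ≤ n) :
    ∃ N : Matrix (Fin n) (Fin n) ℂ, N.charpoly = X ^ n ∧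
      lempert (spectralBall n) N (Matrix.diagonal d) < ‖d i₀‖ₑ := by
  have ha0 : d i₀ ≠ 0 := by
    intro h0
    have hall (i : Fin n) : d i = d i₀ := (hd i).resolve_right <| by
      rw [h0, norm_zero]
      exact not_lt.2 (norm_nonneg _)
    simp only [hall, Finset.filter_true, Finset.card_univ, Fintype.card_fin] at hcard
    have := i₀.pos
    omega
  obtain ⟨φ, hφ, hφ1, hφ0, hφa⟩ := exists_disc_of_card_le ha0 hd1 hd (by simpa using hcard)
  refine ⟨φ 0, charpoly_eq_X_pow_of_pow_eq_zero hφ0, ?_⟩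
  rw [← hφa]
  exact lempert_lt_enorm isOpen_spectralBall hφ
    (fun x hx => mem_spectralBall_of_opNorm_lt (hφ1 x hx)) hd1 ha0

-- The Möbius map moving `-b` to `0` singles out `b` among the points of modulus at most `‖b‖`.
theorem norm_moebius_lt_of_norm_le {b x : ℂ} (hb : ‖b‖ < 1) (hxb : ‖x‖ ≤ ‖b‖) (hne : x ≠ b) :
    ‖(x - -b) / (1 - conj (-b) * x)‖ < ‖(b - -b) / (1 - conj (-b) * b)‖ := by
  have hb' : ‖-b‖ < 1 := by rwa [norm_neg]
  have hpos {y : ℂ} (hy : ‖y‖ < 1) : 0 < ‖1 - conj (-b) * y‖ :=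
    norm_pos_iff.2 (one_sub_conj_mul_ne_zero hb' hy)
  rw [norm_div, norm_div, div_lt_div_iff₀ (hpos (hxb.trans_lt hb)) (hpos hb)]
  refine lt_of_pow_lt_pow_left₀ 2 (by positivity) ?_
  rw [mul_pow, mul_pow]
  have hidentity : ‖b - -b‖ ^ 2 * ‖1 - conj (-b) * x‖ ^ 2 -
        ‖x - -b‖ ^ 2 * ‖1 - conj (-b) * b‖ ^ 2 =
      (1 - ‖b‖ ^ 2) ^ 2 * ‖x - b‖ ^ 2 +
        (‖b‖ ^ 2 - ‖x‖ ^ 2) * (1 - ‖b‖ ^ 2) * (2 + 2 * ‖b‖ ^ 2) := by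
    simp only [← Complex.normSq_eq_norm_sq, Complex.normSq_apply, Complex.sub_re, Complex.sub_im,
      Complex.mul_re, Complex.mul_im, Complex.conj_re, Complex.conj_im, Complex.one_re,
      Complex.one_im, Complex.neg_re, Complex.neg_im]
    ring
  have hdist : 0 < ‖x - b‖ := norm_pos_iff.2 (sub_ne_zero.2 hne)
  have hxb2 : 0 ≤ ‖b‖ ^ 2 - ‖x‖ ^ 2 := by nlinarith [norm_nonneg x]
  have hb2 : 0 < 1 - ‖b‖ ^ 2 := by nlinarith [norm_nonneg b]
  have hstrict : 0 < (1 - ‖b‖ ^ 2) ^ 2 * ‖x - b‖ ^ 2 := by positivity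
  have hweak : 0 ≤ (‖b‖ ^ 2 - ‖x‖ ^ 2) * (1 - ‖b‖ ^ 2) * (2 + 2 * ‖b‖ ^ 2) := by positivity
  linarith

theorem moebius_eq_moebius_iff {μ x y : ℂ} (hμ : ‖μ‖ < 1) (hx : ‖x‖ < 1) (hy : ‖y‖ < 1) :
    (x - μ) / (1 - conj μ * x) = (y - μ) / (1 - conj μ * y) ↔ x = y := by
  refine ⟨fun h => ?_, fun h => by rw [h]⟩
  rw [div_eq_div_iff (one_sub_conj_mul_ne_zero hμ hx) (one_sub_conj_mul_ne_zero hμ hy)] at h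
  have hmul : (1 - conj μ * μ) * (x - y) = 0 := by linear_combination h
  exact sub_eq_zero.1 ((mul_eq_zero.1 hmul).resolve_left (one_sub_conj_mul_ne_zero hμ hμ))

/-- `A` degenerates to `diagonal d` as far as the Lempert function is concerned. Unlike membership
of `diagonal d` in the closure of the conjugacy class of `A`, this is visibly invariant under
Möbius maps. The hypothesis `LempertInvariant A` of the argument is carried along. -/
structure DegeneratesToDiagonal (A : Matrix (Fin n) (Fin n) ℂ) (d : Fin n → ℂ) : Prop where
  mem : A ∈ spectralBall n
  charpoly_eq : A.charpoly = (Matrix.diagonal d).charpoly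
  lempert_le : ∀ N ∈ spectralBall n,
    lempert (spectralBall n) A N ≤ lempert (spectralBall n) (Matrix.diagonal d) N
  invariant : LempertInvariant A

namespace DegeneratesToDiagonal

variable {A : Matrix (Fin n) (Fin n) ℂ} {d : Fin n → ℂ}

theorem isRoot (h : DegeneratesToDiagonal A d) (i : Fin n) : A.charpoly.IsRoot (d i) := by
  rw [h.charpoly_eq, Matrix.charpoly_diagonal, isRoot_prod_X_sub_C]
  exact ⟨i, rfl⟩

theorem norm_lt_one (h : DegeneratesToDiagonal A d) (i : Fin n) : ‖d i‖ < 1 :=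
  mem_spectralBall_iff.1 h.mem _ (h.isRoot i)

theorem moebius (h : DegeneratesToDiagonal A d) {μ : ℂ} (hμ : ‖μ‖ < 1) :
    DegeneratesToDiagonal (matrixMoebius μ A) fun i => (d i - μ) / (1 - conj μ * d i) where
  mem := matrixMoebius_mem hμ h.mem
  charpoly_eq := by
    rw [charpoly_matrixMoebius_eq hμ h.mem h.charpoly_eq, matrixMoebius_diagonal hμ h.norm_lt_one]
  lempert_le N hN := by
    have hμ' : ‖-μ‖ < 1 := by rwa [norm_neg]
    have hpull {Y : Matrix (Fin n) (Fin n) ℂ} (hY : Y ∈ spectralBall n) :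
        lempert (spectralBall n) (matrixMoebius μ Y) N =
          lempert (spectralBall n) Y (matrixMoebius (-μ) N) := by
      rw [← lempert_matrixMoebius hμ' (matrixMoebius_mem hμ hY) hN,
        matrixMoebius_neg_matrixMoebius hμ hY]
    rw [← matrixMoebius_diagonal hμ h.norm_lt_one, hpull h.mem,
      hpull (mem_spectralBall_of_charpoly_eq h.charpoly_eq h.mem)]
    exact h.lempert_le _ (matrixMoebius_mem hμ' hN)
  invariant := lempertInvariant_matrixMoebius h.invariant hμ h.mem

theorem lt_two_mul_card_of_eq_or_norm_lt (h : DegeneratesToDiagonal A d) {i₀ : Fin n}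
    (hd : ∀ i, d i = d i₀ ∨ ‖d i‖ < ‖d i₀‖) :
    n < 2 * (Finset.univ.filter fun i => d i = d i₀).card := by
  by_contra! hcard
  obtain ⟨N, hN, hlt⟩ := exists_nilpotent_lempert_lt (h.norm_lt_one i₀) hd hcard
  have hNm := mem_spectralBall_of_charpoly_eq_X_pow hN
  have hlt' : lempert (spectralBall n) A N < ‖d i₀‖ₑ := by
    refine (h.lempert_le N hNm).trans_lt ?_
    rwa [lempert_spectralBall_comm]
  rw [h.invariant N 0 hNm (by rw [hN, Matrix.charpoly_zero, Fintype.card_fin]),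
    lempert_spectralBall_comm, lempert_zero_left h.mem] at hlt'
  exact absurd (enorm_le_spectralRadius (h.isRoot i₀)) (not_le.2 hlt')

theorem lt_two_mul_card_of_norm_le (h : DegeneratesToDiagonal A d) {i₀ : Fin n}
    (hd : ∀ i, ‖d i‖ ≤ ‖d i₀‖) : n < 2 * (Finset.univ.filter fun i => d i = d i₀).card := by
  have hb := h.norm_lt_one i₀
  have hb' : ‖-d i₀‖ < 1 := by rwa [norm_neg]
  have hiff (i : Fin n) := moebius_eq_moebius_iff hb' (h.norm_lt_one i) hb
  have hmaj := (h.moebius hb').lt_two_mul_card_of_eq_or_norm_lt (i₀ := i₀) fun i => by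
    rw [hiff, or_iff_not_imp_left]
    exact norm_moebius_lt_of_norm_le hb (hd i)
  simpa only [hiff] using hmaj

theorem exists_majority (h : DegeneratesToDiagonal A d) (j : Fin n) :
    ∃ i, (d i = d j → ∀ k, d k = d j) ∧
      n < 2 * (Finset.univ.filter fun k => d k = d i).card := by
  have hj := h.norm_lt_one j
  have : Nonempty (Fin n) := ⟨j⟩
  obtain ⟨i, hi⟩ := Finite.exists_max fun k => ‖(d k - d j) / (1 - conj (d j) * d k)‖
  refine ⟨i, fun hij k => ?_, ?_⟩
  · have hk := hi k
    rw [hij, sub_self, zero_div, norm_zero, norm_le_zero_iff, div_eq_zero_iff,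
      or_iff_left (one_sub_conj_mul_ne_zero hj (h.norm_lt_one k)), sub_eq_zero] at hk
    exact hk
  · have hmaj := (h.moebius hj).lt_two_mul_card_of_norm_le hi
    simpa only [moebius_eq_moebius_iff hj (h.norm_lt_one _) (h.norm_lt_one i)] using hmaj

-- The majority value `d i₁`, and the one found after moving `d i₁` to `0`, must coincide.
theorem apply_eq_apply (h : DegeneratesToDiagonal A d) (i j : Fin n) : d i = d j := by
  obtain ⟨i₁, -, hi₁⟩ := h.exists_majority i
  obtain ⟨i₂, hall, hi₂⟩ := h.exists_majority i₁
  have heq : d i₂ = d i₁ := by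
    by_contra hne
    have hdisj : Disjoint (Finset.univ.filter fun k => d k = d i₁)
        (Finset.univ.filter fun k => d k = d i₂) :=
      Finset.disjoint_filter.2 fun k _ hk hk' => hne (hk'.symm.trans hk)
    have hle := (Finset.card_union_of_disjoint hdisj).symm.trans_le (Finset.card_le_univ _)
    rw [Fintype.card_fin] at hle
    omega
  rw [hall heq i, hall heq j]

end DegeneratesToDiagonal

theorem LempertInvariant.exists_charpoly_eq_pow [Nonempty (Fin n)] {A : Matrix (Fin n) (Fin n) ℂ}
    (hA : A ∈ spectralBall n) (h : LempertInvariant A) :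
    ∃ μ : ℂ, ‖μ‖ < 1 ∧ A.charpoly = (X - C μ) ^ n := by
  obtain ⟨d, hd, hcl⟩ := exists_diagonal_mem_closure A
  have hdeg : DegeneratesToDiagonal A d :=
    { mem := hA
      charpoly_eq := hd.trans (Matrix.charpoly_diagonal d).symm
      lempert_le N _ := by
        rw [lempert_spectralBall_comm, lempert_spectralBall_comm _ N]
        exact lempert_le_of_mem_closure hcl
      invariant := h }
  obtain ⟨i⟩ := ‹Nonempty (Fin n)›
  refine ⟨d i, hdeg.norm_lt_one i, ?_⟩
  rw [hd, Finset.prod_congr rfl fun j _ => by rw [hdeg.apply_eq_apply j i], Finset.prod_const,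
    Finset.card_univ, Fintype.card_fin]

end DistinctEigenvalues

section Divisibility

open scoped Matrix.Norms.Operator
open Polynomial (X C)

variable {ι : Type*} [Fintype ι] [DecidableEq ι]

theorem coeff_charpoly_smul {R : Type*} [CommRing R] (c : R) (A : Matrix ι ι R) {i : ℕ}
    (hi : i ≤ Fintype.card ι) :
    (c • A).charpoly.coeff i = c ^ (Fintype.card ι - i) * A.charpoly.coeff i := by
  have hminor : ∀ s ∈ Finset.univ.powersetCard (Fintype.card ι - i),
      ((c • A).submatrix (Subtype.val : s → ι) (Subtype.val : s → ι)).det =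
        c ^ (Fintype.card ι - i) *
          (A.submatrix (Subtype.val : s → ι) (Subtype.val : s → ι)).det := fun s hs => by
    rw [← (Finset.mem_powersetCard.1 hs).2, ← Fintype.card_coe, ← Matrix.det_smul]
    rfl
  rw [← Nat.sub_sub_self hi, Matrix.charpoly_coeff_eq_sum_minors _ _ (Nat.sub_le _ _),
    Matrix.charpoly_coeff_eq_sum_minors _ _ (Nat.sub_le _ _), Nat.sub_sub_self hi,
    Finset.sum_congr rfl hminor, ← Finset.mul_sum, mul_left_comm]

theorem exists_det_eq_pow_mul {F : ℂ → Matrix ι ι ℂ} {U : Set ℂ} {a : ℂ} {I : Finset ι}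
    (hF : DifferentiableOn ℂ F U) (hU : U ∈ 𝓝 a) (h : ∀ k ∈ I, ∀ l, F a k l = 0) :
    ∃ g : ℂ → ℂ, DifferentiableOn ℂ g U ∧ ∀ x, (F x).det = (x - a) ^ I.card * g x := by
  have hentry (k l : ι) : ∃ g : ℂ → ℂ, DifferentiableOn ℂ g U ∧
      ∀ x, F x k l = (if k ∈ I then x - a else 1) * g x := by
    have hd := differentiableOn_matrix_iff.1 hF k l
    by_cases hk : k ∈ I
    · obtain ⟨g, hg, hFg⟩ := exists_eq_smul_of_apply_eq_zero hd hU (h k hk l)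
      exact ⟨g, hg, fun x => by rw [hFg, if_pos hk, smul_eq_mul]⟩
    · exact ⟨_, hd, fun x => by rw [if_neg hk, one_mul]⟩
  choose g hg hFg using hentry
  refine ⟨fun x => (Matrix.of fun k l => g k l x).det,
    differentiableOn_det (differentiableOn_matrix_iff.2 hg), fun x => ?_⟩
  have hF' : F x = Matrix.of fun k l =>
      (if k ∈ I then x - a else 1) * Matrix.of (fun k l => g k l x) k l :=
    Matrix.ext fun k l => hFg k l x
  rw [hF', Matrix.det_mul_column, Finset.prod_ite_mem, Finset.univ_inter, Finset.prod_const]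

-- Each coefficient is a sum of principal minors, and a minor of size `m` has at least `m - 1` rows
-- vanishing at `a`.
theorem exists_coeff_charpoly_eq_pow_mul {F : ℂ → Matrix ι ι ℂ} {U : Set ℂ} {a : ℂ} {i₀ : ι}
    (hF : DifferentiableOn ℂ F U) (hU : U ∈ 𝓝 a) (h : ∀ k, k ≠ i₀ → ∀ l, F a k l = 0) {i : ℕ}
    (hi : i ≤ Fintype.card ι) :
    ∃ q : ℂ → ℂ, DifferentiableOn ℂ q U ∧
      ∀ x, (F x).charpoly.coeff i = (x - a) ^ (Fintype.card ι - 1 - i) * q x := by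
  have hminor (s : Finset ι) : ∃ g : ℂ → ℂ, DifferentiableOn ℂ g U ∧
      ∀ x, ((F x).submatrix (Subtype.val : s → ι) (Subtype.val : s → ι)).det =
        (x - a) ^ (s.card - 1) * g x := by
    obtain ⟨g, hg, hdet⟩ := exists_det_eq_pow_mul
      (F := fun x => (F x).submatrix (Subtype.val : s → ι) (Subtype.val : s → ι))
      (I := Finset.univ.filter fun k : s => (k : ι) ≠ i₀)
      (differentiableOn_matrix_iff.2 fun k l => differentiableOn_matrix_iff.1 hF k l) hU
      fun k hk l => h k (Finset.mem_filter.1 hk).2 l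
    have hcard : s.card - 1 ≤ (Finset.univ.filter fun k : s => (k : ι) ≠ i₀).card := by
      have hsub : (s.erase i₀).card ≤
          ((Finset.univ.filter fun k : s => (k : ι) ≠ i₀).map (.subtype _)).card :=
        Finset.card_le_card fun k hk => by simpa using (Finset.mem_erase.1 hk)
      rw [Finset.card_map] at hsub
      exact Finset.pred_card_le_card_erase.trans hsub
    obtain ⟨m, hm⟩ := Nat.exists_eq_add_of_le hcard
    refine ⟨fun x => (x - a) ^ m * g x, DifferentiableOn.mul (by fun_prop) hg, fun x => ?_⟩
    rw [hdet, hm, pow_add, mul_assoc]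
  choose g hg hdet using hminor
  refine ⟨fun x => (-1) ^ (Fintype.card ι - i) *
    ∑ s ∈ Finset.univ.powersetCard (Fintype.card ι - i), g s x, ?_, fun x => ?_⟩
  · exact (DifferentiableOn.fun_sum fun s _ => hg s).const_mul _
  · rw [← Nat.sub_sub_self hi, Matrix.charpoly_coeff_eq_sum_minors _ _ (Nat.sub_le _ _),
      Nat.sub_sub_self hi, Finset.sum_congr rfl fun s hs => (hdet s x).trans
        (by rw [(Finset.mem_powersetCard.1 hs).2, Nat.sub_right_comm]),
      ← Finset.mul_sum, mul_left_comm]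

theorem norm_le_of_eq_pow_mul {E : Type*} [NormedAddCommGroup E] [NormedSpace ℂ E] {f h : ℂ → E}
    {a : ℂ} {k : ℕ} {K : ℝ} (ha : ‖a‖ ≤ 1 / 2) (hh : DifferentiableOn ℂ h (ball 0 1))
    (hK : ∀ x ∈ ball (0 : ℂ) 1, ‖f x‖ ≤ K) (hf : ∀ x, f x = (x - a) ^ k • h x) {x : ℂ}
    (hx : x ∈ ball (0 : ℂ) 1) : ‖h x‖ ≤ 4 ^ k * K := by
  have houter {y : ℂ} (hy : y ∈ ball (0 : ℂ) 1) (hy' : 3 / 4 ≤ ‖y‖) : ‖h y‖ ≤ 4 ^ k * K := by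
    have hya : 1 / 4 ≤ ‖y - a‖ := by linarith [norm_sub_norm_le y a]
    have hle : (1 / 4 : ℝ) ^ k * ‖h y‖ ≤ K :=
      calc (1 / 4 : ℝ) ^ k * ‖h y‖ ≤ ‖y - a‖ ^ k * ‖h y‖ := by gcongr
        _ = ‖f y‖ := by rw [hf y, norm_smul, norm_pow]
        _ ≤ K := hK y hy
    rwa [one_div, inv_pow, inv_mul_le_iff₀ (by positivity)] at hle
  by_cases hx' : 3 / 4 ≤ ‖x‖
  · exact houter hx hx'
  have hcl : DiffContOnCl ℂ h (ball 0 (3 / 4)) := DifferentiableOn.diffContOnCl <| by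
    rw [closure_ball _ (by norm_num)]
    exact hh.mono (closedBall_subset_ball (by norm_num))
  refine Complex.norm_le_of_forall_mem_frontier_norm_le isBounded_ball hcl (fun y hy => ?_)
    (subset_closure (mem_ball_zero_iff.2 (not_le.1 hx')))
  rw [frontier_ball _ (by norm_num), mem_sphere_zero_iff_norm] at hy
  exact houter (by rw [mem_ball_zero_iff, hy]; norm_num) hy.ge

theorem norm_coeff_charpoly_le_two_mul_pow {A : Matrix ι ι ℂ} {R : ℝ} (hR : 1 ≤ R)
    (h : ∀ t, A.charpoly.IsRoot t → ‖t‖ ≤ R) (i : ℕ) :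
    ‖A.charpoly.coeff i‖ ≤ (2 * R) ^ Fintype.card ι := by
  refine (norm_coeff_charpoly_le h i).trans ?_
  rw [mul_pow, mul_comm]
  gcongr
  · exact_mod_cast Nat.choose_le_two_pow _ _
  · exact Nat.sub_le _ _

end Divisibility

section RegularNilpotent

open scoped Matrix.Norms.Operator
open Polynomial (X)

variable {n : ℕ}

theorem eval_charpoly_sub_smul_one {ι R : Type*} [Fintype ι] [DecidableEq ι] [CommRing R]
    (A : Matrix ι ι R) (s t : R) :
    (A - t • 1).charpoly.eval s = A.charpoly.eval (s + t) := by
  rw [eval_charpoly_eq_det, eval_charpoly_eq_det, add_smul, sub_sub_eq_add_sub]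

theorem norm_pow_le_of_disc {φ : ℂ → Matrix (Fin n) (Fin n) ℂ} {α t u : ℂ} {i₀ : Fin n}
    (hφ : DifferentiableOn ℂ φ (ball 0 1)) (hm : Set.MapsTo φ (ball 0 1) (spectralBall n))
    (h0 : (φ 0).charpoly = X ^ n)
    (h1 : φ α = Matrix.diagonal fun k => if k = i₀ then u else t) (hα : ‖α‖ ≤ 1 / 2)
    (ht : ‖t‖ ≤ 1) : ‖t‖ ^ n ≤ 16 ^ n * ‖α‖ ^ (n - 1) := by
  have hα1 : ball (0 : ℂ) 1 ∈ 𝓝 α := isOpen_ball.mem_nhds (mem_ball_zero_iff.2 (by linarith))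
  obtain ⟨q, hq, hcoeff⟩ := exists_coeff_charpoly_eq_pow_mul (F := fun x => φ x - t • 1)
    (i₀ := i₀) (hφ.sub_const _) hα1 (fun k hk l => by
      simp only [h1, Matrix.sub_apply, Matrix.smul_apply, Matrix.one_apply, Matrix.diagonal_apply]
      split_ifs <;> simp) (Nat.zero_le _)
  simp only [Fintype.card_fin, Nat.sub_zero] at hcoeff
  have hbound : ∀ x ∈ ball (0 : ℂ) 1, ‖(φ x - t • 1).charpoly.coeff 0‖ ≤ 4 ^ n := by
    intro x hx
    refine (norm_coeff_charpoly_le_two_mul_pow one_le_two (fun s hs => ?_) 0).trans_eq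
      (by norm_num)
    rw [Polynomial.IsRoot, eval_charpoly_sub_smul_one] at hs
    have hst := mem_spectralBall_iff.1 (hm hx) _ hs
    linarith [norm_le_add_norm_add s t]
  have hq0 := norm_le_of_eq_pow_mul hα hq hbound hcoeff (mem_ball_self one_pos)
  have hzero := hcoeff 0
  rw [Polynomial.coeff_zero_eq_eval_zero, eval_charpoly_sub_smul_one, h0, zero_add,
    Polynomial.eval_pow, Polynomial.eval_X, zero_sub] at hzero
  calc ‖t‖ ^ n = ‖α‖ ^ (n - 1) * ‖q 0‖ := by rw [← norm_pow, hzero, norm_mul, norm_pow, norm_neg]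
    _ ≤ ‖α‖ ^ (n - 1) * (4 ^ (n - 1) * 4 ^ n) := by gcongr
    _ ≤ ‖α‖ ^ (n - 1) * (4 ^ n * 4 ^ n) := by
        gcongr
        · norm_num
        · exact Nat.sub_le _ _
    _ = 16 ^ n * ‖α‖ ^ (n - 1) := by rw [← mul_pow, mul_comm]; norm_num

theorem mem_symPolydisk_of_sum_norm_lt_one {s : Fin n → ℂ} (hs : ∑ i, ‖s i‖ < 1) :
    s ∈ symPolydisk n := by
  refine mem_symPolydisk_iff.2 (mem_spectralBall_iff.2 fun t ht => ?_)
  by_contra! ht1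
  have heval := ht.eq_zero
  rw [charpoly_eq_X_pow_add_sum, Polynomial.eval_add, Polynomial.eval_finsetSum,
    add_eq_zero_iff_eq_neg] at heval
  simp only [charpoly_coeff_eq_sigma, sigma_companionOfSigma, Polynomial.eval_mul,
    Polynomial.eval_C, Polynomial.eval_pow, Polynomial.eval_X] at heval
  have hpow : 0 < ‖t‖ ^ n := by positivity
  have hle : ‖t‖ ^ n ≤ (∑ i, ‖s i‖) * ‖t‖ ^ n :=
    calc ‖t‖ ^ n = ‖∑ i : Fin n, -((-1) ^ (i : ℕ) * s i) * t ^ (i.rev : ℕ)‖ := by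
          rw [← norm_pow, heval, norm_neg]
      _ ≤ ∑ i, ‖s i‖ * ‖t‖ ^ n := by
          refine norm_sum_le_of_le _ fun i _ => ?_
          rw [norm_mul, norm_neg, norm_mul, norm_pow, norm_neg, norm_one, one_pow, one_mul,
            norm_pow]
          gcongr
          exact i.rev.is_lt.le
      _ = (∑ i, ‖s i‖) * ‖t‖ ^ n := by rw [Finset.sum_mul]
  exact absurd hle (not_le.2 (mul_lt_of_lt_one_left hpow hs))

theorem lempert_symPolydisk_zero_lt {s : Fin n → ℂ} {r : ℝ} (hs : ∑ i, ‖s i‖ < r) (hr : r ≤ 1) :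
    lempert (symPolydisk n) 0 s < ENNReal.ofReal r := by
  obtain ⟨a, hsa, har⟩ := exists_between hs
  have ha : 0 < a := (Finset.sum_nonneg fun _ _ => norm_nonneg _).trans_lt hsa
  have hae : ‖(a : ℂ)‖ = a := Complex.norm_of_nonneg ha.le
  refine lempert_lt_iff.2 ⟨a, mem_ball_zero_iff.2 (by linarith), ?_, fun x => (x / a) • s,
    by fun_prop, fun x hx => mem_symPolydisk_of_sum_norm_lt_one ?_, by simp, ?_⟩
  · rw [← ofReal_norm, hae]
    exact (ENNReal.ofReal_lt_ofReal_iff (ha.trans har)).2 har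
  · simp only [Pi.smul_apply, norm_smul, ← Finset.mul_sum, norm_div, hae]
    rw [div_mul_eq_mul_div, div_lt_one ha]
    exact (mul_le_of_le_one_left (Finset.sum_nonneg fun _ _ => norm_nonneg _)
      (mem_ball_zero_iff.1 hx).le).trans_lt hsa
  · simp only [div_self (Complex.ofReal_ne_zero.2 ha.ne'), one_smul]

theorem sigma_eq_trace {A : Matrix (Fin n) (Fin n) ℂ} {j : Fin n} (hj : (j : ℕ) = 0) :
    sigma A j = A.trace := by
  obtain ⟨m, rfl⟩ : ∃ m, n = m + 1 := Nat.exists_eq_succ_of_ne_zero j.pos.ne'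
  rw [Fin.val_eq_zero_iff.1 hj, sigma_zero_eq_trace]

theorem norm_sigma_le {A : Matrix (Fin n) (Fin n) ℂ} {R : ℝ}
    (hR : 0 ≤ R) (h : ∀ t, A.charpoly.IsRoot t → ‖t‖ ≤ R) (j : Fin n) :
    ‖sigma A j‖ ≤ R ^ ((j : ℕ) + 1) * 2 ^ n := by
  have hj : n - (j.rev : ℕ) = j + 1 := by rw [Fin.val_rev]; omega
  have hcoeff := norm_coeff_charpoly_le h j.rev
  rw [charpoly_coeff_eq_sigma, norm_neg, norm_mul, norm_pow, norm_neg, norm_one, one_pow, one_mul,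
    Fintype.card_fin, hj] at hcoeff
  refine hcoeff.trans ?_
  gcongr
  exact_mod_cast Nat.choose_le_two_pow _ _

theorem sum_norm_sigma_le_of_trace_eq_zero {A : Matrix (Fin n) (Fin n) ℂ} {R : ℝ} (hR0 : 0 ≤ R)
    (hR : R ≤ 1) (h : ∀ t, A.charpoly.IsRoot t → ‖t‖ ≤ R) (htr : A.trace = 0) :
    ∑ j, ‖sigma A j‖ ≤ n * 2 ^ n * R ^ 2 := by
  have hterm (j : Fin n) : ‖sigma A j‖ ≤ 2 ^ n * R ^ 2 := by
    by_cases hj : (j : ℕ) = 0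
    · rw [sigma_eq_trace hj, htr, norm_zero]
      positivity
    · rw [mul_comm]
      refine (norm_sigma_le hR0 h j).trans ?_
      exact mul_le_mul_of_nonneg_right (pow_le_pow_of_le_one hR0 hR (by omega)) (by positivity)
  simpa [mul_assoc] using Finset.sum_le_card_nsmul Finset.univ _ _ fun j _ => hterm j

theorem trace_diagonal_ite {ι R : Type*} [Fintype ι] [DecidableEq ι] [CommRing R] (i₀ : ι)
    (a b : R) : (Matrix.diagonal fun k => if k = i₀ then a else b).trace =
      a + (Fintype.card ι - 1) * b := by
  rw [Matrix.trace_diagonal, Fintype.sum_eq_add_sum_compl i₀, if_pos rfl,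
    Finset.sum_congr rfl fun k hk => if_neg (by simpa using hk), Finset.sum_const,
    Finset.card_compl, Finset.card_singleton, nsmul_eq_mul,
    Nat.cast_sub (Fintype.card_pos_iff.2 ⟨i₀⟩), Nat.cast_one]

theorem LempertInvariant.lempert_le_symPolydisk_zero {M B : Matrix (Fin n) (Fin n) ℂ}
    (h : LempertInvariant M) (hM : M.charpoly = X ^ n) (hcyc : IsCyclicMatrix M)
    (hB : B ∈ spectralBall n) :
    lempert (spectralBall n) M B ≤ lempert (symPolydisk n) 0 (sigma B) := by
  rw [h B (companionOfSigma (sigma B)) hB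
    (charpoly_eq_iff_sigma_eq.2 (sigma_companionOfSigma _).symm),
    ← lempert_eq_of_isConj_left hcyc.isConj_companionOfSigma, sigma_eq_zero_iff.2 hM]
  exact lempert_companionOfSigma_le _ _

theorem LempertInvariant.pow_le_of_isCyclicMatrix [NeZero n] {M : Matrix (Fin n) (Fin n) ℂ}
    (h : LempertInvariant M) (hM : M.charpoly = X ^ n) (hcyc : IsCyclicMatrix M) {t c : ℝ}
    (ht : 0 < t) (hnt : n * t < 1) (hc : n ^ 3 * 2 ^ n < c) (hct : c * t ^ 2 ≤ 1 / 2) :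
    t ^ n ≤ 16 ^ n * (c * t ^ 2) ^ (n - 1) := by
  have hn1 : (1 : ℝ) ≤ n := by exact_mod_cast NeZero.one_le
  set d : Fin n → ℂ := fun k => if k = 0 then -((n - 1) * t) else t with hd
  have hnorm (k : Fin n) : ‖d k‖ ≤ n * t := by
    have hn1' : ‖(n : ℂ) - 1‖ = n - 1 := by
      rw [← Complex.ofReal_natCast, ← Complex.ofReal_one, ← Complex.ofReal_sub,
        Complex.norm_of_nonneg (sub_nonneg.2 hn1)]
    rw [hd]
    dsimp only
    split_ifs
    · rw [norm_neg, norm_mul, hn1', Complex.norm_of_nonneg ht.le]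
      linarith
    · rw [Complex.norm_of_nonneg ht.le]
      exact le_mul_of_one_le_left ht.le hn1
  have hroot (s : ℂ) (hs : (Matrix.diagonal d).charpoly.IsRoot s) : ‖s‖ ≤ n * t := by
    rw [Matrix.charpoly_diagonal, isRoot_prod_X_sub_C] at hs
    obtain ⟨k, rfl⟩ := hs
    exact hnorm k
  have hB : Matrix.diagonal d ∈ spectralBall n :=
    mem_spectralBall_iff.2 fun s hs => (hroot s hs).trans_lt hnt
  have hsum : ∑ j, ‖sigma (Matrix.diagonal d) j‖ < c * t ^ 2 := by
    refine (sum_norm_sigma_le_of_trace_eq_zero (by positivity) hnt.le hroot ?_).trans_lt ?_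
    · rw [trace_diagonal_ite, Fintype.card_fin, neg_add_cancel]
    · calc n * 2 ^ n * (n * t) ^ 2 = n ^ 3 * 2 ^ n * t ^ 2 := by ring
        _ < c * t ^ 2 := by gcongr
  obtain ⟨α, -, hαt, φ, hφ, hm, h0, h1⟩ := lempert_lt_iff.1
    ((h.lempert_le_symPolydisk_zero hM hcyc hB).trans_lt
      (lempert_symPolydisk_zero_lt hsum (by linarith)))
  have hc0 : 0 < c := lt_of_le_of_lt (by positivity) hc
  rw [← ofReal_norm, ENNReal.ofReal_lt_ofReal_iff (by positivity)] at hαt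
  have hpow := norm_pow_le_of_disc hφ hm (h0 ▸ hM) h1 (hαt.le.trans hct)
    (by rw [Complex.norm_of_nonneg ht.le]; exact (le_mul_of_one_le_left ht.le hn1).trans hnt.le)
  rw [Complex.norm_of_nonneg ht.le] at hpow
  exact hpow.trans (by gcongr)

theorem LempertInvariant.false_of_isCyclicMatrix {M : Matrix (Fin n) (Fin n) ℂ} (hn : 3 ≤ n)
    (h : LempertInvariant M) (hM : M.charpoly = X ^ n) (hcyc : IsCyclicMatrix M) : False := by
  have : NeZero n := ⟨by omega⟩
  set c : ℝ := n ^ 3 * 2 ^ n + 1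
  have hsmall : ∀ᶠ t : ℝ in 𝓝[>] 0,
      0 < t ∧ n * t < 1 ∧ c * t ^ 2 ≤ 1 / 2 ∧ ‖16 ^ n * c ^ (n - 1) * t ^ (2 * (n - 1))‖ ≤
        1 / 2 * ‖t ^ n‖ := by
    have hlin : ∀ᶠ t : ℝ in 𝓝 0, n * t < 1 :=
      ContinuousAt.eventually_lt (by fun_prop) continuousAt_const (by simp)
    have hquad : ∀ᶠ t : ℝ in 𝓝 0, c * t ^ 2 < 1 / 2 :=
      ContinuousAt.eventually_lt (by fun_prop) continuousAt_const (by norm_num)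
    have hlittle := ((Asymptotics.isLittleO_pow_pow (𝕜 := ℝ)
      (show n < 2 * (n - 1) by omega)).const_mul_left (16 ^ n * c ^ (n - 1))).bound
        (one_half_pos (α := ℝ))
    filter_upwards [self_mem_nhdsWithin, nhdsWithin_le_nhds hlin, nhdsWithin_le_nhds hquad,
      nhdsWithin_le_nhds hlittle] with t h₁ h₂ h₃ h₄ using ⟨h₁, h₂, h₃.le, h₄⟩
  obtain ⟨t, ht, hnt, hct, hle⟩ := hsmall.exists
  have hpow := h.pow_le_of_isCyclicMatrix hM hcyc ht hnt (lt_add_one _) hct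
  have hlt : 0 < t ^ n := pow_pos ht n
  rw [mul_pow, ← pow_mul, ← mul_assoc] at hpow
  rw [Real.norm_of_nonneg (by positivity), Real.norm_of_nonneg hlt.le] at hle
  linarith

end RegularNilpotent

section Scalar

open Polynomial (X C)

variable {n : ℕ}

theorem exists_mem_symPolydisk_lempert_lt (hn : 2 ≤ n) : ∃ s ∈ symPolydisk n,
    lempert (symPolydisk n) 0 s < lempert (spectralBall n) 0 (companionOfSigma s) := by
  let i₀ : Fin n := ⟨n - 1, by omega⟩
  let s : Fin n → ℂ := Pi.single i₀ (3 / 8)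
  have hi₀ : (i₀.rev : ℕ) = 0 := by rw [Fin.val_rev]; dsimp only [i₀]; omega
  have hs₀ : s i₀ = 3 / 8 := Pi.single_eq_same ..
  have hsum : ∑ i, ‖s i‖ = 3 / 8 := by
    rw [Fintype.sum_eq_single i₀ fun i hi => norm_eq_zero.2 (Pi.single_eq_of_ne hi _), hs₀]
    norm_num
  have hs : s ∈ symPolydisk n := mem_symPolydisk_of_sum_norm_lt_one (by rw [hsum]; norm_num)
  obtain ⟨t, ht, hlt⟩ : ∃ t, (companionOfSigma s).charpoly.IsRoot t ∧ 1 / 2 < ‖t‖ := by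
    by_contra! hle
    have hcoeff := norm_coeff_charpoly_le hle i₀.rev
    rw [charpoly_coeff_eq_sigma, sigma_companionOfSigma, hs₀, hi₀, Nat.sub_zero,
      Fintype.card_fin, Nat.choose_zero_right, norm_neg, norm_mul, norm_pow, norm_neg, norm_one,
      one_pow] at hcoeff
    have hpow : (1 / 2 : ℝ) ^ n ≤ (1 / 2) ^ 2 :=
      pow_le_pow_of_le_one (by norm_num) (by norm_num) hn
    norm_num at hcoeff hpow
    linarith
  refine ⟨s, hs, (lempert_symPolydisk_zero_lt (r := 1 / 2) (by rw [hsum]; norm_num)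
    (by norm_num)).trans_le ?_⟩
  rw [lempert_zero_left (mem_symPolydisk_iff.1 hs)]
  refine le_trans ?_ (enorm_le_spectralRadius ht)
  rw [← ofReal_norm]
  exact ENNReal.ofReal_le_ofReal hlt.le

theorem exists_lempert_lt_lempert_zero (hn : 2 ≤ n) :
    ∃ J B : Matrix (Fin n) (Fin n) ℂ, J.charpoly = X ^ n ∧ B ∈ spectralBall n ∧
      lempert (spectralBall n) J B < lempert (spectralBall n) 0 B := by
  obtain ⟨s, hs, hlt⟩ := exists_mem_symPolydisk_lempert_lt hn
  exact ⟨companionOfSigma 0, companionOfSigma s, sigma_eq_zero_iff.1 (sigma_companionOfSigma 0),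
    mem_symPolydisk_iff.1 hs, (lempert_companionOfSigma_le 0 s).trans_lt hlt⟩

theorem IsScalarMatrix.exists_not_continuousWithinAt_lempert {A : Matrix (Fin n) (Fin n) ℂ}
    (hn : 2 ≤ n) (hs : IsScalarMatrix A) (hA : A ∈ spectralBall n) :
    ∃ B ∈ spectralBall n, ¬ ContinuousWithinAt
      (fun p : Matrix (Fin n) (Fin n) ℂ × Matrix (Fin n) (Fin n) ℂ =>
        lempert (spectralBall n) p.1 p.2) (spectralBall n ×ˢ spectralBall n) (A, B) := by
  have : NeZero n := ⟨by omega⟩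
  obtain ⟨μ, rfl⟩ := hs
  have hμ : ‖-μ‖ < 1 := by rw [norm_neg]; exact norm_lt_one_of_smul_one_mem hA
  obtain ⟨J, B, hJ, hB, hlt⟩ := exists_lempert_lt_lempert_zero hn
  refine ⟨matrixMoebius (-μ) B, matrixMoebius_mem hμ hB, fun hc => ?_⟩
  rw [← matrixMoebius_neg_zero] at hc
  have hzero := continuousWithinAt_lempert_of_matrixMoebius hμ zero_mem_spectralBall hB hc
  have hleft : ContinuousWithinAt (fun Y => lempert (spectralBall n) Y B) (spectralBall n) 0 :=
    hzero.comp (f := fun Y => (Y, B)) (x := (0 : Matrix (Fin n) (Fin n) ℂ))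
      (by fun_prop) fun Y hY => ⟨hY, hB⟩
  have hnear := hleft.eventually_const_lt hlt
  rw [isOpen_spectralBall.nhdsWithin_eq zero_mem_spectralBall] at hnear
  obtain ⟨Y, hY, hYJ⟩ := mem_closure_iff_nhds.1 (zero_mem_closure_orbit hJ) _ hnear
  exact (lempert_eq_of_isConj_left (B := B) hYJ).not_lt hY

theorem IsScalarMatrix.exists_lempert_ne_symPolydisk {A : Matrix (Fin n) (Fin n) ℂ}
    (hn : 2 ≤ n) (hs : IsScalarMatrix A) (hA : A ∈ spectralBall n) :
    ∃ B ∈ spectralBall n,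
      lempert (spectralBall n) A B ≠ lempert (symPolydisk n) (sigma A) (sigma B) := by
  have : NeZero n := ⟨by omega⟩
  obtain ⟨μ, rfl⟩ := hs
  have hμ : ‖-μ‖ < 1 := by rw [norm_neg]; exact norm_lt_one_of_smul_one_mem hA
  obtain ⟨J, B, hJ, hB, hlt⟩ := exists_lempert_lt_lempert_zero hn
  have hJm := mem_spectralBall_of_charpoly_eq_X_pow hJ
  have hJ0 : J.charpoly = (0 : Matrix (Fin n) (Fin n) ℂ).charpoly := by
    rw [hJ, Matrix.charpoly_zero, Fintype.card_fin]
  refine ⟨matrixMoebius (-μ) B, matrixMoebius_mem hμ hB, fun he => ?_⟩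
  rw [← matrixMoebius_neg_zero, lempert_matrixMoebius hμ zero_mem_spectralBall hB,
    ← charpoly_eq_iff_sigma_eq.1 (charpoly_matrixMoebius_eq hμ hJm hJ0)] at he
  refine hlt.not_ge (he.le.trans ((lempert_symPolydisk_le _ _).trans ?_))
  rw [lempert_matrixMoebius hμ hJm hB]

end Scalar

section Degeneration

open scoped Matrix.Norms.Operator
open Polynomial (X C)

theorem isConj_single_single {ι K : Type*} [Fintype ι] [DecidableEq ι] [Field K] {i j k l : ι}
    (hij : i ≠ j) (hkl : k ≠ l) {c d : K} (hc : c ≠ 0) (hd : d ≠ 0) :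
    IsConj (Matrix.single i j c) (Matrix.single k l d) := by
  obtain ⟨τ, rfl, rfl⟩ : ∃ τ : Equiv.Perm ι, τ i = k ∧ τ j = l :=
    MulAction.is_two_pretransitive_iff.1 (Equiv.Perm.isMultiplyPretransitive ι 2) hij hkl
  have hperm : IsConj (Matrix.single i j d) (Matrix.single (τ i) (τ j) d) := by
    simpa using (isConj_submatrix_perm (Matrix.single (τ i) (τ j) d) τ).symm
  refine IsConj.trans ?_ hperm
  convert isConj_diagonal (d := fun a => if a = i then d / c else 1)
    (fun a => by split_ifs <;> simp [hc, hd]) (Matrix.single i j c) using 1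
  ext a b
  by_cases hab : i = a ∧ j = b
  · obtain ⟨rfl, rfl⟩ := hab
    simp [hij.symm, hc]
  · simp [Matrix.single_apply, hab]

theorem exists_lowest_leftmost_entry {ι R : Type*} [Finite ι] [LinearOrder ι] [Zero R]
    {T : Matrix ι ι R} (hT : T ≠ 0) :
    ∃ i j, T i j ≠ 0 ∧ (∀ a b, T a b ≠ 0 → a ≤ i) ∧ ∀ b, T i b ≠ 0 → j ≤ b := by
  obtain ⟨a, b, hab⟩ : ∃ a b, T a b ≠ 0 := by
    by_contra! h
    exact hT (Matrix.ext h)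
  obtain ⟨⟨i, j⟩, hij, hmax⟩ := Set.exists_max_image {p : ι × ι | T p.1 p.2 ≠ 0}
    (fun p => toLex (p.1, OrderDual.toDual p.2)) (Set.toFinite _) ⟨(a, b), hab⟩
  have hle (a b : ι) (h : T a b ≠ 0) : a < i ∨ a = i ∧ j ≤ b :=
    Prod.Lex.toLex_le_toLex.1 (hmax (a, b) h)
  refine ⟨i, j, hij, fun a b h => ?_, fun b h => ?_⟩
  · rcases hle a b h with h | h
    exacts [h.le, h.1.le]
  · rcases hle i b h with h | h
    exacts [absurd h (lt_irrefl i), h.2]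

-- Only entries joining indices of equal weight survive in the limit. The indices from `i` to `j`
-- share a weight, as do those beyond `j`, and extremality leaves `(i, j)` as the only such entry.
theorem single_mem_closure_orbit {n : ℕ} {T : Matrix (Fin n) (Fin n) ℂ}
    (hT : ∀ a b, b ≤ a → T a b = 0) {i j : Fin n} (hij : T i j ≠ 0)
    (hi : ∀ a b, T a b ≠ 0 → a ≤ i) (hj : ∀ b, T i b ≠ 0 → j ≤ b) :
    Matrix.single i j (T i j) ∈ closure {B | IsConj T B} := by
  have hlt {a b : Fin n} (h : T a b ≠ 0) : a < b := by
    by_contra! hle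
    exact h (hT a b hle)
  have hlt_ij := hlt hij
  let w : Fin n → ℕ := fun l => if l ≤ i then l else if l ≤ j then i else i + 1
  have hwmono : ∀ a b : Fin n, a ≤ b → w a ≤ w b := fun a b hab => by
    simp only [w]
    split_ifs <;> omega
  convert mem_closure_orbit_of_weights (A := T) w fun a b hab => hT a b <| by
    by_contra! hle
    exact absurd (hwmono a b hle.le) (not_le.2 hab) using 1
  ext a b
  rw [Matrix.single_apply, Matrix.of_apply]
  by_cases hab : T a b = 0
  · rw [hab, ite_self, ite_eq_right_iff]
    rintro ⟨rfl, rfl⟩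
    exact hab
  have hai := hi a b hab
  have hw : w a = w b ↔ i = a ∧ j = b := by
    have hltab := hlt hab
    refine ⟨fun hw => ?_, fun h => ?_⟩
    · obtain ⟨rfl, hbj⟩ : i = a ∧ b ≤ j := by
        simp only [w] at hw
        split_ifs at hw <;> constructor <;> omega
      exact ⟨rfl, le_antisymm (hj b hab) hbj⟩
    · simp only [w]
      split_ifs <;> omega
  by_cases h : i = a ∧ j = b
  · obtain ⟨rfl, rfl⟩ := h
    rw [if_pos ⟨rfl, rfl⟩, if_pos (hw.2 ⟨rfl, rfl⟩)]
  · rw [if_neg h, if_neg (mt hw.1 h)]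

variable {n : ℕ} {M : Matrix (Fin n) (Fin n) ℂ}

theorem exists_single_mem_closure_orbit (hM : M.charpoly = X ^ n) (hM0 : M ≠ 0) :
    ∃ i j : Fin n, ∃ c : ℂ, i ≠ j ∧ c ≠ 0 ∧ Matrix.single i j c ∈ closure {B | IsConj M B} := by
  obtain ⟨T, hMT, hT⟩ := exists_isConj_upperTriangular M
  have hT' (a b : Fin n) (hba : b ≤ a) : T a b = 0 := by
    rcases hba.lt_or_eq with hlt | rfl
    · exact hT a b hlt
    · refine eq_zero_of_isRoot_X_pow (k := n) ?_
      rw [← hM, charpoly_eq_of_isConj hMT,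
        Matrix.charpoly_of_isUpperTriangular T fun i j h => hT i j h, isRoot_prod_X_sub_C]
      exact ⟨b, rfl⟩
  have hT0 : T ≠ 0 := by
    rintro rfl
    obtain ⟨P, hP⟩ := hMT
    rw [SemiconjBy, zero_mul, Units.mul_right_eq_zero] at hP
    exact hM0 hP
  obtain ⟨i, j, hij, hi, hj⟩ := exists_lowest_leftmost_entry hT0
  have horbit : {B | IsConj T B} = {B | IsConj M B} :=
    Set.ext fun B => ⟨hMT.trans, hMT.symm.trans⟩
  refine ⟨i, j, T i j, ?_, hij, horbit ▸ single_mem_closure_orbit hT' hij hi hj⟩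
  rintro rfl
  exact hij (hT' i i le_rfl)

theorem lempert_le_lempert_single {B : Matrix (Fin n) (Fin n) ℂ} (hM : M.charpoly = X ^ n)
    (hM0 : M ≠ 0) {i j : Fin n} (hij : i ≠ j) {c : ℂ} (hc : c ≠ 0) :
    lempert (spectralBall n) M B ≤ lempert (spectralBall n) (Matrix.single i j c) B := by
  obtain ⟨k, l, d, hkl, hd, hcl⟩ := exists_single_mem_closure_orbit hM hM0
  rw [lempert_spectralBall_comm M, lempert_spectralBall_comm _ B,
    lempert_eq_of_isConj_right (isConj_single_single hij hkl hc hd)]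
  exact lempert_le_of_mem_closure hcl

end Degeneration

section ShearDisc

open scoped Matrix.Norms.Operator

theorem linfty_opNorm_le {ι : Type*} [Fintype ι] [DecidableEq ι] {A : Matrix ι ι ℂ} {r : ℝ}
    (hr : 0 ≤ r) (h : ∀ i, ∑ j, ‖A i j‖ ≤ r) : ‖A‖ ≤ r := by
  lift r to NNReal using hr
  rw [Matrix.linfty_opNorm_def, NNReal.coe_le_coe]
  refine Finset.sup_le fun i _ => NNReal.coe_le_coe.1 ?_
  simpa only [NNReal.coe_sum, coe_nnnorm] using h i

theorem linfty_opNorm_single_le {ι : Type*} [Fintype ι] [DecidableEq ι] (i j : ι) (a : ℂ) :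
    ‖Matrix.single i j a‖ ≤ ‖a‖ := by
  refine linfty_opNorm_le (norm_nonneg a) fun k => ?_
  rw [Fintype.sum_eq_single j fun l hl => by
    rw [Matrix.single_apply_of_col_ne _ _ hl.symm, norm_zero], Matrix.single_apply]
  split_ifs
  · rfl
  · rw [norm_zero]
    exact norm_nonneg a

theorem charpoly_smul_one_add_eq {ι K : Type*} [Fintype ι] [DecidableEq ι] [Field K] [Infinite K]
    {A B : Matrix ι ι K} (h : A.charpoly = B.charpoly) {c : K} (hc : c ≠ 0) :
    (c • (1 + A)).charpoly = (c • (1 + B)).charpoly := by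
  have heval (t : K) (Y : Matrix ι ι K) :
      (c • (1 + Y)).charpoly.eval t = c ^ Fintype.card ι * Y.charpoly.eval ((t - c) / c) := by
    rw [eval_charpoly_eq_det, ← det_smul_one_sub_smul hc, smul_add, sub_smul, sub_sub]
  exact Polynomial.funext fun t => by rw [heval, heval, h]

variable {m : ℕ}

-- Conjugating by `diagonal d` with `d 0 = 1` and `d i = α / b ^ i` for `i ≠ 0` leaves the `(0, 1)`
-- entry `b / α`, which is the one removed, and makes all other entries small.
theorem exists_isConj_firstColumnCompanion_norm_sub_single_le {c : Fin (m + 2) → ℂ}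
    (hc : c 0 = 0) {b : ℝ} (hb0 : 0 < b) (hb1 : b ≤ 1) {α : ℂ} (hα : α ≠ 0)
    (hαc : ∀ i, ‖α‖ * ‖c i‖ ≤ b ^ (m + 3)) :
    ∃ Z, IsConj (firstColumnCompanion c) Z ∧ ‖Z - Matrix.single 0 1 (b / α)‖ ≤ 2 * b := by
  have hbC : (b : ℂ) ≠ 0 := by exact_mod_cast hb0.ne'
  let d : Fin (m + 2) → ℂ := fun i => (if i = 0 then 1 else α) / b ^ (i : ℕ)
  have hd (i) : d i ≠ 0 := div_ne_zero (by split_ifs <;> simp [hα]) (pow_ne_zero _ hbC)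
  refine ⟨_, isConj_diagonal hd _, linfty_opNorm_le (by positivity) fun i => ?_⟩
  have hzero : ‖d i * c i‖ ≤ b := by
    by_cases hi : i = 0
    · rw [hi, hc, mul_zero, norm_zero]
      exact hb0.le
    · rw [norm_mul, norm_div, if_neg hi, norm_pow, Complex.norm_of_nonneg hb0.le,
        div_mul_eq_mul_div, div_le_iff₀ (by positivity), ← pow_succ']
      exact (hαc i).trans (pow_le_pow_of_le_one hb0.le hb1 (by omega))
  have hsucc (j : Fin (m + 1)) : ‖d i * firstColumnCompanion c i j.succ * (d j.succ)⁻¹ -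
      Matrix.single 0 1 (b / α) i j.succ‖ ≤ if j.castSucc = i then b else 0 := by
    by_cases hij : j.castSucc = i
    · subst hij
      rw [if_pos rfl]
      rcases eq_or_ne j 0 with rfl | hj
      · simp [d, firstColumnCompanion, hb0.le]
      · have hcancel : α / (b : ℂ) ^ (j : ℕ) * (α / (b : ℂ) ^ ((j : ℕ) + 1))⁻¹ = b := by
          rw [pow_succ]
          field_simp
        rw [Matrix.single_apply_of_row_ne (Fin.castSucc_ne_zero_iff.2 hj).symm, sub_zero]
        simpa [d, firstColumnCompanion, hj] using
          (congrArg norm hcancel).le.trans (Complex.norm_of_nonneg hb0.le).le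
    · have hval : (i : ℕ) ≠ j := fun h => hij (Fin.ext h.symm)
      have h01 : ¬((0 : Fin (m + 2)) = i ∧ 1 = j.succ) := by
        rintro ⟨rfl, h⟩
        exact hval (by simpa [eq_comm] using congrArg Fin.val h)
      rw [if_neg hij, Matrix.single_apply_of_ne _ _ _ _ _ h01]
      simp [firstColumnCompanion, hval]
  have hsum : ∑ j : Fin (m + 1), (if j.castSucc = i then b else 0) ≤ b := by
    rcases Fin.eq_castSucc_or_eq_last i with ⟨k, rfl⟩ | rfl
    · simp only [Fin.castSucc_inj, Finset.sum_ite_eq', Finset.mem_univ, if_true, le_refl]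
    · simp only [Fin.castSucc_ne_last, if_false, Finset.sum_const_zero, hb0.le]
  rw [Fin.sum_univ_succ, two_mul]
  refine add_le_add ?_ ((Finset.sum_le_sum fun j _ => hsucc j).trans hsum)
  simpa [d, firstColumnCompanion] using hzero

theorem smul_shear_mem_spectralBall {n : ℕ} {i j : Fin n} {b : ℝ} (hb0 : 0 < b) (hb1 : 4 * b < 1)
    {Y : Matrix (Fin n) (Fin n) ℂ} (hY : ‖Y‖ ≤ 2 * b) {x : ℂ} (hx : ‖x‖ < 1) :
    ((1 - 4 * b : ℝ) : ℂ) • (x • 1 + Matrix.single i j (b : ℂ) + x • Y) ∈ spectralBall n := by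
  have : NeZero n := ⟨i.pos.ne'⟩
  have hsingle : ‖Matrix.single i j (b : ℂ)‖ ≤ b :=
    (linfty_opNorm_single_le i j _).trans_eq (Complex.norm_of_nonneg hb0.le)
  have hsum : ‖x • 1 + Matrix.single i j (b : ℂ) + x • Y‖ ≤ 1 + b + 2 * b :=
    calc ‖x • 1 + Matrix.single i j (b : ℂ) + x • Y‖
        ≤ ‖x‖ * ‖(1 : Matrix (Fin n) (Fin n) ℂ)‖ + ‖Matrix.single i j (b : ℂ)‖ + ‖x‖ * ‖Y‖ := by
          rw [← norm_smul, ← norm_smul]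
          exact norm_add₃_le
      _ ≤ 1 * 1 + b + 1 * (2 * b) := by
          rw [norm_one]
          gcongr
      _ = 1 + b + 2 * b := by ring
  refine mem_spectralBall_of_opNorm_lt ?_
  rw [norm_smul, Complex.norm_of_nonneg (by linarith)]
  nlinarith

theorem trace_diagonal_sub_one (m : ℕ) : (Matrix.diagonal fun k : Fin (m + 2) =>
    if k = 0 then (m + 1 : ℂ) else -1).trace = 0 := by
  rw [trace_diagonal_ite, Fintype.card_fin]
  push_cast
  ring

theorem charpoly_smul_one_add_of_charpoly_eq_diagonal {Z : Matrix (Fin (m + 2)) (Fin (m + 2)) ℂ}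
    (hZ : Z.charpoly =
      (Matrix.diagonal fun k : Fin (m + 2) => if k = 0 then (m + 1 : ℂ) else -1).charpoly)
    {c : ℂ} (hc : c ≠ 0) :
    (c • (1 + Z)).charpoly =
      (Matrix.diagonal fun k : Fin (m + 2) => if k = 0 then c * (m + 2) else 0).charpoly := by
  rw [charpoly_smul_one_add_eq hZ hc, ← Matrix.diagonal_one, Matrix.diagonal_add,
    ← Matrix.diagonal_smul]
  congr 2
  ext k
  simp only [Pi.smul_apply, smul_eq_mul]
  split_ifs <;> ring

-- The disc `x ↦ θ (x + b E₀₁ + x Y)` passes through `θ α (1 + Z)` at `x = α`, where `Z` has the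
-- trace zero spectrum `(n - 1, -1, …, -1)`, so that `1 + Z` has spectrum `(n, 0, …, 0)`.
theorem exists_lempert_single_le (m : ℕ) :
    ∃ c : ℂ, c ≠ 0 ∧ ∀ᶠ α : ℝ in 𝓝[>] 0, ∃ B ∈ spectralBall (m + 2),
      B.charpoly = (Matrix.diagonal fun k : Fin (m + 2) =>
        if k = 0 then (((m + 7 / 4) * α : ℝ) : ℂ) else 0).charpoly ∧
      lempert (spectralBall (m + 2)) (Matrix.single 0 1 c) B ≤ ‖(α : ℂ)‖ₑ := by
  set D : Matrix (Fin (m + 2)) (Fin (m + 2)) ℂ :=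
    Matrix.diagonal fun k => if k = 0 then (m + 1 : ℂ) else -1
  set b : ℝ := 1 / (16 * (m + 2)) with hb
  have hb0 : 0 < b := by positivity
  have hbm : b * (m + 2) = 1 / 16 := by rw [hb]; field_simp
  have hb1 : 4 * b < 1 := by nlinarith [m.cast_nonneg (α := ℝ)]
  set θ : ℝ := 1 - 4 * b with hθ
  have hθ0 : 0 < θ := sub_pos.2 hb1
  have hc0 : (-1) ^ ((0 : Fin (m + 2)) : ℕ) * sigma D 0 = 0 := by
    rw [sigma_zero_eq_trace, trace_diagonal_sub_one, mul_zero]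
  have hsmall : ∀ᶠ α : ℝ in 𝓝[>] 0, 0 < α ∧ ‖(α : ℂ)‖ < 1 ∧
      ∀ i : Fin (m + 2), ‖(α : ℂ)‖ * ‖(-1) ^ (i : ℕ) * sigma D i‖ < b ^ (m + 3) := by
    refine eventually_mem_nhdsWithin.and (nhdsWithin_le_nhds
      (Filter.Eventually.and ?_ (Filter.eventually_all.2 fun i => ?_))) <;>
    exact ContinuousAt.eventually_lt (by fun_prop) continuousAt_const (by simp [hb0])
  refine ⟨θ * b, by exact_mod_cast (mul_pos hθ0 hb0).ne', hsmall.mono fun α ⟨hα, hα1, hαc⟩ => ?_⟩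
  have hαC : (α : ℂ) ≠ 0 := by exact_mod_cast hα.ne'
  obtain ⟨Z, hZ, hY⟩ := exists_isConj_firstColumnCompanion_norm_sub_single_le hc0 hb0
    (by linarith) hαC fun i => (hαc i).le
  have hZD : Z.charpoly = D.charpoly :=
    (charpoly_eq_of_isConj hZ).symm.trans
      (charpoly_eq_iff_sigma_eq.2 (sigma_companionOfSigma (sigma D)))
  set φ : ℂ → Matrix (Fin (m + 2)) (Fin (m + 2)) ℂ := fun x =>
    (θ : ℂ) • (x • 1 + Matrix.single 0 1 (b : ℂ) + x • (Z - Matrix.single 0 1 (b / α : ℂ)))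
  have hφ : Set.MapsTo φ (ball 0 1) (spectralBall (m + 2)) := fun x hx =>
    smul_shear_mem_spectralBall hb0 hb1 hY (mem_ball_zero_iff.1 hx)
  have hα1' : (α : ℂ) ∈ ball (0 : ℂ) 1 := mem_ball_zero_iff.2 hα1
  have hφα : φ α = (θ * α : ℂ) • (1 + Z) := by
    simp only [φ, smul_sub, Matrix.smul_single, smul_eq_mul, mul_div_cancel₀ _ hαC, mul_smul,
      smul_add]
    abel
  have hφ0 : φ 0 = Matrix.single 0 1 (θ * b : ℂ) := by simp [φ, Matrix.smul_single]
  refine ⟨φ α, hφ hα1', ?_, hφ0 ▸ lempert_le hα1' (by fun_prop) hφ⟩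
  rw [hφα, charpoly_smul_one_add_of_charpoly_eq_diagonal hZD
    (mul_ne_zero (by exact_mod_cast hθ0.ne') hαC)]
  have hθm : θ * α * (m + 2) = (m + 7 / 4) * α := by rw [hθ]; linear_combination -4 * α * hbm
  simp only [← hθm, Complex.ofReal_mul, Complex.ofReal_add, Complex.ofReal_natCast,
    Complex.ofReal_ofNat]

end ShearDisc

section DerogatoryNilpotent

open scoped Matrix.Norms.Operator

theorem norm_pow_sub_pow_le {K : Type*} [NormedField K] {a b : K} {R : ℝ} (ha : ‖a‖ ≤ R)
    (hb : ‖b‖ ≤ R) (k : ℕ) : ‖a ^ k - b ^ k‖ ≤ k * R ^ (k - 1) * ‖a - b‖ := by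
  have hterm : ∀ i ∈ Finset.range k, ‖a ^ i * b ^ (k - 1 - i)‖ ≤ R ^ (k - 1) := fun i hi => by
    have hik : i + (k - 1 - i) = k - 1 := by have := Finset.mem_range.1 hi; omega
    rw [norm_mul, norm_pow, norm_pow, ← hik, pow_add, hik]
    gcongr
    exact pow_nonneg ((norm_nonneg a).trans ha) _
  have hsum := norm_sum_le_of_le _ hterm
  rw [Finset.sum_const, Finset.card_range, nsmul_eq_mul] at hsum
  rw [← (Commute.all a b).mul_geom_sum₂, norm_mul, mul_comm]
  gcongr

variable {ι : Type*} [Fintype ι] [DecidableEq ι]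

theorem eval_charpoly_sub_eval_charpoly {R : Type*} [CommRing R] (A B : Matrix ι ι R) (t : R) :
    A.charpoly.eval t - B.charpoly.eval t =
      ∑ i ∈ Finset.range (Fintype.card ι), (A.charpoly.coeff i - B.charpoly.coeff i) * t ^ i := by
  nontriviality R
  have hlead (M : Matrix ι ι R) : M.charpoly.coeff (Fintype.card ι) = 1 := by
    rw [← M.charpoly_natDegree_eq_dim]
    exact M.charpoly_monic.coeff_natDegree
  rw [Polynomial.eval_eq_sum_range, Polynomial.eval_eq_sum_range, A.charpoly_natDegree_eq_dim,
    B.charpoly_natDegree_eq_dim, Finset.sum_range_succ, Finset.sum_range_succ, hlead, hlead,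
    add_sub_add_right_eq_sub, ← Finset.sum_sub_distrib]
  simp only [sub_mul]

theorem exists_norm_le_of_isRoot_charpoly_of_coeff_close (ι : Type*) [Fintype ι] [DecidableEq ι]
    {η : ℝ} (hη : 0 < η) : ∃ δ > 0, ∀ A B : Matrix ι ι ℂ,
      (∀ t, A.charpoly.IsRoot t → ‖t‖ ≤ 1) →
      (∀ i < Fintype.card ι, ‖A.charpoly.coeff i - B.charpoly.coeff i‖ ≤ δ) →
      ∀ t, B.charpoly.IsRoot t → ‖t‖ ≤ 1 + η := by
  set N := Fintype.card ι
  have hq : 0 < (η / (1 + η)) ^ N := by positivity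
  refine ⟨(η / (1 + η)) ^ N / (N + 1), by positivity, fun A B hA hAB t ht => ?_⟩
  by_contra! hlt
  have ht1 : 1 ≤ ‖t‖ := by linarith
  have hupper : ‖A.charpoly.eval t‖ ≤ N * ((η / (1 + η)) ^ N / (N + 1)) * ‖t‖ ^ N := by
    rw [← sub_zero (A.charpoly.eval t), ← ht.eq_zero, eval_charpoly_sub_eval_charpoly, mul_assoc,
      ← nsmul_eq_mul, ← Finset.card_range N, ← Finset.sum_const]
    refine norm_sum_le_of_le _ fun i hi => ?_
    have hiN := Finset.mem_range.1 hi
    rw [norm_mul, norm_pow, Finset.card_range]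
    exact mul_le_mul (hAB i hiN) (pow_le_pow_right₀ ht1 hiN.le) (by positivity) (by positivity)
  have hlower : (η / (1 + η)) ^ N * ‖t‖ ^ N ≤ ‖A.charpoly.eval t‖ := by
    refine le_trans ?_ (pow_sub_le_norm_eval_charpoly ht1 hA)
    rw [← mul_pow]
    gcongr
    rw [div_mul_eq_mul_div, div_le_iff₀ (by linarith)]
    nlinarith
  have hlt : N * ((η / (1 + η)) ^ N / (N + 1)) < (η / (1 + η)) ^ N := by
    rw [← mul_div_assoc, div_lt_iff₀ (by positivity)]
    linarith
  exact (hlower.trans hupper).not_gt (mul_lt_mul_of_pos_right hlt (by positivity))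

theorem norm_trace_le_of_isRoot_charpoly_zero {A : Matrix ι ι ℂ} {R : ℝ}
    (h : ∀ t, A.charpoly.IsRoot t → ‖t‖ ≤ R) (h0 : A.charpoly.IsRoot 0) :
    ‖A.trace‖ ≤ (Fintype.card ι - 1) * R := by
  obtain ⟨s, hs⟩ := Multiset.exists_cons_of_mem
    ((Polynomial.mem_roots A.charpoly_monic.ne_zero).2 h0)
  have hcard : (s.card : ℝ) = Fintype.card ι - 1 := by
    rw [← A.charpoly_natDegree_eq_dim, (IsAlgClosed.splits A.charpoly).natDegree_eq_card_roots, hs,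
      Multiset.card_cons, Nat.cast_add_one, add_sub_cancel_right]
  have hle : ∀ r ∈ s.map norm, r ≤ R := fun r hr => by
    obtain ⟨t, ht, rfl⟩ := Multiset.mem_map.1 hr
    exact h t (Polynomial.isRoot_of_mem_roots (hs ▸ Multiset.mem_cons_of_mem ht))
  rw [Matrix.trace_eq_sum_roots_charpoly, hs, Multiset.sum_cons, zero_add, ← hcard,
    ← nsmul_eq_mul, ← Multiset.card_map norm s]
  exact (norm_multiset_sum_le s).trans (Multiset.sum_le_card_nsmul _ _ hle)

theorem eq_zero_of_det_eq_sub_mul {F : ℂ → Matrix ι ι ℂ} {f : ℂ → ℂ} {U : Set ℂ} {a : ℂ} {k : ℕ}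
    (hF : DifferentiableOn ℂ F U) (hU : U ∈ 𝓝 a) (hk : k < Fintype.card ι) (ha : F a ^ k = 0)
    (hf : ContinuousAt f a) (h : ∀ x, (F x).det = (x - a) * f x) : f a = 0 := by
  obtain ⟨H, hH, hFH⟩ := exists_eq_smul_of_apply_eq_zero (hF.fun_pow k) hU ha
  have hHc : ContinuousAt H a := (hH.differentiableAt hU).continuousAt
  have hpow {x : ℂ} (hx : x ≠ a) : f x ^ k = (x - a) ^ (Fintype.card ι - k) * (H x).det := by
    refine mul_left_cancel₀ (pow_ne_zero k (sub_ne_zero.2 hx)) ?_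
    rw [← mul_pow, ← h, ← Matrix.det_pow, hFH, Matrix.det_smul, ← mul_assoc, ← pow_add,
      Nat.add_sub_cancel' hk.le]
  have hlim : f a ^ k = (a - a) ^ (Fintype.card ι - k) * (H a).det :=
    ((ContinuousAt.eventuallyEq_nhds_iff_eventuallyEq_nhdsNE (hf.pow k)
      (g := fun x => (x - a) ^ (Fintype.card ι - k) * (H x).det) (by fun_prop)).1
        (eventually_mem_nhdsWithin.mono fun x hx => hpow hx)).eq_of_nhds
  rw [sub_self, zero_pow (Nat.sub_ne_zero_of_lt hk), zero_mul] at hlim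
  exact eq_zero_of_pow_eq_zero hlim

theorem eq_zero_of_coeff_zero_charpoly_eq_mul {F : ℂ → Matrix ι ι ℂ} {f : ℂ → ℂ} {U : Set ℂ}
    {α : ℂ} {k p : ℕ} (hF : DifferentiableOn ℂ F U) (hU : U ∈ 𝓝 0) (hk : k < Fintype.card ι)
    (h0 : F 0 ^ k = 0) (hα : α ≠ 0) (hf : ContinuousAt f 0)
    (h : ∀ x, (F x).charpoly.coeff 0 = (x - α) ^ p * (x * f x)) : f 0 = 0 := by
  have hdet := eq_zero_of_det_eq_sub_mul
    (f := fun x => (-1) ^ Fintype.card ι * ((x - α) ^ p * f x)) hF hU hk h0 (by fun_prop)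
    fun x => by
      rw [Matrix.det_eq_sign_charpoly_coeff, h]
      ring
  simpa only [mul_eq_zero, pow_ne_zero, ne_eq, neg_eq_zero, one_ne_zero, not_false_eq_true,
    zero_sub, hα, false_or] using hdet

variable {n : ℕ}

theorem exists_coeff_charpoly_rev_eq_pow_mul_mul {φ : ℂ → Matrix (Fin n) (Fin n) ℂ} {α : ℂ}
    {i₀ : Fin n} (hφ : DifferentiableOn ℂ φ (ball 0 1))
    (hm : Set.MapsTo φ (ball 0 1) (spectralBall n)) (h0 : (φ 0).charpoly = Polynomial.X ^ n)
    (hα0 : α ≠ 0) (hα : ‖α‖ ≤ 1 / 2) (hrow : ∀ k, k ≠ i₀ → ∀ l, φ α k l = 0) (j : Fin n) :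
    ∃ g : ℂ → ℂ, DifferentiableOn ℂ g (ball 0 1) ∧
      (∀ x, (φ x).charpoly.coeff j.rev = (x - α) ^ (j : ℕ) * (x * g x)) ∧
      ∀ x ∈ ball (0 : ℂ) 1, ‖g x‖ ≤ 4 * 8 ^ n := by
  have hαU : ball (0 : ℂ) 1 ∈ 𝓝 α := isOpen_ball.mem_nhds (mem_ball_zero_iff.2 (by linarith))
  obtain ⟨q, hq, hcq⟩ := exists_coeff_charpoly_eq_pow_mul hφ hαU hrow
    (i := j.rev) (by rw [Fintype.card_fin]; exact j.rev.is_lt.le)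
  have hj : Fintype.card (Fin n) - 1 - j.rev = j := by
    rw [Fintype.card_fin, Fin.val_rev]
    omega
  rw [hj] at hcq
  have hq0 : q 0 = 0 := by
    have h := hcq 0
    rw [h0, Polynomial.coeff_X_pow, if_neg j.rev.is_lt.ne, eq_comm, mul_eq_zero] at h
    exact h.resolve_left (pow_ne_zero _ (sub_ne_zero.2 hα0.symm))
  obtain ⟨g, hg, hqg⟩ := exists_eq_smul_of_apply_eq_zero hq (ball_mem_nhds 0 one_pos) hq0
  have hcoeff {x : ℂ} (hx : x ∈ ball (0 : ℂ) 1) : ‖(φ x).charpoly.coeff j.rev‖ ≤ 2 ^ n := by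
    have h := norm_coeff_charpoly_le_two_mul_pow le_rfl
      (fun t ht => (mem_spectralBall_iff.1 (hm hx) t ht).le) j.rev
    rwa [mul_one, Fintype.card_fin] at h
  have hqn {x : ℂ} (hx : x ∈ ball (0 : ℂ) 1) : ‖q x‖ ≤ 8 ^ n :=
    calc ‖q x‖ ≤ 4 ^ (j : ℕ) * 2 ^ n := norm_le_of_eq_pow_mul hα hq (fun x hx => hcoeff hx) hcq hx
      _ ≤ 4 ^ n * 2 ^ n := by gcongr; exacts [by norm_num, j.is_lt.le]
      _ = 8 ^ n := by rw [← mul_pow]; norm_num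
  refine ⟨g, hg, fun x => by rw [hcq, hqg, sub_zero, smul_eq_mul], fun x hx => ?_⟩
  have h := norm_le_of_eq_pow_mul (a := 0) (k := 1) (by simp) hg (fun x hx => hqn hx)
    (fun x => by rw [hqg, pow_one]) hx
  rwa [pow_one] at h

-- The characteristic polynomial of `x` times the companion matrix has coefficients
-- `x ^ (j + 1) * g j x`, which are close to those of `φ x`.
theorem eventually_norm_le_of_isRoot_charpoly_firstColumnCompanion (n : ℕ) (K : ℝ) {η : ℝ}
    (hη : 0 < η) : ∀ᶠ α : ℂ in 𝓝 0, ∀ (φ : ℂ → Matrix (Fin n) (Fin n) ℂ) (g : Fin n → ℂ → ℂ),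
      Set.MapsTo φ (ball 0 1) (spectralBall n) → (∀ j, DifferentiableOn ℂ (g j) (ball 0 1)) →
      (∀ (j : Fin n) x, (φ x).charpoly.coeff j.rev = (x - α) ^ (j : ℕ) * (x * g j x)) →
      (∀ j, ∀ x ∈ ball (0 : ℂ) 1, ‖g j x‖ ≤ K) → ∀ x ∈ ball (0 : ℂ) 1, ∀ t,
        (firstColumnCompanion fun j => -g j x).charpoly.IsRoot t → ‖t‖ ≤ 1 + η := by
  obtain ⟨δ, hδ0, hδ⟩ := exists_norm_le_of_isRoot_charpoly_of_coeff_close (Fin n) hη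
  have hsmall : ∀ᶠ α : ℂ in 𝓝 0, ‖α‖ < 1 ∧ ∀ j : Fin n, K * (j * 2 ^ ((j : ℕ) - 1) * ‖α‖) < δ := by
    refine Filter.Eventually.and ?_ (Filter.eventually_all.2 fun i => ?_) <;>
    exact ContinuousAt.eventually_lt (by fun_prop) continuousAt_const (by simp [hδ0])
  filter_upwards [hsmall] with α ⟨hα, hαδ⟩ φ g hm hg hφg hgK x hx t ht
  have hψ : DifferentiableOn ℂ (fun x => firstColumnCompanion fun j => -g j x) (ball 0 1) := by
    refine differentiableOn_matrix_iff.2 fun i j => ?_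
    simp only [firstColumnCompanion, Matrix.of_apply]
    have := hg i
    split_ifs <;> fun_prop
  refine norm_le_of_isRoot_charpoly_smul hψ (by positivity) (fun x hx => ?_) hx ht
  refine hδ (φ x) _ (fun t ht => (mem_spectralBall_iff.1 (hm hx) t ht).le) fun i hi => ?_
  rw [Fintype.card_fin] at hi
  obtain ⟨j, rfl⟩ : ∃ j : Fin n, (j.rev : ℕ) = i := ⟨Fin.rev ⟨i, hi⟩, by rw [Fin.rev_rev]⟩
  have hj : n - (j.rev : ℕ) = j + 1 := by rw [Fin.val_rev]; omega
  have hx1 : ‖x‖ < 1 := mem_ball_zero_iff.1 hx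
  rw [coeff_charpoly_smul _ _ (by rw [Fintype.card_fin]; exact hi.le), Fintype.card_fin, hj, hφg,
    coeff_charpoly_firstColumnCompanion, neg_neg]
  calc ‖(x - α) ^ (j : ℕ) * (x * g j x) - x ^ ((j : ℕ) + 1) * g j x‖
      = ‖x‖ * ‖g j x‖ * ‖(x - α) ^ (j : ℕ) - x ^ (j : ℕ)‖ := by
        rw [← norm_mul, ← norm_mul]
        ring_nf
    _ ≤ 1 * K * (j * 2 ^ ((j : ℕ) - 1) * ‖x - α - x‖) := by
        gcongr
        · exact mul_nonneg zero_le_one ((norm_nonneg _).trans (hgK j x hx))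
        · exact hgK j x hx
        · exact norm_pow_sub_pow_le (by linarith [norm_sub_le x α]) (by linarith) _
    _ ≤ δ := by
        rw [one_mul, sub_sub_cancel_left, norm_neg]
        exact (hαδ j).le

theorem norm_apply_zero_le_of_isRoot_charpoly_firstColumnCompanion {m : ℕ} {c : Fin (m + 1) → ℂ}
    {R : ℝ} (h : ∀ t, (firstColumnCompanion c).charpoly.IsRoot t → ‖t‖ ≤ R)
    (hc : c (Fin.last m) = 0) : ‖c 0‖ ≤ m * R := by
  have h0 : (firstColumnCompanion c).charpoly.IsRoot 0 := by
    have hlast := coeff_charpoly_firstColumnCompanion c (Fin.last m)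
    rwa [Fin.rev_last, hc, neg_zero, Fin.val_zero, Polynomial.coeff_zero_eq_eval_zero] at hlast
  have htrace : c 0 = (firstColumnCompanion c).trace := by
    have hzero := coeff_charpoly_firstColumnCompanion c 0
    rwa [charpoly_coeff_eq_sigma, sigma_zero_eq_trace, Fin.val_zero, pow_zero, one_mul, neg_inj,
      eq_comm] at hzero
  have hnorm := norm_trace_le_of_isRoot_charpoly_zero h h0
  rwa [← htrace, Fintype.card_fin, Nat.cast_add_one, add_sub_cancel_right] at hnorm

theorem eventually_norm_le_of_disc (m : ℕ) : ∀ᶠ α : ℂ in 𝓝[≠] 0,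
    ∀ (φ : ℂ → Matrix (Fin (m + 1)) (Fin (m + 1)) ℂ) (i₀ : Fin (m + 1)) (t : ℂ),
      DifferentiableOn ℂ φ (ball 0 1) → Set.MapsTo φ (ball 0 1) (spectralBall (m + 1)) →
      (φ 0).charpoly = Polynomial.X ^ (m + 1) → φ 0 ^ m = 0 →
      (φ α = Matrix.diagonal fun k => if k = i₀ then t else 0) → ‖t‖ ≤ (m + 1 / 2) * ‖α‖ := by
  set K : ℝ := 4 * 8 ^ (m + 1)
  set η : ℝ := 1 / (8 * (m + 1))
  have hη : m * η ≤ 1 / 8 := by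
    rw [mul_one_div, div_le_div_iff₀ (by positivity) (by norm_num)]
    linarith
  have hsmall : ∀ᶠ α : ℂ in 𝓝 0, ‖α‖ < 1 / 2 ∧ 2 * K * ‖α‖ < 3 / 8 := by
    refine Filter.Eventually.and ?_ ?_ <;>
    exact ContinuousAt.eventually_lt (by fun_prop) continuousAt_const (by norm_num)
  filter_upwards [nhdsWithin_le_nhds hsmall, eventually_mem_nhdsWithin, nhdsWithin_le_nhds
    (eventually_norm_le_of_isRoot_charpoly_firstColumnCompanion (m + 1) K
      (by positivity : 0 < η))] with α ⟨hα, hαK⟩ hα0 hroot φ i₀ t hφ hm h0 h0' hφα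
  choose g hg hφg hgK using exists_coeff_charpoly_rev_eq_pow_mul_mul (i₀ := i₀) hφ hm h0 hα0 hα.le
    fun k hk l => by rw [hφα, Matrix.diagonal_apply, if_neg hk, ite_self]
  have h0m : (0 : ℂ) ∈ ball (0 : ℂ) 1 := mem_ball_self one_pos
  have hlast : g (Fin.last m) 0 = 0 := by
    have hcont := ((hg (Fin.last m)).differentiableAt (ball_mem_nhds 0 one_pos)).continuousAt
    refine eq_zero_of_coeff_zero_charpoly_eq_mul (p := m) hφ (ball_mem_nhds 0 one_pos)
      (by rw [Fintype.card_fin]; exact m.lt_succ_self) h0' hα0 hcont fun x => ?_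
    simpa only [Fin.rev_last, Fin.val_zero, Fin.val_last] using hφg (Fin.last m) x
  have hg0 : ‖g 0 0‖ ≤ m + 1 / 8 := by
    have h := norm_apply_zero_le_of_isRoot_charpoly_firstColumnCompanion
      (hroot φ g hm hg hφg hgK 0 h0m) (by rw [hlast, neg_zero])
    rw [norm_neg] at h
    linarith
  have hlip : ‖g 0 α - g 0 0‖ ≤ 2 * K * ‖α‖ := by
    have h : dist (g 0 α) (g 0 0) ≤ 2 * K / 1 * dist α 0 :=
      Complex.dist_le_div_mul_dist_of_mapsTo_ball (hg 0) (fun x hx => by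
        rw [mem_closedBall, dist_eq_norm]
        linarith [norm_sub_le (g 0 x) (g 0 0), hgK 0 x hx, hgK 0 0 h0m])
        (mem_ball_zero_iff.2 (by linarith))
    rwa [dist_eq_norm, dist_zero_right, div_one] at h
  have ht : t = -(α * g 0 α) := by
    have h := hφg 0 α
    rw [charpoly_coeff_eq_sigma, sigma_zero_eq_trace, hφα, trace_diagonal_ite, Fin.val_zero,
      pow_zero, one_mul, mul_zero, add_zero, pow_zero, one_mul] at h
    rw [← h, neg_neg]
  rw [ht, norm_neg, norm_mul, mul_comm]
  gcongr
  linarith [norm_sub_norm_le (g 0 α) (g 0 0)]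

theorem LempertInvariant.false_of_pow_eq_zero {m : ℕ} {M : Matrix (Fin (m + 2)) (Fin (m + 2)) ℂ}
    (h : LempertInvariant M) (hM : M.charpoly = Polynomial.X ^ (m + 2)) (hM0 : M ≠ 0)
    (hM1 : M ^ (m + 1) = 0) : False := by
  obtain ⟨c, hc, hup⟩ := exists_lempert_single_le m
  set κ : ℝ := (m + 7 / 4) / (m + 3 / 2) with hκ
  have hκ1 : 1 < κ := by rw [hκ, one_lt_div (by positivity)]; linarith
  obtain ⟨ε, hε, hlow⟩ := Metric.eventually_nhds_iff.1
    (eventually_nhdsWithin_iff.1 (eventually_norm_le_of_disc (m + 1)))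
  have haε : ∀ᶠ a : ℝ in 𝓝[>] 0, a * κ < ε := nhdsWithin_le_nhds
    (ContinuousAt.eventually_lt (by fun_prop) continuousAt_const (by rwa [zero_mul]))
  obtain ⟨a, ⟨B, hB, hBc, hBl⟩, haκ, ha0⟩ :=
    (hup.and (haε.and eventually_mem_nhdsWithin)).exists
  rw [Set.mem_Ioi] at ha0
  have hlt : lempert (spectralBall (m + 2)) M (Matrix.diagonal fun k : Fin (m + 2) =>
      if k = 0 then (((m + 7 / 4) * a : ℝ) : ℂ) else 0) < ENNReal.ofReal (a * κ) := by
    rw [← h B _ hB hBc]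
    refine ((lempert_le_lempert_single hM hM0 zero_ne_one hc).trans hBl).trans_lt ?_
    rw [← ofReal_norm, Complex.norm_of_nonneg ha0.le,
      ENNReal.ofReal_lt_ofReal_iff (by positivity)]
    exact lt_mul_of_one_lt_right ha0 hκ1
  obtain ⟨α, -, hα0, hαc, φ, hφ, hm, h0, h1⟩ := exists_disc_of_lempert_lt hlt
  rw [← ofReal_norm, ENNReal.ofReal_lt_ofReal_iff (by positivity)] at hαc
  have hle := hlow (y := α) (by rw [dist_zero_right]; linarith) hα0 φ 0 _ hφ hm (by rw [h0, hM])
    (by rw [h0, hM1]) h1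
  rw [Complex.norm_of_nonneg (by positivity)] at hle
  have hmul : (m + 3 / 2) * (a * κ) = (m + 7 / 4) * a := by
    rw [hκ]
    field_simp
  push_cast at hle
  nlinarith [m.cast_nonneg (α := ℝ)]

end DerogatoryNilpotent

section Main

open Polynomial (X C)

variable {n : ℕ} {A : Matrix (Fin n) (Fin n) ℂ}

theorem charpoly_eq_sq_of_roots_eq {ι K : Type*} [Fintype ι] [DecidableEq ι] [Field K]
    [IsAlgClosed K] {A : Matrix ι ι K} {μ : K} (h : A.charpoly.roots = {μ, μ}) :
    A.charpoly = (X - C μ) ^ 2 := by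
  rw [(IsAlgClosed.splits A.charpoly).eq_prod_roots_of_monic A.charpoly_monic, h,
    Multiset.insert_eq_cons, Multiset.map_cons, Multiset.map_singleton, Multiset.prod_cons,
    Multiset.prod_singleton, sq]

theorem IsCyclicTwoDouble.continuousWithinAt_lempert (h : IsCyclicTwoDouble A)
    (hA : A ∈ spectralBall n) {B : Matrix (Fin n) (Fin n) ℂ} (hB : B ∈ spectralBall n) :
    ContinuousWithinAt (fun p : Matrix (Fin n) (Fin n) ℂ × Matrix (Fin n) (Fin n) ℂ =>
      lempert (spectralBall n) p.1 p.2) (spectralBall n ×ˢ spectralBall n) (A, B) := by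
  obtain ⟨rfl, hcyc, μ, hμ⟩ := h
  exact continuousWithinAt_lempert_two hA hcyc (charpoly_eq_sq_of_roots_eq hμ) hB

theorem IsCyclicTwoDouble.lempert_eq_symPolydisk (h : IsCyclicTwoDouble A)
    (hA : A ∈ spectralBall n) {B : Matrix (Fin n) (Fin n) ℂ} (hB : B ∈ spectralBall n) :
    lempert (spectralBall n) A B = lempert (symPolydisk n) (sigma A) (sigma B) := by
  obtain ⟨rfl, hcyc, μ, hμ⟩ := h
  exact lempert_eq_symPolydisk_two hA hcyc (charpoly_eq_sq_of_roots_eq hμ) hB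

theorem isScalarMatrix_of_fin_one (A : Matrix (Fin 1) (Fin 1) ℂ) : IsScalarMatrix A :=
  ⟨A 0 0, by ext i j; simp [Subsingleton.elim i 0, Subsingleton.elim j 0]⟩

theorem LempertInvariant.isScalarMatrix_of_charpoly_eq_pow (hn : 3 ≤ n) (h : LempertInvariant A)
    (hA : A ∈ spectralBall n) {μ : ℂ} (hμ : ‖μ‖ < 1) (hc : A.charpoly = (X - C μ) ^ n) :
    IsScalarMatrix A := by
  obtain ⟨m, rfl⟩ : ∃ m, n = m + 2 := ⟨n - 2, by omega⟩
  have hinv := lempertInvariant_matrixMoebius h hμ hA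
  have hX := charpoly_matrixMoebius_of_eq_pow hμ hA hc
  by_contra hs
  by_cases hpow : matrixMoebius μ A ^ (m + 1) = 0
  · exact hinv.false_of_pow_eq_zero hX
      (fun h0 => hs ⟨μ, (matrixMoebius_eq_zero_iff hμ hA).1 h0⟩) hpow
  · exact hinv.false_of_isCyclicMatrix hn hX
      (isCyclicMatrix_of_pow_ne_zero hpow (pow_eq_zero_of_charpoly_eq_X_pow hX))

theorem LempertInvariant.isScalarMatrix_or_isCyclicTwoDouble [Nonempty (Fin n)]
    (h : LempertInvariant A) (hA : A ∈ spectralBall n) :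
    IsScalarMatrix A ∨ IsCyclicTwoDouble A := by
  obtain ⟨μ, hμ, hc⟩ := h.exists_charpoly_eq_pow hA
  by_cases hs : IsScalarMatrix A
  · exact Or.inl hs
  rcases lt_trichotomy n 2 with hn | rfl | hn
  · obtain rfl : n = 1 := by have := Fin.pos_iff_nonempty.2 ‹Nonempty (Fin n)›; omega
    exact Or.inl (isScalarMatrix_of_fin_one A)
  · refine Or.inr ⟨rfl, isCyclicMatrix_of_not_isScalarMatrix hs, μ, ?_⟩
    rw [hc, Polynomial.roots_pow, Polynomial.roots_X_sub_C, two_nsmul]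
    rfl
  · exact Or.inl (h.isScalarMatrix_of_charpoly_eq_pow hn hA hμ hc)

theorem continuousOn_lempert_of_continuousWithinAt (hA : A ∈ spectralBall n)
    (h : ∀ B ∈ spectralBall n, ContinuousWithinAt
      (fun p : Matrix (Fin n) (Fin n) ℂ × Matrix (Fin n) (Fin n) ℂ =>
        lempert (spectralBall n) p.1 p.2) (spectralBall n ×ˢ spectralBall n) (A, B)) :
    ContinuousOn (fun B => lempert (spectralBall n) A B) (spectralBall n) := fun B hB =>
  (h B hB).comp (f := fun B => (A, B)) (by fun_prop) fun _ hY => ⟨hA, hY⟩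

theorem lempertInvariant_of_lempert_eq_symPolydisk
    (h : ∀ B ∈ spectralBall n,
      lempert (spectralBall n) A B = lempert (symPolydisk n) (sigma A) (sigma B)) :
    LempertInvariant A := fun B B' hB hBB' => by
  rw [h B hB, h B' (mem_spectralBall_of_charpoly_eq hBB' hB), charpoly_eq_iff_sigma_eq.1 hBB']

end Main

theorem theorem1 (n : ℕ) (hn : 1 ≤ n) (A : Matrix (Fin n) (Fin n) ℂ)
    (hA : A ∈ spectralBall n) :
    (ContinuousOn (fun B => lempert (spectralBall n) A B) (spectralBall n) ↔
      IsScalarMatrix A ∨ IsCyclicTwoDouble A) ∧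
    (2 ≤ n → List.TFAE [
      ∀ B ∈ spectralBall n,
        ContinuousWithinAt
          (fun p : Matrix (Fin n) (Fin n) ℂ × Matrix (Fin n) (Fin n) ℂ =>
            lempert (spectralBall n) p.1 p.2)
          (spectralBall n ×ˢ spectralBall n) (A, B),
      ∀ B ∈ spectralBall n,
        lempert (spectralBall n) A B = lempert (symPolydisk n) (sigma A) (sigma B),
      IsCyclicTwoDouble A]) := by
  have : Nonempty (Fin n) := ⟨⟨0, hn⟩⟩
  have hinv (h : LempertInvariant A) := h.isScalarMatrix_or_isCyclicTwoDouble hA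
  refine ⟨⟨fun h => hinv (lempertInvariant_of_continuousOn h), ?_⟩, fun hn2 => ?_⟩
  · rintro (h | h)
    · exact h.continuousOn_lempert hA
    · exact continuousOn_lempert_of_continuousWithinAt hA fun B hB =>
        h.continuousWithinAt_lempert hA hB
  · tfae_have 1 → 3 := fun h => by
      refine (hinv (lempertInvariant_of_continuousOn
        (continuousOn_lempert_of_continuousWithinAt hA h))).resolve_left fun hs => ?_
      obtain ⟨B, hB, hBn⟩ := hs.exists_not_continuousWithinAt_lempert hn2 hA
      exact hBn (h B hB)
    tfae_have 2 → 3 := fun h => by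
      refine (hinv (lempertInvariant_of_lempert_eq_symPolydisk h)).resolve_left fun hs => ?_
      obtain ⟨B, hB, hBn⟩ := hs.exists_lempert_ne_symPolydisk hn2 hA
      exact hBn (h B hB)
    tfae_have 3 → 1 := fun h B hB => h.continuousWithinAt_lempert hA hB
    tfae_have 3 → 2 := fun h B hB => h.lempert_eq_symPolydisk hA hB
    tfae_finish
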